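/- Let $K(x)=\dfrac{x_2^2-x_1^2}{2\pi|x|^4}$ for $x\in\mathbb R^2\setminus\{0\}$, let $\Omega\subset\mathbb R^2$ be a non-empty bounded open set, and let $A_\Omega$ be the operator of convolution with $\mathrm{p.v.}\,K$ on $L^2(\Omega)$, that is, the unique bounded operator on $L^2(\Omega)$ (part of the claim is that it exists) with $A_\Omega u(x)=\mathrm{p.v.}\!\int_\Omega K(x-y)u(y)\,dy$ for almost every $x\in\Omega$, for all $u\in C_c^\infty(\Omega)$. For $N\ge1$ and arbitrary origins $a^N\in\mathbb R^2$ let $x^N_m=a^N+m/N$ $(m\in\mathbb Z^2)$ and $\omega^N=\{m\in\mathbb Z^2 : x^N_m\in\Omega\}$, and let $T^N$ be the matrix with entries $N^{-2}K(x^N_m-x^N_n)$ for $m\ne n$ and $0$ for $m=n$ $(m,n\in\omega^N)$. Let $$F(\tau)=\sum_{m\in\mathbb Z^2,\ m\neq0}K(m)\,e^{im\cdot\tau},$$ where the series is summed over the squares $\max(|m_1|,|m_2|)\le M$, $M\to\infty$. Then: 1. The series converges for every $\tau\in\mathbb R^2$, and there is a number $\Lambda_+>\frac12$ such that $F([-\pi,\pi]^2)=\mathcal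 C:=[-\Lambda_+,\Lambda_+]$. 2. For every $\lambda\in\mathbb C\setminus\mathcal C$ and every $N\ge1$, the delta-delta system $$\lambda u_m-N^{-2}\sum_{n\in\omega^N,\,n\ne m}K(x^N_m-x^N_n)u_n=f_m\quad(m\in\omega^N)$$ has a unique solution for every right-hand side $f$, and $\|(\lambda\,\mathrm{Id}-T^N)^{-1}\|_{\mathcal L(\ell^2(\omega^N))}\le \operatorname{dist}(\lambda,\mathcal C)^{-1}$. 3. For every $\lambda\in[-\Lambda_+,-\frac12)\cup(\frac12,\Lambda_+]$ (a non-empty set, by 1), the integral equation $(\lambda\,\mathrm{Id}-A_\Omega)u=f$ is well posed in $L^2(\Omega)$ (for every $f\in L^2(\Omega)$ there is exactly one solution $u\in L^2(\Omega)$, and $\|u\|\le C\|f\|$ with $C$ independent of $f$), but the delta-delta scheme is unstable: there are no $C$ and $N_0$ such that for all $N\ge N_0$ the matrix $\lambda\,\mathrm{Id}-T^N$ is invertible with $\|(\lambda\,\mathrm{Id}-T^N)^{-1}\|_{\mathcal L(\ell^2(\omega^N))}\le C$. -/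

import Mathlib

open scoped ContDiff Topology

namespace DeltaDelta

/-- The plane with its Euclidean norm. -/
abbrev Plane : Type := EuclideanSpace ℝ (Fin 2)

/-- The strongly singular kernel `K(x) = (x₂² - x₁²) / (2π |x|⁴)`; coordinates are indexed by
`0, 1`. Its value at the origin is never used. -/
noncomputable def kernel (x : Plane) : ℝ :=
  ((x 1) ^ 2 - (x 0) ^ 2) / (2 * Real.pi * ‖x‖ ^ 4)

/-! ### The singular integral operator on `L²(Ω)` -/

/-- `L²(Ω)` with Lebesgue measure and complex values. -/
abbrev L2 (Ω : Set Plane) : Type :=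
  MeasureTheory.Lp ℂ 2 ((MeasureTheory.volume : MeasureTheory.Measure Plane).restrict Ω)

/-- The integral `∫_{y ∈ Ω, |x - y| > ε} K(x - y) φ(y) dy`, whose limit as `ε → 0` is the
Cauchy principal value. -/
noncomputable def truncatedIntegral (Ω : Set Plane) (φ : Plane → ℂ) (x : Plane) (ε : ℝ) : ℂ :=
  ∫ y in {y : Plane | y ∈ Ω ∧ ε < ‖x - y‖}, (kernel (x - y) : ℂ) * φ y

/-- `A` is the operator `A_Ω` of convolution with `p.v. K` on `L²(Ω)`: the bounded operator on
`L²(Ω)` that is given by the Cauchy principal value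
`(A φ)(x) = p.v. ∫_Ω K(x - y) φ(y) dy` for all test functions `φ ∈ C_c^∞(Ω)`.
(Test functions are dense in `L²(Ω)`, so that there is at most one such operator.) -/
def IsSingularIntegralOperator (Ω : Set Plane) (A : L2 Ω →L[ℂ] L2 Ω) : Prop :=
  ∀ φ : Plane → ℂ, ContDiff ℝ ∞ φ → HasCompactSupport φ → tsupport φ ⊆ Ω →
    ∀ u : L2 Ω, u =ᵐ[MeasureTheory.volume.restrict Ω] φ →
      ∀ᵐ x ∂(MeasureTheory.volume.restrict Ω),
        Filter.Tendsto (fun ε : ℝ => truncatedIntegral Ω φ x ε) (𝓝[>] 0) (𝓝 ((A u : L2 Ω) x))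

/-- The equation `lam u - A u = f` is well posed in `L²(Ω)`: for every `f` there is exactly one
solution `u`, and it depends continuously on `f`. -/
def WellPosed {Ω : Set Plane} (A : L2 Ω →L[ℂ] L2 Ω) (lam : ℂ) : Prop :=
  (∀ f : L2 Ω, ∃! u : L2 Ω, lam • u - A u = f) ∧
    ∃ C : ℝ, ∀ u f : L2 Ω, lam • u - A u = f → ‖u‖ ≤ C * ‖f‖

/-! ### The delta-delta discretization -/

/-- The integer vector `m` as a point of the plane. -/
noncomputable def latticePoint (m : Fin 2 → ℤ) : Plane :=
  WithLp.toLp 2 (fun i => (m i : ℝ))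

/-- The grid point `x_m = a + m / N`. -/
noncomputable def gridPoint (a : Plane) (N : ℕ+) (m : Fin 2 → ℤ) : Plane :=
  a + ((N : ℕ) : ℝ)⁻¹ • latticePoint m

theorem finite_gridPoint_mem {Ω : Set Plane} (hΩ : Bornology.IsBounded Ω) (a : Plane) (N : ℕ+) :
    {m : Fin 2 → ℤ | gridPoint a N m ∈ Ω}.Finite := by
  obtain ⟨R, hR⟩ := hΩ.subset_closedBall a
  have hN : (0 : ℝ) < ((N : ℕ) : ℝ) := by exact_mod_cast N.pos
  refine (Set.finite_Icc (fun _ : Fin 2 => -⌈((N : ℕ) : ℝ) * R⌉)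
    (fun _ : Fin 2 => ⌈((N : ℕ) : ℝ) * R⌉)).subset ?_
  intro m hm
  have h1 : ‖((N : ℕ) : ℝ)⁻¹ • latticePoint m‖ ≤ R := by
    have := hR hm
    simpa [gridPoint, Metric.mem_closedBall, dist_eq_norm] using this
  rw [norm_smul, Real.norm_of_nonneg (inv_nonneg.2 hN.le), inv_mul_le_iff₀ hN] at h1
  have h2 : ∀ i, |(m i : ℝ)| ≤ ((N : ℕ) : ℝ) * R := by
    intro i
    have h3 := PiLp.norm_apply_le (latticePoint m) i
    simp only [latticePoint, Real.norm_eq_abs] at h3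
    exact h3.trans h1
  have h4 : ∀ i, |m i| ≤ ⌈((N : ℕ) : ℝ) * R⌉ := by
    intro i
    have h5 : ((|m i| : ℤ) : ℝ) ≤ (⌈((N : ℕ) : ℝ) * R⌉ : ℝ) := by
      rw [Int.cast_abs]
      exact (h2 i).trans (Int.le_ceil _)
    exact_mod_cast h5
  exact ⟨fun i => (abs_le.1 (h4 i)).1, fun i => (abs_le.1 (h4 i)).2⟩

/-- The finite index set `ω^N = {m ∈ ℤ² | x_m ∈ Ω}` of the grid points in the bounded set `Ω`. -/
noncomputable def gridIndex {Ω : Set Plane} (hΩ : Bornology.IsBounded Ω) (a : Plane) (N : ℕ+) :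
    Finset (Fin 2 → ℤ) :=
  (finite_gridPoint_mem hΩ a N).toFinset

/-- The system matrix `T^N`, with entries `N⁻² K(x_m - x_n)` off the diagonal and `0` on it. -/
noncomputable def systemMatrix {Ω : Set Plane} (hΩ : Bornology.IsBounded Ω) (a : Plane) (N : ℕ+) :
    Matrix (gridIndex hΩ a N) (gridIndex hΩ a N) ℂ :=
  Matrix.of fun m n =>
    if m = n then 0
    else (((((N : ℕ) : ℝ) ^ 2)⁻¹ * kernel (gridPoint a N m - gridPoint a N n) : ℝ) : ℂ)

/-- The operator norm of `(lam - T^N)⁻¹` on `ℓ²(ω^N)` (meaningful if `lam - T^N` is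
invertible). -/
noncomputable def resolventNorm {Ω : Set Plane} (hΩ : Bornology.IsBounded Ω) (a : Plane) (N : ℕ+)
    (lam : ℂ) : ℝ :=
  ‖Matrix.toEuclideanCLM (n := gridIndex hΩ a N) (𝕜 := ℂ) (lam • 1 - systemMatrix hΩ a N)⁻¹‖

/-- The discretization with grid origins `a N` is stable at `lam`: for all sufficiently large `N`
the matrix `lam - T^N` is invertible, and the `ℓ²` operator norms of the inverses are bounded
uniformly in `N`. -/
def Stable {Ω : Set Plane} (hΩ : Bornology.IsBounded Ω) (a : ℕ+ → Plane) (lam : ℂ) : Prop :=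
  ∃ C : ℝ, ∃ N₀ : ℕ+, ∀ N : ℕ+, N₀ ≤ N →
    IsUnit (lam • 1 - systemMatrix hΩ (a N) N) ∧ resolventNorm hΩ (a N) N lam ≤ C

/-! ### The numerical symbol -/

/-- The partial sum over `m ∈ {-M, …, M}²`, `m ≠ 0`, of the Fourier series
`∑_{m ≠ 0} K(m) e^{i m·τ}`. -/
noncomputable def symbolPartialSum (τ : Fin 2 → ℝ) (M : ℕ) : ℂ :=
  ∑ m ∈ (Finset.Icc (fun _ : Fin 2 => -(M : ℤ)) (fun _ : Fin 2 => (M : ℤ))).erase 0,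
    (kernel (latticePoint m) : ℂ) *
      Complex.exp (Complex.I * ((∑ i, (m i : ℝ) * τ i : ℝ) : ℂ))

/-- The symbol `F(τ) = ∑_{m ≠ 0} K(m) e^{i m·τ}` of the infinite Toeplitz matrix. The series does
not converge absolutely; it is summed over squares. As the coefficients are square summable, this
agrees almost everywhere with the sum of the series in `L²([-π, π]²)`. -/
noncomputable def symbol (τ : Fin 2 → ℝ) : ℂ :=
  Filter.atTop.limUnder (symbolPartialSum τ)

/-- The period square `Q = [-π, π]²`. -/
def periodSquare : Set (Fin 2 → ℝ) :=
  Set.Icc (fun _ => -Real.pi) (fun _ => Real.pi)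

/-- `Λ₊`, the maximum over `Q` of (the real part of) the symbol. -/
noncomputable def lambdaPlus : ℝ :=
  sSup ((fun τ => (symbol τ).re) '' periodSquare)

/-- The segment `[-Λ₊, Λ₊]`, as a subset of the complex plane. -/
def segmentC : Set ℂ :=
  (fun t : ℝ => (t : ℂ)) '' Set.Icc (-lambdaPlus) lambdaPlus

end DeltaDelta

open DeltaDelta

namespace DeltaDelta

open Filter

/-! The symbol is made accessible by multiplying it with the symbol `4 - 2 cos τ₀ - 2 cos τ₁` of
minus the discrete Laplacian. The kernel is the real part of a multiple of `1 / z ^ 2`, so the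
differenced coefficients are `O(|m|⁻⁶)` and their Fourier series converges absolutely. Partial sums
over boxes change by `o(1)` under a unit shift, hence the original series converges to the quotient
wherever the Laplacian symbol is nonzero. At its zeros, the points of `2πℤ²`, the partial sums
vanish because exchanging the coordinates changes the sign of the kernel.

The symbol is continuous off `2πℤ²`. At the origin its modulus has upper limit at most
`|laplaceMoment| / 2` (`eventually_abs_symbol_lt`). Summing the kernel over rows turns this bound
and the value at `(π, 0)` into rapidly convergent sums: row zero gives `π / 6`, the other rows are
negative and of the order of powers of `e^{-2π}`. They push the bound at the origin below `π / 6`,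
whereas the alternating signs at `(π, 0)` push the value there up to at least `π / 6 > 1 / 2`. Hence
the maximum is attained away from the discontinuity. The swap gives the symmetric minimum, and
connectedness of the plane minus a countable set fills in the segment (`symbol_image`).

By homogeneity of the kernel, the system matrix is a finite section of one Toeplitz matrix, whose
quadratic form is integration of the symbol against `|trigPoly u|²` on the torus. Its numerical
range therefore lies in the segment, which gives the resolvent bound (`infDist_mul_norm_le`).
Conversely, each point of the segment is a value of the symbol at a point of continuity. Powers of a
trigonometric polynomial peaking there are approximate eigenvectors; modulation moves their
frequencies into the index set of a fine grid, so no uniform inverse bound can hold (`not_stable`).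

The continuous operator has norm at most `1 / 2`. For a regularised fundamental solution, let `a`
and `b` be the pure second derivatives of the potential of `φ`. Then `a - b` is twice the
regularised singular integral, `a + b` is a mollification of `φ`, and two integrations by parts show
that the real part of `∫ a * conj b` is nonnegative. Thus `‖a - b‖ ≤ ‖a + b‖ ≤ ‖φ‖` in `L²`. Fatou's
lemma and density carry the bound to the principal value operator, and a Neumann series gives
well-posedness for `|lam| > 1 / 2`. -/

/-! ### Lattice coefficients, characters and boxes. -/

/-- The coefficients of the symbol. -/
noncomputable def latticeCoeff (m : Fin 2 → ℤ) : ℝ := kernel (latticePoint m)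

/-- The integer vector `m` as a complex number. -/
noncomputable def latticeComplex (m : Fin 2 → ℤ) : ℂ := (m 0 : ℂ) + (m 1 : ℂ) * Complex.I

/-- The character `m ↦ exp (i m·τ)`. -/
noncomputable def latticeChar (τ : Fin 2 → ℝ) (m : Fin 2 → ℤ) : ℂ :=
  Complex.exp (Complex.I * ((∑ i, (m i : ℝ) * τ i : ℝ) : ℂ))

/-- The box `{-M, …, M}²`. -/
noncomputable def latticeBox (M : ℕ) : Finset (Fin 2 → ℤ) :=
  Finset.Icc (fun _ => -(M : ℤ)) (fun _ => (M : ℤ))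

theorem norm_latticeChar (τ : Fin 2 → ℝ) (m : Fin 2 → ℤ) : ‖latticeChar τ m‖ = 1 := by
  rw [latticeChar, mul_comm, Complex.norm_exp_ofReal_mul_I]

theorem latticeChar_add (τ : Fin 2 → ℝ) (m n : Fin 2 → ℤ) :
    latticeChar τ (m + n) = latticeChar τ m * latticeChar τ n := by
  simp only [latticeChar, ← Complex.exp_add, Fin.sum_univ_two, Pi.add_apply]
  congr 1
  push_cast
  ring

theorem latticeChar_neg (τ : Fin 2 → ℝ) (m : Fin 2 → ℤ) :
    latticeChar τ (-m) = (starRingEnd ℂ) (latticeChar τ m) := by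
  simp only [latticeChar, ← Complex.exp_conj]
  congr 1
  simp [Fin.sum_univ_two]
  ring

theorem latticeChar_sub_mul (τ : Fin 2 → ℝ) (m s : Fin 2 → ℤ) :
    latticeChar τ (m - s) * latticeChar τ s = latticeChar τ m := by
  rw [← latticeChar_add, sub_add_cancel]

theorem norm_latticePoint_sq (m : Fin 2 → ℤ) :
    ‖latticePoint m‖ ^ 2 = (m 0 : ℝ) ^ 2 + (m 1 : ℝ) ^ 2 := by
  simp [EuclideanSpace.norm_sq_eq, latticePoint, Fin.sum_univ_two]

theorem latticeCoeff_eq (m : Fin 2 → ℤ) :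
    latticeCoeff m =
      ((m 1 : ℝ) ^ 2 - (m 0 : ℝ) ^ 2) / (2 * Real.pi * ((m 0 : ℝ) ^ 2 + (m 1 : ℝ) ^ 2) ^ 2) := by
  rw [latticeCoeff, kernel, show ‖latticePoint m‖ ^ 4 = (‖latticePoint m‖ ^ 2) ^ 2 by ring,
    norm_latticePoint_sq]
  rfl

theorem latticeCoeff_zero : latticeCoeff 0 = 0 := by
  simp [latticeCoeff_eq]

theorem latticeCoeff_neg (m : Fin 2 → ℤ) : latticeCoeff (-m) = latticeCoeff m := by
  simp [latticeCoeff_eq]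

theorem normSq_latticeComplex (m : Fin 2 → ℤ) :
    Complex.normSq (latticeComplex m) = (m 0 : ℝ) ^ 2 + (m 1 : ℝ) ^ 2 := by
  simp [latticeComplex, Complex.normSq_apply]
  ring

/-- The holomorphic form of the kernel: differences of the coefficients become differences of the
rational function `1 / z ^ 2`. -/
theorem latticeCoeff_eq_re (m : Fin 2 → ℤ) :
    latticeCoeff m = -(2 * Real.pi)⁻¹ * (1 / latticeComplex m ^ 2).re := by
  rw [latticeCoeff_eq, one_div, Complex.inv_re, map_pow, normSq_latticeComplex]
  simp only [latticeComplex, pow_two, Complex.mul_re, Complex.add_re, Complex.add_im,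
    Complex.mul_im, Complex.I_re, Complex.I_im, Complex.intCast_re, Complex.intCast_im]
  rw [div_eq_mul_inv, div_eq_mul_inv, mul_inv]
  ring

theorem norm_le_norm_latticeComplex (m : Fin 2 → ℤ) : ‖m‖ ≤ ‖latticeComplex m‖ := by
  refine (pi_norm_le_iff_of_nonneg (norm_nonneg _)).2 fun i => ?_
  have h : ‖latticeComplex m‖ ^ 2 = (m 0 : ℝ) ^ 2 + (m 1 : ℝ) ^ 2 := by
    rw [← Complex.normSq_eq_norm_sq, normSq_latticeComplex]
  rw [Int.norm_eq_abs]
  refine abs_le_of_sq_le_sq ?_ (norm_nonneg _)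
  rw [h]
  fin_cases i <;> simp <;> positivity

theorem abs_latticeCoeff_mul_le (m : Fin 2 → ℤ) : |latticeCoeff m| * ‖m‖ ^ 2 ≤ 1 := by
  have hpi : (2 * Real.pi)⁻¹ ≤ 1 := inv_le_one_of_one_le₀ (by linarith [Real.pi_gt_three])
  have h1 : |latticeCoeff m| ≤ 1 / ‖latticeComplex m‖ ^ 2 := by
    rw [latticeCoeff_eq_re, abs_mul, abs_neg, abs_of_pos (by positivity)]
    have := Complex.abs_re_le_norm (1 / latticeComplex m ^ 2)
    rw [norm_div, norm_pow, norm_one] at this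
    calc _ ≤ 1 * (1 / ‖latticeComplex m‖ ^ 2) := by gcongr
      _ = _ := one_mul _
  calc |latticeCoeff m| * ‖m‖ ^ 2
      ≤ 1 / ‖latticeComplex m‖ ^ 2 * ‖latticeComplex m‖ ^ 2 := by
        gcongr
        exact norm_le_norm_latticeComplex m
    _ ≤ 1 := by rw [one_div]; exact inv_mul_le_one

theorem abs_latticeCoeff_le_one (m : Fin 2 → ℤ) : |latticeCoeff m| ≤ 1 := by
  rcases eq_or_ne m 0 with rfl | hm
  · simp [latticeCoeff_zero]
  have h1 : 1 ≤ ‖m‖ := by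
    obtain ⟨i, hi⟩ := Function.ne_iff.1 hm
    refine le_trans ?_ (norm_le_pi_norm m i)
    rw [Int.norm_eq_abs]
    exact_mod_cast Int.one_le_abs hi
  exact (le_mul_of_one_le_right (abs_nonneg _) (one_le_pow₀ h1)).trans (abs_latticeCoeff_mul_le m)

theorem mem_latticeBox {M : ℕ} {m : Fin 2 → ℤ} : m ∈ latticeBox M ↔ ∀ i, |m i| ≤ M := by
  simp only [latticeBox, Finset.mem_Icc, Pi.le_def, abs_le, forall_and]

theorem card_latticeBox (M : ℕ) : (latticeBox M).card = (2 * M + 1) ^ 2 := by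
  rw [latticeBox, Pi.card_Icc]
  simp only [Int.card_Icc, Finset.prod_const, Finset.card_univ, Fintype.card_fin]
  congr 1
  omega

theorem le_norm_of_notMem_latticeBox {M : ℕ} {m : Fin 2 → ℤ} (h : m ∉ latticeBox M) :
    (M : ℝ) + 1 ≤ ‖m‖ := by
  rw [mem_latticeBox] at h
  push Not at h
  obtain ⟨i, hi⟩ := h
  refine le_trans ?_ (norm_le_pi_norm m i)
  rw [Int.norm_eq_abs]
  exact_mod_cast hi

theorem tendsto_latticeBox : Tendsto latticeBox atTop atTop := by
  refine tendsto_atTop_finset_of_monotone (fun a b hab m hm => ?_) fun m => ?_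
  · rw [mem_latticeBox] at hm ⊢
    exact fun i => (hm i).trans (by exact_mod_cast hab)
  · refine ⟨(|m 0| + |m 1|).toNat, mem_latticeBox.2 fun i => ?_⟩
    have h0 := abs_nonneg (m 0)
    have h1 := abs_nonneg (m 1)
    fin_cases i <;> simp

/-! ### Convergence of the symbol series by means of the discrete Laplacian. -/

/-- Shifting the box changes the partial sums of a series with terms `O(|m|⁻²)` by `o(1)`. -/
theorem tendsto_sum_latticeBox_shift {f : (Fin 2 → ℤ) → ℂ} (hf : ∀ m, ‖f m‖ * ‖m‖ ^ 2 ≤ 1)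
    {s : Fin 2 → ℤ} (hs : ∀ i, |s i| ≤ 1) :
    Tendsto (fun M => ∑ m ∈ latticeBox M, f (m - s) - ∑ m ∈ latticeBox M, f m) atTop (𝓝 0) := by
  -- With `n + 1` as the size of the box, the symmetric difference of the box and its shift lies in
  -- the shell between the boxes `n` and `n + 2`.
  rw [← tendsto_add_atTop_iff_nat 1]
  have hlim : Tendsto (fun n : ℕ => 2 * (24 * ((n : ℝ) + 1)⁻¹)) atTop (𝓝 0) := by
    have h := (tendsto_inv_atTop_zero (𝕜 := ℝ)).comp
      (tendsto_atTop_add_const_right _ (1 : ℝ) tendsto_natCast_atTop_atTop)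
    simpa [Function.comp_def] using (h.const_mul 24).const_mul 2
  refine squeeze_zero_norm (fun n => ?_) hlim
  have hbd : ∀ A : Finset (Fin 2 → ℤ), A ⊆ latticeBox (n + 2) \ latticeBox n →
      ‖∑ m ∈ A, f m‖ ≤ 24 * ((n : ℝ) + 1)⁻¹ := by
    intro A hA
    have hn : (0 : ℝ) < n + 1 := by positivity
    have h1 : ∀ m ∈ A, ‖f m‖ ≤ (((n : ℝ) + 1) ^ 2)⁻¹ := by
      intro m hm
      have h2 := le_norm_of_notMem_latticeBox (Finset.mem_sdiff.1 (hA hm)).2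
      rw [← one_div, le_div_iff₀ (by positivity)]
      refine le_trans ?_ (hf m)
      gcongr
    refine (norm_sum_le_of_le _ h1).trans ?_
    rw [Finset.sum_const, nsmul_eq_mul]
    have hsub : latticeBox n ⊆ latticeBox (n + 2) := fun m hm => by
      rw [mem_latticeBox] at hm ⊢
      exact fun i => (hm i).trans (by push_cast; omega)
    -- The shell has `(2n + 5)² - (2n + 1)² = 16n + 24` points, and each term there is at most `(n +
    -- 1)⁻²`.
    have h3 : (A.card : ℝ) ≤ 24 * ((n : ℝ) + 1) := by
      have h4 := Finset.card_le_card hA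
      have h5 := Finset.card_sdiff_add_card_eq_card hsub
      rw [card_latticeBox, card_latticeBox] at h5
      have h6 : A.card ≤ 24 * (n + 1) := by nlinarith
      exact_mod_cast h6
    calc (A.card : ℝ) * (((n : ℝ) + 1) ^ 2)⁻¹
        ≤ 24 * ((n : ℝ) + 1) * (((n : ℝ) + 1) ^ 2)⁻¹ := by gcongr
      _ = 24 * ((n : ℝ) + 1)⁻¹ := by field_simp
  have himg : ∑ m ∈ latticeBox (n + 1), f (m - s) =
      ∑ m ∈ (latticeBox (n + 1)).image (fun m => m - s), f m := by
    rw [Finset.sum_image]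
    exact fun x _ y _ h => sub_left_injective h
  rw [himg, ← Finset.sum_sdiff_sub_sum_sdiff, two_mul]
  refine (norm_sub_le _ _).trans (add_le_add (hbd _ ?_) (hbd _ ?_))
  · intro m hm
    simp only [Finset.mem_sdiff, Finset.mem_image, mem_latticeBox] at hm ⊢
    obtain ⟨⟨x, hx, rfl⟩, h2⟩ := hm
    refine ⟨fun i => ?_, fun h => h2 fun i => (h i).trans (by push_cast; omega)⟩
    have h3 := hx i
    have h4 := hs i
    rw [Pi.sub_apply]
    rw [abs_le] at *
    push_cast at *
    omega
  · intro m hm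
    simp only [Finset.mem_sdiff, Finset.mem_image, mem_latticeBox, not_exists, not_and] at hm ⊢
    refine ⟨fun i => (hm.1 i).trans (by push_cast; omega), fun h => hm.2 (m + s) (fun i => ?_) ?_⟩
    · have h3 := h i
      have h4 := hs i
      rw [Pi.add_apply]
      rw [abs_le] at *
      push_cast at *
      omega
    · rw [add_sub_cancel_right]

theorem symbolPartialSum_eq (τ : Fin 2 → ℝ) (M : ℕ) :
    symbolPartialSum τ M = ∑ m ∈ latticeBox M, (latticeCoeff m : ℂ) * latticeChar τ m := by
  rw [symbolPartialSum]
  exact Finset.sum_erase _ (by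
    change ((latticeCoeff 0 : ℝ) : ℂ) * _ = 0
    rw [latticeCoeff_zero, Complex.ofReal_zero, zero_mul])

/-- Minus the discrete Laplacian of the coefficients. -/
noncomputable def laplaceCoeff (m : Fin 2 → ℤ) : ℝ :=
  4 * latticeCoeff m - latticeCoeff (m - ![1, 0]) - latticeCoeff (m - ![-1, 0])
    - latticeCoeff (m - ![0, 1]) - latticeCoeff (m - ![0, -1])

/-- The symbol of minus the discrete Laplacian. -/
noncomputable def laplaceSymbol (τ : Fin 2 → ℝ) : ℝ := 4 - 2 * Real.cos (τ 0) - 2 * Real.cos (τ 1)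

/-- Shifting the coefficients multiplies the series by a character; for square partial sums this
holds up to the boundary error of `tendsto_sum_latticeBox_shift`. -/
theorem tendsto_sum_shift_sub (τ : Fin 2 → ℝ) {s : Fin 2 → ℤ} (hs : ∀ i, |s i| ≤ 1) :
    Tendsto (fun M => ∑ m ∈ latticeBox M, (latticeCoeff (m - s) : ℂ) * latticeChar τ m
      - latticeChar τ s * symbolPartialSum τ M) atTop (𝓝 0) := by
  have h := (tendsto_sum_latticeBox_shift
    (f := fun m => (latticeCoeff m : ℂ) * latticeChar τ m) (fun m => by
      rw [norm_mul, norm_latticeChar, mul_one, Complex.norm_real, Real.norm_eq_abs]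
      exact abs_latticeCoeff_mul_le m) hs).const_mul (latticeChar τ s)
  rw [mul_zero] at h
  refine h.congr fun M => ?_
  rw [mul_sub, symbolPartialSum_eq, Finset.mul_sum]
  congr 1
  refine Finset.sum_congr rfl fun m _ => ?_
  rw [← latticeChar_sub_mul τ m s]
  ring

theorem laplaceSymbol_eq (τ : Fin 2 → ℝ) : (laplaceSymbol τ : ℂ) =
    4 - latticeChar τ ![1, 0] - latticeChar τ ![-1, 0] - latticeChar τ ![0, 1]
      - latticeChar τ ![0, -1] := by
  simp only [laplaceSymbol, latticeChar, Fin.sum_univ_two, Matrix.cons_val_zero,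
    Matrix.cons_val_one]
  push_cast
  rw [Complex.cos, Complex.cos]
  ring_nf

theorem tendsto_laplace_mul (τ : Fin 2 → ℝ) :
    Tendsto (fun M => ∑ m ∈ latticeBox M, (laplaceCoeff m : ℂ) * latticeChar τ m
      - laplaceSymbol τ * symbolPartialSum τ M) atTop (𝓝 0) := by
  have h := (((tendsto_sum_shift_sub τ (s := ![1, 0]) (by decide)).add
    (tendsto_sum_shift_sub τ (s := ![-1, 0]) (by decide))).add
    ((tendsto_sum_shift_sub τ (s := ![0, 1]) (by decide)).add
    (tendsto_sum_shift_sub τ (s := ![0, -1]) (by decide)))).neg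
  simp only [add_zero, neg_zero] at h
  refine h.congr fun M => ?_
  rw [laplaceSymbol_eq]
  simp only [laplaceCoeff, Complex.ofReal_sub, sub_mul, Finset.sum_sub_distrib, Complex.ofReal_mul,
    mul_assoc, ← Finset.mul_sum, ← symbolPartialSum_eq]
  push_cast
  ring

theorem latticeComplex_sub (m s : Fin 2 → ℤ) :
    latticeComplex (m - s) = latticeComplex m - latticeComplex s := by
  simp [latticeComplex]
  ring

/-- The four neighbours are the shifts by the fourth roots of unity, so in the expansion at infinity
all terms before `z⁻⁶` cancel: the numerator has degree 4, the denominator degree 10. -/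
theorem laplaceCoeff_identity {z : ℂ} (h0 : z ≠ 0) (h1 : z ^ 4 - 1 ≠ 0) :
    1 / (z - 1) ^ 2 + 1 / (z - -1) ^ 2 + 1 / (z - Complex.I) ^ 2 + 1 / (z - -Complex.I) ^ 2
      - 4 * (1 / z ^ 2) = 4 * (5 * z ^ 4 - 1) / (z ^ 2 * (z ^ 4 - 1) ^ 2) := by
  have hI := Complex.I_sq
  have e : z ^ 4 - 1 = (z - 1) * (z - -1) * ((z - Complex.I) * (z - -Complex.I)) := by
    linear_combination (z ^ 2 - 1) * hI
  have h2 := h1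
  rw [e] at h2
  simp only [mul_ne_zero_iff] at h2
  obtain ⟨⟨ha, hb⟩, hc, hd⟩ := h2
  have e1 : 1 / (z - 1) ^ 2 + 1 / (z - -1) ^ 2 = (2 * z ^ 2 + 2) / (z ^ 2 - 1) ^ 2 := by
    rw [show z ^ 2 - 1 = (z - 1) * (z - -1) by ring]
    field_simp
    ring
  have e2 : 1 / (z - Complex.I) ^ 2 + 1 / (z - -Complex.I) ^ 2
      = (2 * z ^ 2 - 2) / (z ^ 2 + 1) ^ 2 := by
    rw [show z ^ 2 + 1 = (z - Complex.I) * (z - -Complex.I) by linear_combination hI,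
      div_add_div _ _ (pow_ne_zero 2 hc) (pow_ne_zero 2 hd), ← mul_pow]
    congr 1
    linear_combination 2 * hI
  have e3 : z ^ 4 - 1 = (z ^ 2 - 1) * (z ^ 2 + 1) := by ring
  rw [e3] at h1 ⊢
  obtain ⟨hp, hq⟩ := mul_ne_zero_iff.1 h1
  rw [add_assoc (_ + _), e1, e2]
  field_simp
  ring

theorem exists_laplaceCoeff_bound : ∃ C : ℝ, ∀ m, |laplaceCoeff m| * ‖m‖ ^ 6 ≤ C := by
  refine ⟨96, fun m => ?_⟩
  -- The rational identity fails at `0` and at the fourth roots of unity, so the lattice points of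
  -- sup norm at most one are treated by the trivial bound 8.
  by_cases hm : ‖m‖ < 2
  · have h1 : ‖m‖ ≤ 1 := by
      refine (pi_norm_le_iff_of_nonneg zero_le_one).2 fun i => ?_
      have h := (norm_le_pi_norm m i).trans_lt hm
      rw [Int.norm_eq_abs] at h ⊢
      have : |m i| < 2 := by exact_mod_cast h
      exact_mod_cast Int.lt_add_one_iff.1 this
    have h2 : |laplaceCoeff m| ≤ 8 := by
      rw [laplaceCoeff]
      have a1 := abs_le.1 (abs_latticeCoeff_le_one m)
      have a2 := abs_le.1 (abs_latticeCoeff_le_one (m - ![1, 0]))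
      have a3 := abs_le.1 (abs_latticeCoeff_le_one (m - ![-1, 0]))
      have a4 := abs_le.1 (abs_latticeCoeff_le_one (m - ![0, 1]))
      have a5 := abs_le.1 (abs_latticeCoeff_le_one (m - ![0, -1]))
      rw [abs_le]
      constructor <;> linarith
    have h3 : ‖m‖ ^ 6 ≤ 1 := pow_le_one₀ (norm_nonneg _) h1
    calc |laplaceCoeff m| * ‖m‖ ^ 6 ≤ 8 * 1 := by gcongr
      _ ≤ 96 := by norm_num
  push Not at hm
  set z := latticeComplex m with hz
  have hmz : ‖m‖ ≤ ‖z‖ := norm_le_norm_latticeComplex m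
  have hz2 : 2 ≤ ‖z‖ := hm.trans hmz
  have hz4 : 16 ≤ ‖z‖ ^ 4 := by
    calc (16 : ℝ) = 2 ^ 4 := by norm_num
      _ ≤ _ := by gcongr
  -- This and `hup` give the constant `96 = 4 * 6 * 2 ^ 2`.
  have hlow : ‖z‖ ^ 4 / 2 ≤ ‖z ^ 4 - 1‖ := by
    have := norm_sub_norm_le (z ^ 4) 1
    rw [norm_pow, norm_one] at this
    linarith
  have hup : ‖5 * z ^ 4 - 1‖ ≤ 6 * ‖z‖ ^ 4 := by
    have := norm_sub_le (5 * z ^ 4) 1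
    rw [norm_mul, norm_pow, norm_one] at this
    norm_num at this
    linarith
  have h0 : z ≠ 0 := norm_pos_iff.1 (by linarith)
  have h1 : z ^ 4 - 1 ≠ 0 := norm_pos_iff.1 (by linarith)
  have key : laplaceCoeff m
      = (2 * Real.pi)⁻¹ * (4 * (5 * z ^ 4 - 1) / (z ^ 2 * (z ^ 4 - 1) ^ 2)).re := by
    rw [← laplaceCoeff_identity h0 h1, laplaceCoeff]
    simp only [latticeCoeff_eq_re, latticeComplex_sub, ← hz]
    have b1 : latticeComplex ![1, 0] = 1 := by simp [latticeComplex]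
    have b2 : latticeComplex ![-1, 0] = -1 := by simp [latticeComplex]
    have b3 : latticeComplex ![0, 1] = Complex.I := by simp [latticeComplex]
    have b4 : latticeComplex ![0, -1] = -Complex.I := by simp [latticeComplex]
    rw [b1, b2, b3, b4]
    simp only [Complex.sub_re, Complex.add_re, Complex.mul_re, Complex.re_ofNat, Complex.im_ofNat]
    ring
  have hpi : (2 * Real.pi)⁻¹ ≤ 1 := inv_le_one_of_one_le₀ (by linarith [Real.pi_gt_three])
  have hzpos : 0 < ‖z‖ := by linarith
  have hb : |laplaceCoeff m| ≤ 96 / ‖z‖ ^ 6 := by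
    rw [key, abs_mul, abs_of_pos (by positivity)]
    calc (2 * Real.pi)⁻¹ * |(4 * (5 * z ^ 4 - 1) / (z ^ 2 * (z ^ 4 - 1) ^ 2)).re|
        ≤ 1 * ‖4 * (5 * z ^ 4 - 1) / (z ^ 2 * (z ^ 4 - 1) ^ 2)‖ := by
          gcongr
          exact Complex.abs_re_le_norm _
      _ = 4 * ‖5 * z ^ 4 - 1‖ / (‖z‖ ^ 2 * ‖z ^ 4 - 1‖ ^ 2) := by
          rw [one_mul, norm_div, norm_mul, norm_mul, norm_pow, norm_pow]
          norm_num
      _ ≤ 4 * (6 * ‖z‖ ^ 4) / (‖z‖ ^ 2 * (‖z‖ ^ 4 / 2) ^ 2) := by gcongr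
      _ = 96 / ‖z‖ ^ 6 := by field_simp; norm_num
  calc |laplaceCoeff m| * ‖m‖ ^ 6 ≤ 96 / ‖z‖ ^ 6 * ‖z‖ ^ 6 := by gcongr
    _ = 96 := by field_simp

theorem one_le_norm_of_ne_zero {m : Fin 2 → ℤ} (hm : m ≠ 0) : 1 ≤ ‖m‖ := by
  obtain ⟨i, hi⟩ := Function.ne_iff.1 hm
  refine le_trans ?_ (norm_le_pi_norm m i)
  rw [Int.norm_eq_abs]
  exact_mod_cast Int.one_le_abs hi

/-- A third moment is what the cubic Taylor remainder in `exists_laplaceSeries_expansion` requires;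
the decay leaves `‖m‖⁻³`, which is summable in the plane. -/
theorem summable_laplaceCoeff_mul_norm : Summable fun m => |laplaceCoeff m| * ‖m‖ ^ 3 := by
  obtain ⟨C, hC⟩ := exists_laplaceCoeff_bound
  refine Summable.of_nonneg_of_le (fun m => by positivity) (fun m => ?_)
    ((EisensteinSeries.summable_one_div_norm_rpow (k := 3) (by norm_num)).mul_left C)
  rcases eq_or_ne m 0 with rfl | hm
  · simp
  have h1 : 0 < ‖m‖ := norm_pos_iff.2 hm
  rw [Real.rpow_neg h1.le, show (3 : ℝ) = ((3 : ℕ) : ℝ) by norm_num, Real.rpow_natCast,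
    ← div_eq_mul_inv, le_div_iff₀ (by positivity)]
  calc _ = |laplaceCoeff m| * ‖m‖ ^ 6 := by ring
    _ ≤ C := hC m

theorem summable_laplaceCoeff_mul {g : (Fin 2 → ℤ) → ℝ} {C : ℝ}
    (hg : ∀ m ≠ 0, |g m| ≤ C * ‖m‖ ^ 3) : Summable fun m => laplaceCoeff m * g m := by
  refine Summable.of_norm_bounded_eventually (summable_laplaceCoeff_mul_norm.mul_left C) ?_
  refine (Set.finite_singleton (0 : Fin 2 → ℤ)).subset fun m hm => ?_
  by_contra h
  refine hm ?_
  rw [Set.mem_ofPred_eq, Real.norm_eq_abs, abs_mul]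
  calc |laplaceCoeff m| * |g m| ≤ |laplaceCoeff m| * (C * ‖m‖ ^ 3) := by gcongr; exact hg m h
    _ = _ := by ring

theorem summable_abs_laplaceCoeff : Summable fun m => |laplaceCoeff m| := by
  have := (summable_laplaceCoeff_mul (g := fun _ => 1) (C := 1) fun m hm => by
    simpa using one_le_pow₀ (one_le_norm_of_ne_zero hm)).abs
  simpa using this

theorem norm_laplaceCoeff_mul_char (τ : Fin 2 → ℝ) (m : Fin 2 → ℤ) :
    ‖(laplaceCoeff m : ℂ) * latticeChar τ m‖ = |laplaceCoeff m| := by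
  rw [norm_mul, norm_latticeChar, mul_one, Complex.norm_real, Real.norm_eq_abs]

/-- The absolutely convergent Fourier series with the coefficients `laplaceCoeff`. -/
noncomputable def laplaceSeries (τ : Fin 2 → ℝ) : ℂ :=
  ∑' m, (laplaceCoeff m : ℂ) * latticeChar τ m

theorem hasSum_laplaceSeries (τ : Fin 2 → ℝ) :
    HasSum (fun m => (laplaceCoeff m : ℂ) * latticeChar τ m) (laplaceSeries τ) :=
  (Summable.of_norm (by simpa only [norm_laplaceCoeff_mul_char] using
    summable_abs_laplaceCoeff)).hasSum

theorem continuous_laplaceSeries : Continuous laplaceSeries := by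
  refine continuous_tsum (fun m => ?_) summable_abs_laplaceCoeff fun m τ =>
    (norm_laplaceCoeff_mul_char τ m).le
  unfold latticeChar
  fun_prop

theorem continuous_laplaceSymbol : Continuous laplaceSymbol := by
  unfold laplaceSymbol
  fun_prop

theorem tendsto_symbolPartialSum_of_ne {τ : Fin 2 → ℝ} (hτ : laplaceSymbol τ ≠ 0) :
    Tendsto (symbolPartialSum τ) atTop (𝓝 (laplaceSeries τ / laplaceSymbol τ)) := by
  have h := (((hasSum_laplaceSeries τ).comp tendsto_latticeBox).sub
    (tendsto_laplace_mul τ)).div_const (laplaceSymbol τ : ℂ)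
  rw [sub_zero] at h
  refine h.congr fun M => ?_
  have : (laplaceSymbol τ : ℂ) ≠ 0 := by exact_mod_cast hτ
  simp only [Function.comp_apply]
  field_simp
  ring

/-! ### Symmetries, reality and periodicity of the symbol. -/

/-- The reflection `(m₁, m₂) ↦ (m₂, m₁)`. -/
def coordSwap (α : Type*) : (Fin 2 → α) ≃ (Fin 2 → α) :=
  (Equiv.swap (0 : Fin 2) 1).arrowCongr (Equiv.refl α)

@[simp] theorem coordSwap_zero {α : Type*} (x : Fin 2 → α) : coordSwap α x 0 = x 1 := by
  simp [coordSwap]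

@[simp] theorem coordSwap_one {α : Type*} (x : Fin 2 → α) : coordSwap α x 1 = x 0 := by
  simp [coordSwap]

theorem latticeCoeff_coordSwap (m : Fin 2 → ℤ) :
    latticeCoeff (coordSwap ℤ m) = -latticeCoeff m := by
  simp only [latticeCoeff_eq, coordSwap_zero, coordSwap_one]
  rw [← neg_div, neg_sub, add_comm]

theorem laplaceCoeff_coordSwap (m : Fin 2 → ℤ) :
    laplaceCoeff (coordSwap ℤ m) = -laplaceCoeff m := by
  have e : ∀ a b : ℤ, coordSwap ℤ m - ![a, b] = coordSwap ℤ (m - ![b, a]) := fun a b => by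
    ext i
    fin_cases i <;> simp [Matrix.vecHead, Matrix.vecTail]
  simp only [laplaceCoeff, e, latticeCoeff_coordSwap]
  ring

theorem latticeChar_coordSwap (τ : Fin 2 → ℝ) (m : Fin 2 → ℤ) :
    latticeChar (coordSwap ℝ τ) (coordSwap ℤ m) = latticeChar τ m := by
  simp only [latticeChar, Fin.sum_univ_two, coordSwap_zero, coordSwap_one]
  rw [add_comm]

theorem symbolPartialSum_coordSwap (τ : Fin 2 → ℝ) (M : ℕ) :
    symbolPartialSum (coordSwap ℝ τ) M = -symbolPartialSum τ M := by
  rw [symbolPartialSum_eq, symbolPartialSum_eq, ← Finset.sum_neg_distrib]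
  refine (Finset.sum_equiv (coordSwap ℤ) (fun m => ?_) fun m _ => ?_).symm
  · simp only [mem_latticeBox, Fin.forall_fin_two, coordSwap_zero, coordSwap_one, and_comm]
  · rw [latticeCoeff_coordSwap, latticeChar_coordSwap]
    push_cast
    ring

theorem laplaceSymbol_eq_zero_iff {τ : Fin 2 → ℝ} :
    laplaceSymbol τ = 0 ↔ Real.cos (τ 0) = 1 ∧ Real.cos (τ 1) = 1 := by
  have h0 := Real.cos_le_one (τ 0)
  have h1 := Real.cos_le_one (τ 1)
  rw [laplaceSymbol]
  constructor
  · intro h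
    constructor <;> linarith
  · rintro ⟨h, h'⟩
    rw [h, h']
    norm_num

theorem laplaceSymbol_eq_zero_iff' {τ : Fin 2 → ℝ} :
    laplaceSymbol τ = 0 ↔ ∃ n : Fin 2 → ℤ, τ = fun i => (n i : ℝ) * (2 * Real.pi) := by
  rw [laplaceSymbol_eq_zero_iff, Real.cos_eq_one_iff, Real.cos_eq_one_iff]
  constructor
  · rintro ⟨⟨a, ha⟩, b, hb⟩
    refine ⟨![a, b], ?_⟩
    ext i
    fin_cases i
    · simpa using ha.symm
    · simpa using hb.symm
  · rintro ⟨n, rfl⟩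
    exact ⟨⟨n 0, rfl⟩, n 1, rfl⟩

theorem latticeChar_two_pi_mul (n m : Fin 2 → ℤ) :
    latticeChar (fun i => (n i : ℝ) * (2 * Real.pi)) m = 1 := by
  rw [latticeChar, Complex.exp_eq_one_iff]
  refine ⟨m 0 * n 0 + m 1 * n 1, ?_⟩
  rw [Fin.sum_univ_two]
  push_cast
  ring

theorem latticeChar_add_left (τ σ : Fin 2 → ℝ) (m : Fin 2 → ℤ) :
    latticeChar (τ + σ) m = latticeChar τ m * latticeChar σ m := by
  simp only [latticeChar, ← Complex.exp_add, Fin.sum_univ_two, Pi.add_apply]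
  congr 1
  push_cast
  ring

/-- On `2πℤ²` every character equals 1, so swapping the coordinates leaves the partial sum unchanged
while also changing its sign. -/
theorem symbolPartialSum_eq_zero {τ : Fin 2 → ℝ} (hτ : laplaceSymbol τ = 0) (M : ℕ) :
    symbolPartialSum τ M = 0 := by
  obtain ⟨n, rfl⟩ := laplaceSymbol_eq_zero_iff'.1 hτ
  have h := symbolPartialSum_coordSwap (fun i => (n i : ℝ) * (2 * Real.pi)) M
  have e : coordSwap ℝ (fun i => (n i : ℝ) * (2 * Real.pi))
      = fun i => (coordSwap ℤ n i : ℝ) * (2 * Real.pi) := by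
    ext i
    fin_cases i <;> simp
  rw [e] at h
  simp only [symbolPartialSum_eq, latticeChar_two_pi_mul, mul_one] at h ⊢
  exact self_eq_neg.1 h

theorem tendsto_symbolPartialSum (τ : Fin 2 → ℝ) :
    Tendsto (symbolPartialSum τ) atTop (𝓝 (symbol τ)) := by
  refine tendsto_nhds_limUnder ?_
  by_cases hτ : laplaceSymbol τ = 0
  · exact ⟨0, tendsto_const_nhds.congr fun M => (symbolPartialSum_eq_zero hτ M).symm⟩
  · exact ⟨_, tendsto_symbolPartialSum_of_ne hτ⟩

theorem symbol_eq_div {τ : Fin 2 → ℝ} (hτ : laplaceSymbol τ ≠ 0) :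
    symbol τ = laplaceSeries τ / laplaceSymbol τ :=
  tendsto_nhds_unique (tendsto_symbolPartialSum τ) (tendsto_symbolPartialSum_of_ne hτ)

theorem symbol_eq_zero {τ : Fin 2 → ℝ} (hτ : laplaceSymbol τ = 0) : symbol τ = 0 :=
  tendsto_nhds_unique (tendsto_symbolPartialSum τ)
    (tendsto_const_nhds.congr fun M => (symbolPartialSum_eq_zero hτ M).symm)

theorem symbol_coordSwap (τ : Fin 2 → ℝ) : symbol (coordSwap ℝ τ) = -symbol τ :=
  tendsto_nhds_unique (tendsto_symbolPartialSum _)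
    ((tendsto_symbolPartialSum τ).neg.congr fun M => (symbolPartialSum_coordSwap τ M).symm)

theorem conj_symbolPartialSum (τ : Fin 2 → ℝ) (M : ℕ) :
    (starRingEnd ℂ) (symbolPartialSum τ M) = symbolPartialSum τ M := by
  rw [symbolPartialSum_eq, map_sum]
  refine Finset.sum_equiv (Equiv.neg _) (fun m => ?_) fun m _ => ?_
  · simp only [mem_latticeBox, Equiv.neg_apply, Pi.neg_apply, abs_neg]
  · rw [Equiv.neg_apply, latticeCoeff_neg, latticeChar_neg, map_mul, Complex.conj_ofReal]

theorem symbol_im (τ : Fin 2 → ℝ) : (symbol τ).im = 0 := by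
  rw [← Complex.conj_eq_iff_im]
  refine tendsto_nhds_unique ?_ (tendsto_symbolPartialSum τ)
  exact ((Complex.continuous_conj.tendsto _).comp (tendsto_symbolPartialSum τ)).congr
    fun M => conj_symbolPartialSum τ M

theorem ofReal_symbol_re (τ : Fin 2 → ℝ) : ((symbol τ).re : ℂ) = symbol τ :=
  Complex.ext rfl (by simp [symbol_im])

theorem symbol_periodic (τ : Fin 2 → ℝ) (n : Fin 2 → ℤ) :
    symbol (τ + fun i => (n i : ℝ) * (2 * Real.pi)) = symbol τ := by
  refine tendsto_nhds_unique (tendsto_symbolPartialSum _)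
    ((tendsto_symbolPartialSum τ).congr fun M => ?_)
  simp only [symbolPartialSum_eq, latticeChar_add_left, latticeChar_two_pi_mul, mul_one]

theorem continuousOn_symbol : ContinuousOn symbol {τ | laplaceSymbol τ ≠ 0} := by
  have h : ContinuousOn (fun τ => laplaceSeries τ / laplaceSymbol τ) {τ | laplaceSymbol τ ≠ 0} :=
    continuous_laplaceSeries.continuousOn.div
      (Complex.continuous_ofReal.comp continuous_laplaceSymbol).continuousOn
      fun τ hτ => by simpa using hτ
  exact h.congr fun τ hτ => symbol_eq_div hτ

/-! ### Second-order expansion at the origin. -/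

theorem latticeChar_re (τ : Fin 2 → ℝ) (m : Fin 2 → ℤ) :
    (latticeChar τ m).re = Real.cos (∑ i, (m i : ℝ) * τ i) := by
  rw [latticeChar, mul_comm, Complex.exp_ofReal_mul_I_re]

theorem hasSum_laplaceSeries_re (τ : Fin 2 → ℝ) :
    HasSum (fun m => laplaceCoeff m * Real.cos (∑ i, (m i : ℝ) * τ i)) (laplaceSeries τ).re := by
  have h := Complex.hasSum_re (hasSum_laplaceSeries τ)
  simpa only [Complex.re_ofReal_mul, latticeChar_re] using h

theorem laplaceSymbol_mul_symbol_re {τ : Fin 2 → ℝ} (hτ : laplaceSymbol τ ≠ 0) :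
    laplaceSymbol τ * (symbol τ).re = (laplaceSeries τ).re := by
  rw [symbol_eq_div hτ, Complex.div_ofReal_re]
  field_simp

/-- Valid for all `x`, unlike the quartic bound on `|x| ≤ 1`; it can therefore be summed over all
frequencies using third moments only. -/
theorem abs_cos_sub_le (x : ℝ) : |Real.cos x - (1 - x ^ 2 / 2)| ≤ |x| ^ 3 := by
  rcases le_total |x| 1 with hx | hx
  · refine (Real.cos_bound hx).trans ?_
    have : |x| ^ 4 ≤ |x| ^ 3 := pow_le_pow_of_le_one (abs_nonneg x) hx (by norm_num)
    nlinarith [pow_nonneg (abs_nonneg x) 4]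
  · rw [abs_of_nonneg (by linarith [Real.one_sub_sq_div_two_le_cos (x := x)])]
    have : |x| ^ 2 ≤ |x| ^ 3 := pow_le_pow_right₀ hx (by norm_num)
    rw [sq_abs] at this
    nlinarith [Real.cos_le_one x, sq_nonneg x]

/-- The second moment of the coefficients of `laplaceSeries`. -/
noncomputable def laplaceMoment : ℝ := ∑' m, laplaceCoeff m * (m 0 : ℝ) ^ 2

theorem abs_coord_le_norm (m : Fin 2 → ℤ) (i : Fin 2) : |(m i : ℝ)| ≤ ‖m‖ := by
  have := norm_le_pi_norm m i
  rwa [Int.norm_eq_abs] at this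

theorem summable_laplaceCoeff_mul_coord (i j : Fin 2) :
    Summable fun m => laplaceCoeff m * ((m i : ℝ) * (m j : ℝ)) := by
  refine summable_laplaceCoeff_mul (C := 1) fun m hm => ?_
  rw [abs_mul, one_mul]
  calc |(m i : ℝ)| * |(m j : ℝ)| ≤ ‖m‖ * ‖m‖ := by gcongr <;> exact abs_coord_le_norm _ _
    _ = ‖m‖ ^ 2 := by ring
    _ ≤ ‖m‖ ^ 3 := pow_le_pow_right₀ (one_le_norm_of_ne_zero hm) (by norm_num)

theorem tsum_laplaceCoeff_mul_swap (g : (Fin 2 → ℤ) → ℝ) :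
    ∑' m, laplaceCoeff m * g (coordSwap ℤ m) = -∑' m, laplaceCoeff m * g m := by
  rw [← (coordSwap ℤ).tsum_eq, ← tsum_neg]
  refine tsum_congr fun m => ?_
  rw [laplaceCoeff_coordSwap]
  have : coordSwap ℤ (coordSwap ℤ m) = m := by
    ext i
    fin_cases i <;> simp
  rw [this]
  ring

/-- Antisymmetry under the swap kills the zeroth moment and the mixed second moment, and makes the
two pure second moments opposite. Odd orders are absent because only cosines occur. -/
theorem exists_laplaceSeries_expansion : ∃ C : ℝ, 0 ≤ C ∧ ∀ τ : Fin 2 → ℝ,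
    |(laplaceSeries τ).re + laplaceMoment / 2 * (τ 0 ^ 2 - τ 1 ^ 2)| ≤ C * ‖τ‖ ^ 3 := by
  refine ⟨8 * ∑' m, |laplaceCoeff m| * ‖m‖ ^ 3,
    mul_nonneg (by norm_num) (tsum_nonneg fun m => by positivity), fun τ => ?_⟩
  have hone : Summable laplaceCoeff := summable_abs_laplaceCoeff.of_abs
  have s0 : ∑' m, laplaceCoeff m = 0 := by
    have := tsum_laplaceCoeff_mul_swap fun _ => 1
    simp only [mul_one] at this
    linarith
  have s1 : ∑' m : Fin 2 → ℤ, laplaceCoeff m * ((m 0 : ℝ) * (m 1 : ℝ)) = 0 := by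
    have := tsum_laplaceCoeff_mul_swap fun m => (m 0 : ℝ) * (m 1 : ℝ)
    simp only [coordSwap_zero, coordSwap_one] at this
    rw [show (fun m : Fin 2 → ℤ => laplaceCoeff m * ((m 1 : ℝ) * (m 0 : ℝ)))
      = fun m => laplaceCoeff m * ((m 0 : ℝ) * (m 1 : ℝ)) from
        funext fun m => by ring] at this
    linarith
  have s2 : ∑' m : Fin 2 → ℤ, laplaceCoeff m * ((m 0 : ℝ) * (m 0 : ℝ)) = laplaceMoment :=
    tsum_congr fun m => by ring
  have s3 : ∑' m : Fin 2 → ℤ, laplaceCoeff m * ((m 1 : ℝ) * (m 1 : ℝ)) = -laplaceMoment := by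
    have := tsum_laplaceCoeff_mul_swap fun m => (m 0 : ℝ) * (m 0 : ℝ)
    simp only [coordSwap_zero] at this
    rw [this, s2]
  have hs := (((hasSum_laplaceSeries_re τ).sub hone.hasSum).add
    (((summable_laplaceCoeff_mul_coord 0 0).hasSum.mul_left (τ 0 ^ 2 / 2)).add
    ((summable_laplaceCoeff_mul_coord 1 1).hasSum.mul_left (τ 1 ^ 2 / 2)))).add
    ((summable_laplaceCoeff_mul_coord 0 1).hasSum.mul_left (τ 0 * τ 1))
  rw [s0, s1, s2, s3] at hs
  have e : (laplaceSeries τ).re + laplaceMoment / 2 * (τ 0 ^ 2 - τ 1 ^ 2) =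
      (laplaceSeries τ).re - 0 + (τ 0 ^ 2 / 2 * laplaceMoment + τ 1 ^ 2 / 2 * -laplaceMoment)
      + τ 0 * τ 1 * 0 := by ring
  rw [e, ← hs.tsum_eq, ← Real.norm_eq_abs]
  have hb := ((summable_laplaceCoeff_mul_norm.hasSum).mul_left 8).mul_right (‖τ‖ ^ 3)
  refine tsum_of_norm_bounded hb fun m => ?_
  have e2 : laplaceCoeff m * Real.cos (∑ i, (m i : ℝ) * τ i) - laplaceCoeff m
      + (τ 0 ^ 2 / 2 * (laplaceCoeff m * ((m 0 : ℝ) * (m 0 : ℝ)))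
        + τ 1 ^ 2 / 2 * (laplaceCoeff m * ((m 1 : ℝ) * (m 1 : ℝ))))
      + τ 0 * τ 1 * (laplaceCoeff m * ((m 0 : ℝ) * (m 1 : ℝ)))
      = laplaceCoeff m * (Real.cos (∑ i, (m i : ℝ) * τ i)
        - (1 - (∑ i, (m i : ℝ) * τ i) ^ 2 / 2)) := by
    rw [Fin.sum_univ_two]
    ring
  rw [e2, norm_mul, Real.norm_eq_abs, Real.norm_eq_abs]
  have hx : |∑ i, (m i : ℝ) * τ i| ≤ 2 * (‖m‖ * ‖τ‖) := by
    rw [Fin.sum_univ_two]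
    refine (abs_add_le _ _).trans ?_
    rw [abs_mul, abs_mul, two_mul]
    gcongr
    · exact abs_coord_le_norm m 0
    · exact norm_le_pi_norm τ 0
    · exact abs_coord_le_norm m 1
    · exact norm_le_pi_norm τ 1
  calc _ ≤ |laplaceCoeff m| * (2 * (‖m‖ * ‖τ‖)) ^ 3 := by
        gcongr
        exact (abs_cos_sub_le _).trans (by gcongr)
    _ = _ := by ring

theorem abs_laplaceSymbol_sub_le (τ : Fin 2 → ℝ) :
    |laplaceSymbol τ - (τ 0 ^ 2 + τ 1 ^ 2)| ≤ 4 * ‖τ‖ ^ 3 := by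
  have h : ∀ i, |Real.cos (τ i) - (1 - τ i ^ 2 / 2)| ≤ ‖τ‖ ^ 3 := fun i =>
    (abs_cos_sub_le _).trans (by gcongr; exact norm_le_pi_norm τ i)
  have h0 := abs_le.1 (h 0)
  have h1 := abs_le.1 (h 1)
  rw [laplaceSymbol, abs_le]
  constructor <;> linarith

/-- The upper limit of the modulus of the symbol at the origin. -/
theorem eventually_abs_symbol_lt {B : ℝ} (hB : |laplaceMoment| / 2 < B) :
    ∀ᶠ τ in 𝓝 (0 : Fin 2 → ℝ), |(symbol τ).re| < B := by
  obtain ⟨C, hC0, hC⟩ := exists_laplaceSeries_expansion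
  have hB0 : 0 < B := lt_of_le_of_lt (by positivity) hB
  -- Dividing numerator and denominator bounds by `τ 0 ^ 2 + τ 1 ^ 2` reduces the claim to this
  -- inequality, which holds in the limit by `hB`.
  have hev : ∀ᶠ τ in 𝓝 (0 : Fin 2 → ℝ),
      |laplaceMoment| / 2 + C * ‖τ‖ < B * (1 - 4 * ‖τ‖) := by
    have c1 : ContinuousAt (fun τ : Fin 2 → ℝ => |laplaceMoment| / 2 + C * ‖τ‖) 0 := by fun_prop
    have c2 : ContinuousAt (fun τ : Fin 2 → ℝ => B * (1 - 4 * ‖τ‖)) 0 := by fun_prop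
    refine ContinuousAt.eventually_lt c1 c2 ?_
    simpa using hB
  filter_upwards [hev] with τ hτ
  by_cases h0 : laplaceSymbol τ = 0
  · simpa [symbol_eq_zero h0] using hB0
  have hne : τ ≠ 0 := by
    rintro rfl
    exact h0 (by norm_num [laplaceSymbol])
  have hpos : 0 < ‖τ‖ := norm_pos_iff.2 hne
  set q := τ 0 ^ 2 + τ 1 ^ 2 with hq
  have hq1 : ‖τ‖ ^ 2 ≤ q := by
    have : ‖τ‖ ≤ Real.sqrt q := (pi_norm_le_iff_of_nonneg (Real.sqrt_nonneg _)).2 fun i => by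
      rw [Real.norm_eq_abs]
      refine Real.abs_le_sqrt ?_
      fin_cases i <;> simp [hq] <;> positivity
    calc ‖τ‖ ^ 2 ≤ Real.sqrt q ^ 2 := by gcongr
      _ = q := Real.sq_sqrt (by positivity)
  have hq0 : 0 < q := lt_of_lt_of_le (by positivity) hq1
  have hq3 : ‖τ‖ ^ 3 ≤ q * ‖τ‖ := by
    calc ‖τ‖ ^ 3 = ‖τ‖ ^ 2 * ‖τ‖ := by ring
      _ ≤ _ := by gcongr
  have hD := (abs_le.1 (abs_laplaceSymbol_sub_le τ)).1
  have hDlow : q * (1 - 4 * ‖τ‖) ≤ laplaceSymbol τ := by linarith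
  have hDpos : 0 < laplaceSymbol τ := by
    refine lt_of_lt_of_le (mul_pos hq0 ?_) hDlow
    have : 0 < B * (1 - 4 * ‖τ‖) := lt_of_le_of_lt (by positivity) hτ
    exact pos_of_mul_pos_right this hB0.le
  have hF : laplaceSymbol τ * |(symbol τ).re| ≤ q * (|laplaceMoment| / 2 + C * ‖τ‖) := by
    rw [← abs_of_pos hDpos, ← abs_mul, laplaceSymbol_mul_symbol_re h0]
    have h1 := hC τ
    have h2 : |laplaceMoment / 2 * (τ 0 ^ 2 - τ 1 ^ 2)| ≤ |laplaceMoment| / 2 * q := by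
      rw [abs_mul, abs_div, abs_two]
      gcongr
      rw [abs_le]
      constructor <;> nlinarith [sq_nonneg (τ 0), sq_nonneg (τ 1)]
    have h3 := abs_sub_abs_le_abs_sub (laplaceSeries τ).re
      (-(laplaceMoment / 2 * (τ 0 ^ 2 - τ 1 ^ 2)))
    rw [sub_neg_eq_add, abs_neg] at h3
    nlinarith
  have : laplaceSymbol τ * |(symbol τ).re| < laplaceSymbol τ * B := by
    calc _ ≤ q * (|laplaceMoment| / 2 + C * ‖τ‖) := hF
      _ < q * (B * (1 - 4 * ‖τ‖)) := by gcongr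
      _ = q * (1 - 4 * ‖τ‖) * B := by ring
      _ ≤ _ := by gcongr
  exact lt_of_mul_lt_mul_left this hDpos.le

/-! ### Row sums and numerical bounds for the symbol. -/

/-- The sum of the coefficients over the row `m₁ = k`. -/
noncomputable def rowSum (k : ℤ) : ℝ := ∑' n : ℤ, latticeCoeff ![k, n]

theorem summable_row (k : ℤ) : Summable fun n : ℤ => latticeCoeff ![k, n] := by
  have h : Summable fun n : ℤ => ((n : ℝ) ^ 2)⁻¹ := by
    simpa using Real.summable_one_div_int_pow.2 (by norm_num : 1 < 2)
  refine Summable.of_norm_bounded_eventually h ?_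
  refine (Set.finite_singleton (0 : ℤ)).subset fun n hn => ?_
  by_contra h0
  refine hn ?_
  have hn0 : (0 : ℝ) < (n : ℝ) ^ 2 := by
    have : (n : ℝ) ≠ 0 := by exact_mod_cast h0
    positivity
  rw [Set.mem_ofPred_eq, Real.norm_eq_abs, ← one_div, le_div_iff₀ hn0]
  refine le_trans ?_ (abs_latticeCoeff_mul_le ![k, n])
  refine mul_le_mul_of_nonneg_left ?_ (abs_nonneg _)
  rw [← sq_abs]
  gcongr
  simpa using abs_coord_le_norm ![k, n] 1

theorem hasSum_row (k : ℤ) : HasSum (fun n : ℤ => latticeCoeff ![k, n]) (rowSum k) :=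
  (summable_row k).hasSum

/-- The two shifts along the row do not change its sum, so the weight 4 drops to 2 and a
one-dimensional second difference remains. -/
theorem hasSum_laplaceCoeff_row (k : ℤ) : HasSum (fun n : ℤ => laplaceCoeff ![k, n])
    (2 * rowSum k - rowSum (k + 1) - rowSum (k - 1)) := by
  have h1 := (Equiv.subRight (1 : ℤ)).hasSum_iff.2 (hasSum_row k)
  have h2 := (Equiv.subRight (-1 : ℤ)).hasSum_iff.2 (hasSum_row k)
  have h := ((((hasSum_row k).mul_left 4).sub (hasSum_row (k - 1))).sub
    (hasSum_row (k + 1))).sub h1 |>.sub h2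
  convert! h using 1
  · ext n
    simp [laplaceCoeff]
  · ring

theorem rowSum_neg (k : ℤ) : rowSum (-k) = rowSum k :=
  tsum_congr fun n => by simp [latticeCoeff_eq]

theorem rowSum_zero : rowSum 0 = Real.pi / 6 := by
  have e : ∀ n : ℤ, latticeCoeff ![0, n] = (2 * Real.pi)⁻¹ * (1 / (n : ℝ) ^ 2) := by
    intro n
    rcases eq_or_ne (n : ℝ) 0 with h | h
    · simp [latticeCoeff_eq, h]
    · simp [latticeCoeff_eq]
      field_simp
  have h1 : HasSum (fun n : ℕ => 1 / ((n : ℤ) : ℝ) ^ 2) (Real.pi ^ 2 / 6) := by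
    simpa using hasSum_zeta_two
  have h2 : HasSum (fun n : ℕ => 1 / ((-(n : ℤ) : ℤ) : ℝ) ^ 2) (Real.pi ^ 2 / 6) := by
    simpa using hasSum_zeta_two
  -- Both halves contain the index 0, where the term is `1 / 0 = 0`.
  have h := (HasSum.of_nat_of_neg (f := fun n : ℤ => 1 / (n : ℝ) ^ 2) h1 h2).mul_left
    (2 * Real.pi)⁻¹
  rw [rowSum, tsum_congr e, h.tsum_eq]
  have := Real.pi_pos
  simp
  field_simp
  norm_num

/-- The nome `e^{-2π}` of the square lattice. -/
noncomputable def nome : ℝ := Real.exp (-(2 * Real.pi))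

theorem nome_pos : 0 < nome := Real.exp_pos _

theorem nome_lt : nome < 1 / 100 := by
  rw [nome, Real.exp_neg, ← one_div]
  refine one_div_lt_one_div_of_lt (by norm_num) ?_
  calc (100 : ℝ) < 2.7 ^ 6 := by norm_num
    _ ≤ Real.exp 1 ^ 6 := by
      gcongr
      linarith [Real.exp_one_gt_d9]
    _ = Real.exp 6 := by rw [← Real.exp_nat_mul]; norm_num
    _ ≤ _ := Real.exp_le_exp.2 (by linarith [Real.pi_gt_three])

theorem nome_pow_lt_one (k : ℕ) (hk : k ≠ 0) : nome ^ k < 1 :=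
  pow_lt_one₀ nome_pos.le (by linarith [nome_lt]) hk

/-- The row at height `k` is, up to conjugation, the series `∑ 1 / (z + n) ^ 2` at `z = k * I`. Its
`q`-expansion is a geometric-type series in `nome ^ k` with a closed form. -/
theorem rowSum_of_pos {k : ℕ} (hk : 0 < k) :
    rowSum k = -(2 * Real.pi) * (nome ^ k / (1 - nome ^ k) ^ 2) := by
  have hkR : (0 : ℝ) < k := by exact_mod_cast hk
  let z : UpperHalfPlane := ⟨(k : ℂ) * Complex.I, by simpa using hk⟩
  have hz : (z : ℂ) = (k : ℂ) * Complex.I := rfl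
  have hI := Complex.I_sq
  have e : ∀ n : ℤ, latticeCoeff ![(k : ℤ), n]
      = (2 * Real.pi)⁻¹ * (1 / ((z : ℂ) + n) ^ (1 + 1)).re := by
    intro n
    have h1 : latticeComplex ![(k : ℤ), n] ^ 2
        = -(starRingEnd ℂ) (((z : ℂ) + n) ^ 2) := by
      simp only [latticeComplex, hz, map_pow, map_add, map_mul, Complex.conj_I,
        Complex.conj_natCast, map_intCast, Matrix.cons_val_zero, Matrix.cons_val_one]
      push_cast
      linear_combination ((n : ℂ) ^ 2 + k ^ 2) * hI
    rw [latticeCoeff_eq_re, h1, one_div_neg_eq_neg_one_div, Complex.neg_re,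
      ← map_one (starRingEnd ℂ),
      ← map_div₀, Complex.conj_re, map_one]
    ring
  have hsum := EisensteinSeries.qExpansion_identity (k := 1) le_rfl z
  have hq : Complex.exp (2 * Real.pi * Complex.I * z) = ((nome ^ k : ℝ) : ℂ) := by
    rw [nome, ← Real.exp_nat_mul, Complex.ofReal_exp, hz]
    congr 1
    push_cast
    linear_combination (2 * Real.pi * k : ℂ) * hI
  have hx : ‖((nome ^ k : ℝ) : ℂ)‖ < 1 := by
    rw [Complex.norm_real, Real.norm_eq_abs, abs_of_pos (pow_pos nome_pos k)]
    exact nome_pow_lt_one k hk.ne'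
  rw [hq] at hsum
  simp only [pow_one] at hsum
  rw [tsum_coe_mul_geometric_of_norm_lt_one hx] at hsum
  -- Were the series not summable, its `tsum` would be 0 by convention, but the `q`-expansion gives
  -- a nonzero value.
  have hs : Summable fun n : ℤ => 1 / ((z : ℂ) + n) ^ (1 + 1) := by
    by_contra hns
    have hzero := tsum_eq_zero_of_not_summable hns
    rw [hsum] at hzero
    have h1 : ((nome ^ k : ℝ) : ℂ) ≠ 0 := by
      exact_mod_cast (pow_pos nome_pos k).ne'
    have h2 : (1 - ((nome ^ k : ℝ) : ℂ)) ≠ 0 := by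
      have : 1 - nome ^ k ≠ 0 := by linarith [nome_pow_lt_one k hk.ne']
      exact_mod_cast this
    have h3 : (-2 * (Real.pi : ℂ) * Complex.I) ≠ 0 := by
      simp [Real.pi_ne_zero]
    simp only [Nat.factorial_one, Nat.cast_one, div_one] at hzero
    exact mul_ne_zero (pow_ne_zero _ h3) (div_ne_zero h1 (pow_ne_zero _ h2)) hzero
  rw [rowSum, tsum_congr e, tsum_mul_left, ← Complex.re_tsum hs, hsum]
  have e3 : (-2 * (Real.pi : ℂ) * Complex.I) ^ (1 + 1) / ((Nat.factorial 1 : ℕ) : ℂ)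
      * (((nome ^ k : ℝ) : ℂ) / (1 - ((nome ^ k : ℝ) : ℂ)) ^ 2)
      = ((-(4 * Real.pi ^ 2) * (nome ^ k / (1 - nome ^ k) ^ 2) : ℝ) : ℂ) := by
    simp only [Nat.factorial_one, Nat.cast_one, div_one]
    push_cast
    linear_combination (4 * (Real.pi : ℂ) ^ 2 * ((nome : ℂ) ^ k / (1 - (nome : ℂ) ^ k) ^ 2)) * hI
  rw [e3, Complex.ofReal_re]
  have := Real.pi_pos
  field_simp
  norm_num

theorem nome_ratio_le {k : ℕ} (hk : 0 < k) : nome ^ k / (1 - nome ^ k) ^ 2 ≤ 2 * nome ^ k := by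
  have h1 : nome ^ k ≤ nome :=
    pow_le_of_le_one nome_pos.le (by linarith [nome_lt]) hk.ne'
  have h2 := nome_lt
  have h3 := pow_pos nome_pos k
  rw [div_le_iff₀ (by apply pow_pos; linarith)]
  have : (1 : ℝ) / 2 ≤ (1 - nome ^ k) ^ 2 := by nlinarith
  nlinarith

theorem le_nome_ratio {k : ℕ} (hk : 0 < k) : nome ^ k ≤ nome ^ k / (1 - nome ^ k) ^ 2 := by
  have h1 := nome_pow_lt_one k hk.ne'
  have h3 := pow_pos nome_pos k
  rw [le_div_iff₀ (by apply pow_pos; linarith)]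
  exact mul_le_of_le_one_right h3.le (pow_le_one₀ (by linarith) (by linarith))

theorem abs_rowSum_le {k : ℕ} (hk : 0 < k) : |rowSum k| ≤ 4 * Real.pi * nome ^ k := by
  have h := nome_ratio_le hk
  have h2 := (pow_pos nome_pos k).le.trans (le_nome_ratio hk)
  rw [rowSum_of_pos hk, abs_mul, abs_neg, abs_of_pos (by positivity), abs_of_nonneg h2]
  nlinarith [Real.pi_pos]

/-- Row sums against functions of quadratic growth are summable. -/
theorem summable_rowSum_mul {g : ℤ → ℝ} {C : ℝ} (hg : ∀ k, |g k| ≤ C * (1 + (k : ℝ) ^ 2)) :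
    Summable fun k => rowSum k * g k := by
  have hq : ‖nome‖ < 1 := by
    rw [Real.norm_eq_abs, abs_of_pos nome_pos]
    linarith [nome_lt]
  have hs : Summable fun n : ℕ => 4 * Real.pi * C * (nome ^ n + (n : ℝ) ^ 2 * nome ^ n) :=
    ((summable_geometric_of_norm_lt_one hq).add
      (summable_pow_mul_geometric_of_norm_lt_one 2 hq)).mul_left _
  have hC : 0 ≤ C := by simpa using (abs_nonneg _).trans (hg 0)
  have key : ∀ j : ℤ, ∀ n : ℕ, 0 < n → (j = n ∨ j = -n) →
      ‖rowSum j * g j‖ ≤ 4 * Real.pi * C * (nome ^ n + (n : ℝ) ^ 2 * nome ^ n) := by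
    intro j n hn hj
    have e1 : rowSum j = rowSum n := by
      rcases hj with rfl | rfl
      · rfl
      · exact rowSum_neg _
    have e2 : (j : ℝ) ^ 2 = (n : ℝ) ^ 2 := by
      rcases hj with rfl | rfl <;> simp
    have h2 := hg j
    rw [e2] at h2
    rw [norm_mul, Real.norm_eq_abs, Real.norm_eq_abs, e1]
    calc |rowSum n| * |g j| ≤ (4 * Real.pi * nome ^ n) * (C * (1 + (n : ℝ) ^ 2)) := by
          have := pow_pos nome_pos n
          have := Real.pi_pos
          gcongr
          exact abs_rowSum_le hn
      _ = _ := by ring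
  have hsmall : ∀ᶠ n in cofinite, 0 < n := by
    refine (Set.finite_singleton 0).subset fun n hn => ?_
    simpa using hn
  refine Summable.of_nat_of_neg ?_ ?_
  · exact Summable.of_norm_bounded_eventually hs
      (hsmall.mono fun n hn => key n n hn (Or.inl rfl))
  · exact Summable.of_norm_bounded_eventually hs
      (hsmall.mono fun n hn => key (-n) n hn (Or.inr rfl))

/-- Sum along rows first, then move the second difference from the row sums to `g`; the exponential
decay of the row sums justifies the rearrangement. -/
theorem tsum_laplaceCoeff_mul_fst {g : ℤ → ℝ} {C : ℝ} (hg : ∀ k, |g k| ≤ C * (1 + (k : ℝ) ^ 2)) :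
    ∑' m, laplaceCoeff m * g (m 0)
      = ∑' k, rowSum k * (2 * g k - g (k + 1) - g (k - 1)) := by
  have hC : 0 ≤ C := by simpa using (abs_nonneg _).trans (hg 0)
  have hs : Summable fun m : Fin 2 → ℤ => laplaceCoeff m * g (m 0) := by
    refine summable_laplaceCoeff_mul (C := 2 * C) fun m hm => (hg _).trans ?_
    have h1 := one_le_norm_of_ne_zero hm
    have h2 : (m 0 : ℝ) ^ 2 ≤ ‖m‖ ^ 2 := by
      rw [← sq_abs]
      gcongr
      exact abs_coord_le_norm m 0
    have h3 : ‖m‖ ^ 2 ≤ ‖m‖ ^ 3 := pow_le_pow_right₀ h1 (by norm_num)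
    have h4 : 1 ≤ ‖m‖ ^ 3 := one_le_pow₀ h1
    nlinarith
  have hs' : Summable fun p : ℤ × ℤ => laplaceCoeff ((finTwoArrowEquiv ℤ).symm p)
      * g (((finTwoArrowEquiv ℤ).symm p) 0) := (finTwoArrowEquiv ℤ).symm.summable_iff.2 hs
  rw [← (finTwoArrowEquiv ℤ).symm.tsum_eq, hs'.tsum_prod]
  have hrow : ∀ k : ℤ, ∑' n : ℤ, laplaceCoeff ((finTwoArrowEquiv ℤ).symm (k, n))
      * g (((finTwoArrowEquiv ℤ).symm (k, n)) 0)
      = 2 * (rowSum k * g k) - rowSum (k + 1) * g k - rowSum (k - 1) * g k := by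
    intro k
    have := ((hasSum_laplaceCoeff_row k).mul_right (g k)).tsum_eq
    simp only [finTwoArrowEquiv_symm_apply, Matrix.cons_val_zero]
    rw [this]
    ring
  rw [tsum_congr hrow]
  have s0 := summable_rowSum_mul hg
  have s1 : Summable fun k => rowSum k * g (k - 1) :=
    summable_rowSum_mul (C := 3 * C) fun k => (hg _).trans (by
      push_cast
      nlinarith [mul_nonneg hC (sq_nonneg ((k : ℝ) + 1)), mul_nonneg hC (sq_nonneg (k : ℝ))])
  have s2 : Summable fun k => rowSum k * g (k + 1) :=
    summable_rowSum_mul (C := 3 * C) fun k => (hg _).trans (by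
      push_cast
      nlinarith [mul_nonneg hC (sq_nonneg ((k : ℝ) - 1)), mul_nonneg hC (sq_nonneg (k : ℝ))])
  have t1 : HasSum (fun k => rowSum (k + 1) * g k) (∑' k, rowSum k * g (k - 1)) := by
    have := (Equiv.addRight (1 : ℤ)).hasSum_iff.2 s1.hasSum
    simpa [Function.comp_def] using this
  have t2 : HasSum (fun k => rowSum (k - 1) * g k) (∑' k, rowSum k * g (k + 1)) := by
    have := (Equiv.subRight (1 : ℤ)).hasSum_iff.2 s2.hasSum
    simpa [Function.comp_def] using this
  rw [(((s0.hasSum.mul_left 2).sub t1).sub t2).tsum_eq,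
    ← (((s0.hasSum.mul_left 2).sub s2.hasSum).sub s1.hasSum).tsum_eq.trans
      (by ring : _ = 2 * ∑' k, rowSum k * g k - (∑' k, rowSum k * g (k - 1))
        - ∑' k, rowSum k * g (k + 1))]
  exact tsum_congr fun k => by ring

/-- The sum over `ℤ` of the row sums against an even function, up to a geometric tail. -/
theorem tsum_rowSum_mul_even {g : ℤ → ℝ} (hg : ∀ k, |g k| ≤ 1) (hg0 : g 0 = 1)
    (hneg : ∀ k, g (-k) = g k) :
    |∑' k, rowSum k * g k - (Real.pi / 6
      - 4 * Real.pi * (nome / (1 - nome) ^ 2) * g 1)| ≤ 16 * Real.pi * nome ^ 2 := by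
  have hs : Summable fun k => rowSum k * g k :=
    summable_rowSum_mul (C := 1) fun k => (hg k).trans (by nlinarith [sq_nonneg (k : ℝ)])
  have hn : Summable fun n : ℕ => rowSum n * g n :=
    hs.comp_injective (i := fun n : ℕ => (n : ℤ)) Nat.cast_injective
  -- The index 0 lies in both halves, so its term is subtracted once in the resulting sum.
  have hs2 := HasSum.of_nat_of_neg (f := fun k : ℤ => rowSum k * g k) hn.hasSum
    (by simpa only [rowSum_neg, hneg] using hn.hasSum)
  have hsplit := hn.sum_add_tsum_nat_add 2
  have htail : |∑' n : ℕ, rowSum (n + 2 : ℕ) * g (n + 2 : ℕ)| ≤ 8 * Real.pi * nome ^ 2 := by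
    have hgeo := ((hasSum_geometric_of_lt_one nome_pos.le (by linarith [nome_lt])).mul_left
      (4 * Real.pi * nome ^ 2))
    rw [← Real.norm_eq_abs]
    refine (tsum_of_norm_bounded hgeo fun n => ?_).trans ?_
    · rw [norm_mul, Real.norm_eq_abs, Real.norm_eq_abs]
      calc |rowSum (n + 2 : ℕ)| * |g (n + 2 : ℕ)|
          ≤ (4 * Real.pi * nome ^ (n + 2)) * 1 :=
            mul_le_mul (abs_rowSum_le (by omega)) (hg _) (abs_nonneg _)
              ((abs_nonneg _).trans (abs_rowSum_le (by omega)))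
        _ = _ := by ring
    · have h1 : (1 - nome)⁻¹ ≤ 2 := by
        rw [inv_le_comm₀ (by linarith [nome_lt]) (by norm_num)]
        linarith [nome_lt]
      have := Real.pi_pos
      calc _ ≤ 4 * Real.pi * nome ^ 2 * 2 := by gcongr
        _ = _ := by ring
  have hr1 := rowSum_of_pos (k := 1) one_pos
  rw [pow_one, Nat.cast_one] at hr1
  rw [hs2.tsum_eq, ← hsplit]
  simp only [Finset.sum_range_succ, Finset.sum_range_zero, Nat.cast_zero, zero_add, hg0,
    rowSum_zero, mul_one, hr1, Nat.cast_one, Nat.cast_add, Nat.cast_ofNat] at htail ⊢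
  rw [abs_le] at htail ⊢
  simp only [Nat.cast_add, Nat.cast_ofNat] at *
  constructor <;> linarith

/-- The second difference `2 k² - (k + 1)² - (k - 1)²` is the constant `-2`. -/
theorem laplaceMoment_eq : laplaceMoment = -2 * ∑' k, rowSum k * 1 := by
  rw [laplaceMoment, tsum_laplaceCoeff_mul_fst (g := fun k => (k : ℝ) ^ 2) (C := 1),
    ← tsum_mul_left]
  · exact tsum_congr fun k => by push_cast; ring
  · intro k
    rw [abs_of_nonneg (sq_nonneg _)]
    linarith

/-- The rows `±1` lower the sum below `π / 6` by at least `4 π * nome`, which exceeds the tail `16 π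
* nome ^ 2` because `nome < 1 / 100`. -/
theorem abs_laplaceMoment_lt : |laplaceMoment| / 2 < Real.pi / 6 := by
  have h := tsum_rowSum_mul_even (g := fun _ => 1) (by simp) rfl (by simp)
  have hpi := Real.pi_pos
  have h1 := nome_lt
  have h0 := nome_pos
  have h2 := nome_ratio_le one_pos
  have h3 := le_nome_ratio one_pos
  rw [pow_one] at h2 h3
  rw [laplaceMoment_eq, abs_mul, abs_neg, abs_two, mul_div_assoc, mul_div_cancel₀ _ two_ne_zero]
  rw [mul_one, abs_le] at h
  have h5 : Real.pi * nome ≤ Real.pi * (nome / (1 - nome) ^ 2) := by gcongr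
  have h6 : Real.pi * (nome / (1 - nome) ^ 2) ≤ Real.pi * (2 * nome) := by gcongr
  have h7 : Real.pi * nome ^ 2 ≤ Real.pi * nome * (1 / 100) := by
    rw [mul_assoc, pow_two]
    gcongr
  have h8 : Real.pi * nome ≤ Real.pi * (1 / 100) := by gcongr
  have h9 : 0 < Real.pi * nome := by positivity
  rw [abs_lt]
  constructor <;> nlinarith

/-- At `(π, 0)` the Laplacian symbol is 4, and the second difference of the alternating sequence
`cos (k π)` is also 4 times it. The quotient is the alternating sum of row sums, in which the rows
`±1` contribute positively. -/
theorem le_symbol_pi : Real.pi / 6 ≤ (symbol ![Real.pi, 0]).re := by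
  have hD : laplaceSymbol ![Real.pi, 0] = 4 + 2 - 2 := by
    simp [laplaceSymbol]
  have hg : ∀ k : ℤ, Real.cos ((k + 1 : ℤ) * Real.pi) = -Real.cos (k * Real.pi) := fun k => by
    rw [← Real.cos_add_pi]
    push_cast
    ring_nf
  have hg' : ∀ k : ℤ, Real.cos ((k - 1 : ℤ) * Real.pi) = -Real.cos (k * Real.pi) := fun k => by
    rw [← Real.cos_sub_pi]
    push_cast
    ring_nf
  have h := laplaceSymbol_mul_symbol_re (τ := ![Real.pi, 0]) (by rw [hD]; norm_num)
  rw [← (hasSum_laplaceSeries_re _).tsum_eq] at h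
  have e : ∀ m : Fin 2 → ℤ, laplaceCoeff m
      * Real.cos (∑ i, (m i : ℝ) * (![Real.pi, 0] : Fin 2 → ℝ) i)
      = laplaceCoeff m * Real.cos (m 0 * Real.pi) := fun m => by
    simp [Fin.sum_univ_two]
  rw [tsum_congr e, tsum_laplaceCoeff_mul_fst (g := fun k => Real.cos (k * Real.pi)) (C := 1)] at h
  swap
  · intro k
    refine (Real.abs_cos_le_one _).trans ?_
    nlinarith [sq_nonneg (k : ℝ)]
  have e2 : ∀ k : ℤ, rowSum k * (2 * Real.cos (k * Real.pi) - Real.cos ((k + 1 : ℤ) * Real.pi)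
      - Real.cos ((k - 1 : ℤ) * Real.pi)) = 4 * (rowSum k * Real.cos (k * Real.pi)) := fun k => by
    rw [hg, hg']
    ring
  rw [tsum_congr e2, tsum_mul_left, hD] at h
  have hb := tsum_rowSum_mul_even (g := fun k => Real.cos (k * Real.pi))
    (fun k => Real.abs_cos_le_one _) (by simp) (fun k => by simp)
  simp only [Int.cast_one, one_mul, Real.cos_pi] at hb
  have hpi := Real.pi_pos
  have h1 := nome_lt
  have h0 := nome_pos
  have h3 := le_nome_ratio one_pos
  rw [pow_one] at h3
  have h5 : Real.pi * nome ≤ Real.pi * (nome / (1 - nome) ^ 2) := by gcongr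
  have h7 : Real.pi * nome ^ 2 ≤ Real.pi * nome * (1 / 100) := by
    rw [mul_assoc, pow_two]
    gcongr
  have h9 : 0 < Real.pi * nome := by positivity
  rw [abs_le] at hb
  nlinarith

/-! ### The range of the symbol. -/

theorem exists_period_shift (τ : Fin 2 → ℝ) :
    ∃ n : Fin 2 → ℤ, (τ + fun i => (n i : ℝ) * (2 * Real.pi)) ∈ periodSquare := by
  refine ⟨fun i => -toIcoDiv Real.two_pi_pos (-Real.pi) (τ i), ?_⟩
  have h : ∀ i, τ i + ((-toIcoDiv Real.two_pi_pos (-Real.pi) (τ i) : ℤ) : ℝ) * (2 * Real.pi)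
      ∈ Set.Ico (-Real.pi) (-Real.pi + 2 * Real.pi) := fun i => by
    have := toIcoMod_mem_Ico Real.two_pi_pos (-Real.pi) (τ i)
    rw [toIcoMod] at this
    simpa [sub_eq_add_neg] using this
  refine ⟨fun i => (h i).1, fun i => (h i).2.le.trans ?_⟩
  linarith

theorem eq_zero_of_mem_periodSquare {τ : Fin 2 → ℝ} (hτ : τ ∈ periodSquare)
    (h : laplaceSymbol τ = 0) : τ = 0 := by
  obtain ⟨n, rfl⟩ := laplaceSymbol_eq_zero_iff'.1 h
  have hpi := Real.pi_pos
  ext i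
  have h1 : -Real.pi ≤ (n i : ℝ) * (2 * Real.pi) := hτ.1 i
  have h2 : (n i : ℝ) * (2 * Real.pi) ≤ Real.pi := hτ.2 i
  have h3 : (n i : ℝ) < 1 := by nlinarith
  have h4 : (-1 : ℝ) < n i := by nlinarith
  have h5 : n i < 1 := by exact_mod_cast h3
  have h6 : -1 < n i := by exact_mod_cast h4
  have h7 : n i = 0 := by omega
  simp [h7]

theorem coordSwap_mem_periodSquare {τ : Fin 2 → ℝ} (hτ : τ ∈ periodSquare) :
    coordSwap ℝ τ ∈ periodSquare := by
  refine ⟨fun i => ?_, fun i => ?_⟩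
  · fin_cases i
    · simpa using hτ.1 1
    · simpa using hτ.1 0
  · fin_cases i
    · simpa using hτ.2 1
    · simpa using hτ.2 0

/-- Compactness cannot be applied on the whole square, as continuity at the origin is not available.
Near the origin the symbol stays below `π / 6`, a level reached at `(π, 0)`, so it suffices to
maximise outside a ball. -/
theorem exists_symbol_max : ∃ σ ∈ periodSquare, laplaceSymbol σ ≠ 0 ∧
    Real.pi / 6 ≤ (symbol σ).re ∧ ∀ τ ∈ periodSquare, (symbol τ).re ≤ (symbol σ).re := by
  obtain ⟨δ, hδ, hball⟩ := Metric.eventually_nhds_iff_ball.1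
    (eventually_abs_symbol_lt abs_laplaceMoment_lt)
  have hS : IsCompact (periodSquare ∩ (Metric.ball 0 δ)ᶜ) :=
    isCompact_Icc.inter_right Metric.isOpen_ball.isClosed_compl
  have hne : ∀ τ ∈ periodSquare ∩ (Metric.ball 0 δ)ᶜ, laplaceSymbol τ ≠ 0 := by
    rintro τ ⟨h1, h2⟩ h
    rw [eq_zero_of_mem_periodSquare h1 h] at h2
    exact h2 (Metric.mem_ball_self hδ)
  have hp : ![Real.pi, 0] ∈ periodSquare ∩ (Metric.ball 0 δ)ᶜ := by
    refine ⟨?_, fun h => ?_⟩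
    · have := Real.pi_pos
      refine ⟨fun i => ?_, fun i => ?_⟩ <;> fin_cases i <;> simp <;> linarith
    · have h1 := hball _ h
      have h2 := le_symbol_pi
      linarith [le_abs_self (symbol ![Real.pi, 0]).re]
  obtain ⟨σ, hσ, hmax⟩ := hS.exists_isMaxOn ⟨_, hp⟩
    (Complex.continuous_re.comp_continuousOn (continuousOn_symbol.mono hne))
  have hpi : Real.pi / 6 ≤ (symbol σ).re := le_symbol_pi.trans (hmax hp)
  refine ⟨σ, hσ.1, hne σ hσ, hpi, fun τ hτ => ?_⟩
  by_cases hb : τ ∈ Metric.ball 0 δ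
  · exact (le_abs_self _).trans ((hball τ hb).le.trans hpi)
  · exact hmax ⟨hτ, hb⟩

theorem exists_symbol_eq_lambdaPlus : ∃ σ ∈ periodSquare, laplaceSymbol σ ≠ 0 ∧
    (symbol σ).re = lambdaPlus ∧ Real.pi / 6 ≤ lambdaPlus ∧
    ∀ τ ∈ periodSquare, (symbol τ).re ≤ lambdaPlus := by
  obtain ⟨σ, hσ, h0, hpi, hmax⟩ := exists_symbol_max
  have : lambdaPlus = (symbol σ).re :=
    IsGreatest.csSup_eq ⟨⟨σ, hσ, rfl⟩, by rintro _ ⟨τ, hτ, rfl⟩; exact hmax τ hτ⟩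
  exact ⟨σ, hσ, h0, this.symm, this ▸ hpi, this ▸ hmax⟩

theorem half_lt_lambdaPlus : 1 / 2 < lambdaPlus := by
  obtain ⟨σ, -, -, -, h, -⟩ := exists_symbol_eq_lambdaPlus
  linarith [Real.pi_gt_three]

theorem abs_symbol_le (τ : Fin 2 → ℝ) : |(symbol τ).re| ≤ lambdaPlus := by
  obtain ⟨n, hn⟩ := exists_period_shift τ
  rw [← symbol_periodic τ n]
  obtain ⟨σ, -, -, -, -, h⟩ := exists_symbol_eq_lambdaPlus
  rw [abs_le]
  have := h _ (coordSwap_mem_periodSquare hn)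
  rw [symbol_coordSwap, Complex.neg_re] at this
  exact ⟨by linarith, h _ hn⟩

theorem laplaceSymbol_coordSwap (τ : Fin 2 → ℝ) :
    laplaceSymbol (coordSwap ℝ τ) = laplaceSymbol τ := by
  simp only [laplaceSymbol, coordSwap_zero, coordSwap_one]
  ring

/-- The plane minus the countable set `2πℤ²` is connected and the symbol is continuous on it. The
preimage being a point of continuity is essential for the instability argument. -/
theorem exists_symbol_eq {t : ℝ} (ht : t ∈ Set.Icc (-lambdaPlus) lambdaPlus) :
    ∃ τ : Fin 2 → ℝ, laplaceSymbol τ ≠ 0 ∧ symbol τ = t := by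
  have hset : {τ : Fin 2 → ℝ | laplaceSymbol τ ≠ 0}
      = (Set.range fun (n : Fin 2 → ℤ) (i : Fin 2) => (n i : ℝ) * (2 * Real.pi))ᶜ := by
    ext τ
    simp only [Set.mem_ofPred_eq, Set.mem_compl_iff, Set.mem_range, ne_eq,
      laplaceSymbol_eq_zero_iff', eq_comm]
  have hconn : IsPreconnected {τ : Fin 2 → ℝ | laplaceSymbol τ ≠ 0} := by
    rw [hset]
    refine ((Set.countable_range _).isConnected_compl_of_one_lt_rank ?_).isPreconnected
    rw [rank_fun']
    norm_num
  obtain ⟨σ, -, h0, hσ, -, -⟩ := exists_symbol_eq_lambdaPlus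
  have h1 : laplaceSymbol (coordSwap ℝ σ) ≠ 0 := by rwa [laplaceSymbol_coordSwap]
  have h2 : (symbol (coordSwap ℝ σ)).re = -lambdaPlus := by
    rw [symbol_coordSwap, Complex.neg_re, hσ]
  have := hconn.intermediate_value h1 h0
    (Complex.continuous_re.comp_continuousOn continuousOn_symbol)
  simp only [Function.comp_apply, h2, hσ] at this
  obtain ⟨τ, hτ, rfl⟩ := this ht
  exact ⟨τ, hτ, (ofReal_symbol_re τ).symm⟩

theorem symbol_image : symbol '' periodSquare = segmentC := by
  apply Set.Subset.antisymm
  · rintro _ ⟨τ, -, rfl⟩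
    exact ⟨(symbol τ).re, abs_le.1 (abs_symbol_le τ), ofReal_symbol_re τ⟩
  · rintro _ ⟨t, ht, rfl⟩
    obtain ⟨τ, -, h⟩ := exists_symbol_eq ht
    obtain ⟨n, hn⟩ := exists_period_shift τ
    exact ⟨_, hn, by rw [symbol_periodic, h]⟩

/-! ### Toeplitz forms and Fourier series on the torus. -/

section Torus

open MeasureTheory UnitAddTorus
open scoped ComplexConjugate

-- Haar measure of total mass one, for which the characters are orthonormal.
noncomputable local instance unitCircleMeasureSpace : MeasureSpace UnitAddCircle :=
  ⟨AddCircle.haarAddCircle⟩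

local instance isAddHaarMeasure_unitCircle :
    Measure.IsAddHaarMeasure (volume : Measure UnitAddCircle) :=
  inferInstanceAs (Measure.IsAddHaarMeasure AddCircle.haarAddCircle)

local instance isProbabilityMeasure_unitCircle :
    IsProbabilityMeasure (volume : Measure UnitAddCircle) :=
  inferInstanceAs (IsProbabilityMeasure AddCircle.haarAddCircle)

theorem mFourier_coe (τ : Fin 2 → ℝ) (m : Fin 2 → ℤ) :
    mFourier m (fun i => ((τ i / (2 * Real.pi) : ℝ) : UnitAddCircle)) = latticeChar τ m := by
  have hpi : (Real.pi : ℂ) ≠ 0 := by exact_mod_cast Real.pi_ne_zero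
  simp only [mFourier, ContinuousMap.coe_mk, fourier_coe_apply, Fin.prod_univ_two,
    ← Complex.exp_add, latticeChar, Fin.sum_univ_two]
  congr 1
  push_cast
  field_simp

theorem exists_torus_lift (x : UnitAddTorus (Fin 2)) :
    ∃ τ : Fin 2 → ℝ, (fun i => ((τ i / (2 * Real.pi) : ℝ) : UnitAddCircle)) = x := by
  choose t ht using fun i => QuotientAddGroup.mk_surjective (x i)
  refine ⟨fun i => 2 * Real.pi * t i, ?_⟩
  ext i
  rw [mul_div_cancel_left₀ _ (by positivity)]
  exact ht i

/-- A point of the plane over a point of the torus. -/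
noncomputable def torusLift (x : UnitAddTorus (Fin 2)) : Fin 2 → ℝ :=
  (exists_torus_lift x).choose

theorem torusLift_spec (x : UnitAddTorus (Fin 2)) :
    (fun i => ((torusLift x i / (2 * Real.pi) : ℝ) : UnitAddCircle)) = x :=
  (exists_torus_lift x).choose_spec

theorem latticeChar_torusLift (x : UnitAddTorus (Fin 2)) (m : Fin 2 → ℤ) :
    latticeChar (torusLift x) m = mFourier m x := by
  rw [← mFourier_coe, torusLift_spec]

/-- The symbol as a function on the torus. -/
noncomputable def torusSymbol (x : UnitAddTorus (Fin 2)) : ℂ := symbol (torusLift x)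

theorem symbol_congr {τ σ : Fin 2 → ℝ} (h : ∀ m, latticeChar τ m = latticeChar σ m) :
    symbol τ = symbol σ :=
  tendsto_nhds_unique (tendsto_symbolPartialSum τ)
    ((tendsto_symbolPartialSum σ).congr fun M => by simp only [symbolPartialSum_eq, h])

theorem torusSymbol_coe (τ : Fin 2 → ℝ) :
    torusSymbol (fun i => ((τ i / (2 * Real.pi) : ℝ) : UnitAddCircle)) = symbol τ :=
  symbol_congr fun m => by rw [latticeChar_torusLift, mFourier_coe]

theorem tendsto_torusSymbol (x : UnitAddTorus (Fin 2)) :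
    Tendsto (fun M => ∑ m ∈ latticeBox M, (latticeCoeff m : ℂ) * mFourier m x) atTop
      (𝓝 (torusSymbol x)) :=
  (tendsto_symbolPartialSum (torusLift x)).congr fun M => by
    simp only [symbolPartialSum_eq, latticeChar_torusLift]

theorem continuousAt_torusSymbol {τ : Fin 2 → ℝ} (hτ : laplaceSymbol τ ≠ 0) :
    ContinuousAt torusSymbol (fun i => ((τ i / (2 * Real.pi) : ℝ) : UnitAddCircle)) := by
  have hS : Continuous fun x : UnitAddTorus (Fin 2) => laplaceSeries (torusLift x) := by
    simp only [laplaceSeries, latticeChar_torusLift]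
    refine continuous_tsum (fun m => ?_) summable_abs_laplaceCoeff fun m x => ?_
    · fun_prop
    · rw [← latticeChar_torusLift, norm_laplaceCoeff_mul_char]
  have hD : Continuous fun x : UnitAddTorus (Fin 2) => (laplaceSymbol (torusLift x) : ℂ) := by
    simp only [laplaceSymbol_eq, latticeChar_torusLift]
    fun_prop
  set x₀ : UnitAddTorus (Fin 2) := fun i => ((τ i / (2 * Real.pi) : ℝ) : UnitAddCircle)
  have h0 : (laplaceSymbol (torusLift x₀) : ℂ) ≠ 0 := by
    rw [laplaceSymbol_eq]
    simp only [latticeChar_torusLift, x₀, mFourier_coe]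
    rw [← laplaceSymbol_eq]
    exact_mod_cast hτ
  have hc : ContinuousAt (fun x : UnitAddTorus (Fin 2) =>
      laplaceSeries (torusLift x) / (laplaceSymbol (torusLift x) : ℂ)) x₀ :=
    hS.continuousAt.div hD.continuousAt h0
  refine hc.congr ?_
  filter_upwards [hD.continuousAt.eventually_ne h0] with x hx
  exact (symbol_eq_div (by exact_mod_cast hx)).symm

theorem memℓp_latticeCoeff : Memℓp (fun m => (latticeCoeff m : ℂ)) 2 := by
  refine memℓp_gen ?_
  refine Summable.of_norm_bounded_eventually
    (EisensteinSeries.summable_one_div_norm_rpow (k := 4) (by norm_num)) ?_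
  refine (Set.finite_singleton (0 : Fin 2 → ℤ)).subset fun m hm => ?_
  by_contra h
  refine hm ?_
  have h1 : 0 < ‖m‖ := norm_pos_iff.2 h
  have h2 := abs_latticeCoeff_mul_le m
  rw [Set.mem_ofPred_eq, Complex.norm_real, Real.norm_eq_abs, ENNReal.toReal_ofNat,
    Real.rpow_ofNat, Real.norm_eq_abs, abs_of_nonneg (by positivity), Real.rpow_neg h1.le,
    Real.rpow_ofNat, ← one_div, le_div_iff₀ (by positivity)]
  calc |latticeCoeff m| ^ 2 * ‖m‖ ^ 4 = (|latticeCoeff m| * ‖m‖ ^ 2) ^ 2 := by ring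
    _ ≤ 1 := pow_le_one₀ (by positivity) h2

/-- Square summability of the coefficients yields an `L²` sum, and the square partial sums converge
everywhere to the symbol. The two limits agree almost everywhere, which supplies measurability and
the Fourier coefficients of the symbol. -/
theorem exists_L2_torusSymbol : ∃ f : Lp ℂ 2 (volume : Measure (UnitAddTorus (Fin 2))),
    f =ᵐ[volume] torusSymbol ∧ ∀ m, mFourierCoeff f m = latticeCoeff m := by
  let c : lp (fun _ : Fin 2 → ℤ => ℂ) 2 := ⟨_, memℓp_latticeCoeff⟩
  let f := (mFourierBasis (d := Fin 2)).repr.symm c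
  have hcoef : ∀ m, mFourierCoeff f m = latticeCoeff m := fun m => by
    rw [← mFourierBasis_repr, LinearIsometryEquiv.apply_symm_apply]
  refine ⟨f, ?_, hcoef⟩
  have hs := (hasSum_mFourier_series_L2 f).comp tendsto_latticeBox
  -- Convergence in `L²` implies convergence in measure, hence almost everywhere along a
  -- subsequence.
  obtain ⟨ns, hns, hae⟩ := (tendstoInMeasure_of_tendsto_Lp hs).exists_seq_tendsto_ae
  have hterm : ∀ᵐ x ∂(volume : Measure (UnitAddTorus (Fin 2))), ∀ M : ℕ,
      (∑ m ∈ latticeBox M, mFourierCoeff f m • mFourierLp 2 m :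
        Lp ℂ 2 (volume : Measure (UnitAddTorus (Fin 2)))) x
        = ∑ m ∈ latticeBox M, (latticeCoeff m : ℂ) * mFourier m x := by
    rw [ae_all_iff]
    intro M
    have h1 : ∀ᵐ x ∂(volume : Measure (UnitAddTorus (Fin 2))), ∀ m : Fin 2 → ℤ,
        (mFourierCoeff f m • mFourierLp 2 m :
          Lp ℂ 2 (volume : Measure (UnitAddTorus (Fin 2)))) x
          = (latticeCoeff m : ℂ) * mFourier m x := by
      rw [ae_all_iff]
      intro m
      filter_upwards [Lp.coeFn_smul (mFourierCoeff f m) (mFourierLp 2 m),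
        coeFn_mFourierLp 2 m] with x hx hx'
      rw [hx, Pi.smul_apply, hx', hcoef, smul_eq_mul]
    filter_upwards [h1, Lp.coeFn_finsetSum (latticeBox M)
      (fun m => mFourierCoeff f m • mFourierLp 2 m)] with x hx hx'
    rw [hx', Finset.sum_apply]
    exact Finset.sum_congr rfl fun m _ => hx m
  filter_upwards [hae, hterm] with x hx hx'
  refine tendsto_nhds_unique hx ?_
  refine ((tendsto_torusSymbol x).comp hns.tendsto_atTop).congr fun n => ?_
  exact (hx' (ns n)).symm

theorem norm_torusSymbol_le (x : UnitAddTorus (Fin 2)) : ‖torusSymbol x‖ ≤ lambdaPlus := by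
  rw [torusSymbol, ← ofReal_symbol_re, Complex.norm_real]
  exact abs_symbol_le _

theorem aestronglyMeasurable_torusSymbol :
    AEStronglyMeasurable torusSymbol (volume : Measure (UnitAddTorus (Fin 2))) := by
  obtain ⟨f, hf, -⟩ := exists_L2_torusSymbol
  exact (Lp.aestronglyMeasurable f).congr hf

theorem mFourierCoeff_torusSymbol (m : Fin 2 → ℤ) :
    mFourierCoeff torusSymbol m = latticeCoeff m := by
  obtain ⟨f, hf, hc⟩ := exists_L2_torusSymbol
  rw [← hc]
  exact integral_congr_ae (hf.mono fun x hx => by simp only [hx])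

theorem integrable_torusSymbol :
    Integrable torusSymbol (volume : Measure (UnitAddTorus (Fin 2))) :=
  Integrable.of_bound aestronglyMeasurable_torusSymbol _ (ae_of_all _ norm_torusSymbol_le)

/-- The trigonometric polynomial with the coefficients `u`. -/
noncomputable def trigPoly {s : Finset (Fin 2 → ℤ)} (u : s → ℂ) : C(UnitAddTorus (Fin 2), ℂ) :=
  ∑ n : s, u n • mFourier (n : Fin 2 → ℤ)

theorem integral_trigPoly_mul {s : Finset (Fin 2 → ℤ)} (u v : s → ℂ)
    {g : UnitAddTorus (Fin 2) → ℂ} (hg : Integrable g) :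
    ∫ x, conj (trigPoly v x) * (g x * trigPoly u x)
      = ∑ m : s, conj (v m) * ∑ n : s, mFourierCoeff g (m.1 - n.1) * u n := by
  have hint : ∀ m n : s, Integrable fun x : UnitAddTorus (Fin 2) =>
      conj (v m) * u n * (mFourier (-(m.1 - n.1)) x * g x) := fun m n => by
    refine Integrable.const_mul ?_ _
    refine hg.bdd_mul (c := 1) ?_ (ae_of_all _ fun x => ?_)
    · exact (mFourier (-(m.1 - n.1))).continuous.aestronglyMeasurable
    · exact ((mFourier (-(m.1 - n.1))).norm_coe_le_norm x).trans_eq mFourier_norm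
  have e : ∀ x : UnitAddTorus (Fin 2), conj (trigPoly v x) * (g x * trigPoly u x)
      = ∑ m : s, ∑ n : s,
        conj (v m) * u n * (mFourier (-(m.1 - n.1)) x * g x) := fun x => by
    simp only [trigPoly, ContinuousMap.coe_sum, Finset.sum_apply, ContinuousMap.coe_smul,
      Pi.smul_apply, smul_eq_mul, map_sum, map_mul]
    rw [Finset.mul_sum, Finset.sum_mul_sum]
    refine Finset.sum_congr rfl fun m _ => Finset.sum_congr rfl fun n _ => ?_
    rw [neg_sub, sub_eq_add_neg, mFourier_add, mFourier_neg]
    ring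
  simp_rw [e]
  rw [integral_finsetSum _ fun m _ => integrable_finsetSum _ fun n _ => hint m n]
  refine Finset.sum_congr rfl fun m _ => ?_
  rw [integral_finsetSum _ fun n _ => hint m n, Finset.mul_sum]
  refine Finset.sum_congr rfl fun n _ => ?_
  rw [integral_const_mul, mFourierCoeff]
  simp only [smul_eq_mul]
  ring

theorem mFourierCoeff_const (c : ℂ) (m : Fin 2 → ℤ) :
    mFourierCoeff (fun _ : UnitAddTorus (Fin 2) => c) m = if m = 0 then c else 0 := by
  have h := mFourierBasis_repr (mFourierLp (d := Fin 2) 2 0) m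
  rw [← coe_mFourierBasis, HilbertBasis.repr_self] at h
  have h2 : mFourierCoeff (mFourierBasis (d := Fin 2) 0) m
      = mFourierCoeff (fun _ : UnitAddTorus (Fin 2) => (1 : ℂ)) m := by
    rw [coe_mFourierBasis]
    refine integral_congr_ae ((coeFn_mFourierLp 2 0).mono fun x hx => ?_)
    simp only [hx, mFourier_zero, ContinuousMap.one_apply]
  rw [h2] at h
  have h3 : mFourierCoeff (fun _ : UnitAddTorus (Fin 2) => c) m
      = mFourierCoeff (fun _ : UnitAddTorus (Fin 2) => (1 : ℂ)) m * c := by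
    simp only [mFourierCoeff, smul_eq_mul, mul_one]
    rw [integral_mul_const]
  rw [h3, ← h, lp.single_apply]
  by_cases hm : m = 0
  · subst hm; simp
  · simp [hm]

theorem integral_norm_trigPoly_sq {s : Finset (Fin 2 → ℤ)} (u : s → ℂ) :
    ∫ x, ‖trigPoly u x‖ ^ 2 = ∑ m : s, ‖u m‖ ^ 2 := by
  have h := integral_trigPoly_mul u u (integrable_const (1 : ℂ))
  have e : ∀ x, conj (trigPoly u x) * (1 * trigPoly u x) = ((‖trigPoly u x‖ ^ 2 : ℝ) : ℂ) := by
    intro x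
    rw [one_mul, Complex.conj_mul']
    push_cast
    rfl
  simp_rw [e, mFourierCoeff_const, sub_eq_zero, SetLike.coe_eq_coe] at h
  rw [integral_complex_ofReal] at h
  simp only [ite_mul, one_mul, zero_mul, Finset.sum_ite_eq, Finset.mem_univ, if_true,
    Complex.conj_mul'] at h
  exact_mod_cast h

/-- The finite Toeplitz matrix of the symbol. -/
noncomputable def toeplitz (s : Finset (Fin 2 → ℤ)) : Matrix s s ℂ :=
  Matrix.of fun m n => (latticeCoeff (m.1 - n.1) : ℂ)

theorem inner_toeplitz {s : Finset (Fin 2 → ℤ)} (lam : ℂ) (u v : s → ℂ) :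
    ∑ m : s, conj (v m) * (lam • 1 - toeplitz s).mulVec u m
      = ∫ x, conj (trigPoly v x) * ((lam - torusSymbol x) * trigPoly u x) := by
  have hg : Integrable (fun x : UnitAddTorus (Fin 2) => lam - torusSymbol x) :=
    (integrable_const lam).sub integrable_torusSymbol
  have hc : ∀ m, mFourierCoeff (fun x : UnitAddTorus (Fin 2) => lam - torusSymbol x) m
      = (if m = 0 then lam else 0) - latticeCoeff m := fun m => by
    rw [← mFourierCoeff_const, ← mFourierCoeff_torusSymbol]
    simp only [mFourierCoeff, smul_sub]
    refine integral_sub ?_ ?_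
    · exact (integrable_const lam).bdd_mul (c := 1)
        (mFourier (-m)).continuous.aestronglyMeasurable
        (ae_of_all _ fun x => ((mFourier (-m)).norm_coe_le_norm x).trans_eq mFourier_norm)
    · exact integrable_torusSymbol.bdd_mul (c := 1)
        (mFourier (-m)).continuous.aestronglyMeasurable
        (ae_of_all _ fun x => ((mFourier (-m)).norm_coe_le_norm x).trans_eq mFourier_norm)
  rw [integral_trigPoly_mul u v hg]
  refine Finset.sum_congr rfl fun m _ => ?_
  congr 1
  rw [Matrix.sub_mulVec, Matrix.smul_mulVec, Matrix.one_mulVec]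
  simp only [hc, sub_mul, Finset.sum_sub_distrib, sub_eq_zero, SetLike.coe_eq_coe, ite_mul,
    zero_mul, Finset.sum_ite_eq, Finset.mem_univ, if_true]
  rfl

theorem integrable_mul_norm_trigPoly_sq {s : Finset (Fin 2 → ℤ)} (u : s → ℂ)
    {g : UnitAddTorus (Fin 2) → ℝ} {C : ℝ} (hg : AEStronglyMeasurable g) (hC : ∀ x, ‖g x‖ ≤ C) :
    Integrable fun x => g x * ‖trigPoly u x‖ ^ 2 := by
  refine Integrable.bdd_mul (c := C) ?_ hg (ae_of_all _ hC)
  exact (Continuous.integrable_of_hasCompactSupport (by fun_prop)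
    (HasCompactSupport.of_compactSpace _))

/-- The symbol is real and bounded by `lambdaPlus`, so `r`, the integral of the symbol against
`|trigPoly u|²`, is real and controlled by Parseval. -/
theorem exists_real_form {s : Finset (Fin 2 → ℤ)} (lam : ℂ) (u : s → ℂ) :
    ∃ r : ℝ, |r| ≤ lambdaPlus * ∑ m : s, ‖u m‖ ^ 2 ∧
      ∑ m : s, conj (u m) * (lam • 1 - toeplitz s).mulVec u m
        = lam * ((∑ m : s, ‖u m‖ ^ 2 : ℝ) : ℂ) - r := by
  have hm : AEStronglyMeasurable (fun x => (torusSymbol x).re)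
      (volume : Measure (UnitAddTorus (Fin 2))) :=
    Complex.continuous_re.comp_aestronglyMeasurable aestronglyMeasurable_torusSymbol
  have hb : ∀ x, ‖(torusSymbol x).re‖ ≤ lambdaPlus := fun x => abs_symbol_le _
  have hi := integrable_mul_norm_trigPoly_sq u hm hb
  have h1 : Integrable fun x => ‖trigPoly u x‖ ^ 2 := by
    simpa using integrable_mul_norm_trigPoly_sq u (g := fun _ => 1) (C := 1)
      aestronglyMeasurable_const (by simp)
  refine ⟨∫ x, (torusSymbol x).re * ‖trigPoly u x‖ ^ 2, ?_, ?_⟩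
  · rw [← integral_norm_trigPoly_sq, ← integral_const_mul, ← Real.norm_eq_abs]
    refine norm_integral_le_of_norm_le (h1.const_mul _) (ae_of_all _ fun x => ?_)
    rw [norm_mul, norm_pow, norm_norm]
    gcongr
    exact hb x
  · rw [inner_toeplitz, ← integral_norm_trigPoly_sq, ← integral_complex_ofReal,
      ← integral_complex_ofReal, ← integral_const_mul, ← integral_sub]
    · refine integral_congr_ae (ae_of_all _ fun x => ?_)
      have e := Complex.conj_mul' (trigPoly u x)
      have e2 : ((torusSymbol x).re : ℂ) = torusSymbol x := ofReal_symbol_re _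
      simp only [Complex.ofReal_mul, e2, Complex.ofReal_pow]
      linear_combination (lam - torusSymbol x) * e
    · exact h1.ofReal.const_mul _
    · exact hi.ofReal

theorem isClosed_segmentC : IsClosed segmentC :=
  (isCompact_Icc.image Complex.continuous_ofReal).isClosed

theorem segmentC_nonempty : segmentC.Nonempty :=
  ⟨_, 0, ⟨by linarith [half_lt_lambdaPlus], by linarith [half_lt_lambdaPlus]⟩, rfl⟩

/-- The Rayleigh quotient of the Toeplitz matrix lies in the segment; the distance bound for the
quadratic form then passes to the vector by Cauchy–Schwarz. -/
theorem infDist_mul_norm_le (s : Finset (Fin 2 → ℤ)) (lam : ℂ) (u : EuclideanSpace ℂ s) :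
    Metric.infDist lam segmentC * ‖u‖
      ≤ ‖Matrix.toEuclideanCLM (n := s) (𝕜 := ℂ) (lam • 1 - toeplitz s) u‖ := by
  rcases eq_or_ne u 0 with rfl | hu
  · simp
  have hpos : 0 < ‖u‖ := norm_pos_iff.2 hu
  obtain ⟨r, hr, heq⟩ := exists_real_form lam (WithLp.ofLp u)
  rw [← EuclideanSpace.norm_sq_eq] at hr heq
  set w := Matrix.toEuclideanCLM (n := s) (𝕜 := ℂ) (lam • 1 - toeplitz s) u with hw
  have hinner : inner ℂ u w = lam * ((‖u‖ ^ 2 : ℝ) : ℂ) - r := by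
    rw [← heq, PiLp.inner_apply]
    refine Finset.sum_congr rfl fun m _ => ?_
    rw [RCLike.inner_apply, mul_comm]
    rfl
  have h1 : Metric.infDist lam segmentC ≤ ‖lam - ((r / ‖u‖ ^ 2 : ℝ) : ℂ)‖ := by
    rw [← dist_eq_norm]
    refine Metric.infDist_le_dist_of_mem ⟨_, abs_le.1 ?_, rfl⟩
    rw [abs_div, abs_of_pos (by positivity : 0 < ‖u‖ ^ 2), div_le_iff₀ (by positivity)]
    exact hr
  have h2 : ‖(inner ℂ u w : ℂ)‖ ≤ ‖u‖ * ‖w‖ := norm_inner_le_norm u w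
  have h3 : (inner ℂ u w : ℂ) = (lam - ((r / ‖u‖ ^ 2 : ℝ) : ℂ)) * ((‖u‖ ^ 2 : ℝ) : ℂ) := by
    have : ((‖u‖ : ℝ) : ℂ) ≠ 0 := by exact_mod_cast hpos.ne'
    rw [hinner]
    push_cast
    field_simp
  rw [h3, norm_mul, Complex.norm_real, norm_pow, norm_norm] at h2
  have h4 : Metric.infDist lam segmentC * ‖u‖ ^ 2 ≤ ‖u‖ * ‖w‖ :=
    le_trans (by gcongr) h2
  rw [pow_two] at h4
  nlinarith

/-! ### Reduction of the system matrix and stability off the segment. -/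

theorem kernel_smul (c : ℝ) (x : Plane) : kernel (c • x) = (c ^ 2)⁻¹ * kernel x := by
  rcases eq_or_ne c 0 with rfl | hc
  · simp [kernel]
  simp only [kernel, PiLp.smul_apply, smul_eq_mul, norm_smul, mul_pow, Real.norm_eq_abs]
  rw [show |c| ^ 4 = c ^ 4 by rw [← abs_pow, abs_of_nonneg (by positivity)], ← mul_sub,
    show 2 * Real.pi * (c ^ 4 * ‖x‖ ^ 4) = c ^ 2 * (c ^ 2 * (2 * Real.pi * ‖x‖ ^ 4)) by ring,
    mul_div_mul_left _ _ (pow_ne_zero 2 hc), ← div_div, div_right_comm, inv_mul_eq_div]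

/-- Homogeneity of degree `-2` cancels the factor `N⁻²`, and differences of grid points forget the
origin; only the index set depends on the grid. -/
theorem systemMatrix_eq {Ω : Set Plane} (hΩ : Bornology.IsBounded Ω) (a : Plane) (N : ℕ+) :
    systemMatrix hΩ a N = toeplitz (gridIndex hΩ a N) := by
  ext m n
  have hN : ((N : ℕ) : ℝ) ≠ 0 := by exact_mod_cast N.ne_zero
  have hlat : gridPoint a N m - gridPoint a N n
      = ((N : ℕ) : ℝ)⁻¹ • latticePoint (m.1 - n.1) := by
    ext i
    simp [gridPoint, latticePoint]
    ring
  simp only [systemMatrix, toeplitz, Matrix.of_apply]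
  split_ifs with h
  -- The zero diagonal matches because the kernel at the origin is `0 / 0 = 0`.
  · rw [h, sub_self, latticeCoeff_zero, Complex.ofReal_zero]
  · rw [hlat, kernel_smul, inv_pow, inv_inv, ← mul_assoc, inv_mul_cancel₀ (pow_ne_zero 2 hN),
      one_mul]
    rfl

theorem isUnit_of_lower_bound {ι : Type*} [Fintype ι] [DecidableEq ι] {A : Matrix ι ι ℂ} {d : ℝ}
    (hd : 0 < d) (h : ∀ u, d * ‖u‖ ≤ ‖Matrix.toEuclideanCLM (n := ι) (𝕜 := ℂ) A u‖) :
    IsUnit A := by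
  rw [← Matrix.mulVec_injective_iff_isUnit]
  have hz : ∀ x : ι → ℂ, A.mulVec x = 0 → x = 0 := fun x hx => by
    have h1 := h (WithLp.toLp 2 x)
    rw [Matrix.toEuclideanCLM_toLp, hx, WithLp.toLp_zero, norm_zero] at h1
    have h2 : ‖WithLp.toLp 2 x‖ = 0 := le_antisymm (by nlinarith) (norm_nonneg _)
    rw [norm_eq_zero] at h2
    simpa using congrArg WithLp.ofLp h2
  intro x y hxy
  rw [← sub_eq_zero]
  exact hz _ (by rw [Matrix.mulVec_sub, sub_eq_zero]; exact hxy)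

theorem norm_inv_le_of_lower_bound {ι : Type*} [Fintype ι] [DecidableEq ι] {A : Matrix ι ι ℂ}
    {d : ℝ} (hd : 0 < d)
    (h : ∀ u, d * ‖u‖ ≤ ‖Matrix.toEuclideanCLM (n := ι) (𝕜 := ℂ) A u‖) :
    ‖Matrix.toEuclideanCLM (n := ι) (𝕜 := ℂ) A⁻¹‖ ≤ d⁻¹ := by
  refine ContinuousLinearMap.opNorm_le_bound _ (by positivity) fun y => ?_
  have h1 := h (Matrix.toEuclideanCLM (n := ι) (𝕜 := ℂ) A⁻¹ y)
  rw [← mul_apply_eq_comp, ← map_mul, Matrix.mul_nonsing_inv _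
    ((Matrix.isUnit_iff_isUnit_det A).1 (isUnit_of_lower_bound hd h)), map_one,
    one_apply_eq_self] at h1
  rwa [inv_mul_eq_div, le_div_iff₀ hd, mul_comm]

theorem discrete_stability {Ω : Set Plane} (hΩ : Bornology.IsBounded Ω) (a : Plane) (N : ℕ+)
    {lam : ℂ} (hlam : lam ∉ segmentC) :
    (∀ f : gridIndex hΩ a N → ℂ, ∃! u : gridIndex hΩ a N → ℂ,
        (lam • 1 - systemMatrix hΩ a N).mulVec u = f) ∧
      resolventNorm hΩ a N lam ≤ (Metric.infDist lam segmentC)⁻¹ := by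
  have hd : 0 < Metric.infDist lam segmentC :=
    (isClosed_segmentC.notMem_iff_infDist_pos segmentC_nonempty).1 hlam
  have hb : ∀ u, Metric.infDist lam segmentC * ‖u‖
      ≤ ‖Matrix.toEuclideanCLM (n := gridIndex hΩ a N) (𝕜 := ℂ)
        (lam • 1 - systemMatrix hΩ a N) u‖ := fun u => by
    rw [systemMatrix_eq]
    exact infDist_mul_norm_le _ lam u
  have hU := isUnit_of_lower_bound hd hb
  refine ⟨fun f => ?_, norm_inv_le_of_lower_bound hd hb⟩
  exact Function.Bijective.existsUnique ⟨Matrix.mulVec_injective_iff_isUnit.2 hU,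
    Matrix.mulVec_surjective_iff_isUnit.2 hU⟩ f

/-! ### Peaking polynomials and instability on the segment. -/

/-- Toeplitz matrices are bounded by multiplication with the symbol. -/
theorem norm_sq_toeplitz_le (s : Finset (Fin 2 → ℤ)) (lam : ℂ) (u : EuclideanSpace ℂ s) :
    ‖Matrix.toEuclideanCLM (n := s) (𝕜 := ℂ) (lam • 1 - toeplitz s) u‖ ^ 2
      ≤ ∫ x, ‖lam - torusSymbol x‖ ^ 2 * ‖trigPoly (WithLp.ofLp u) x‖ ^ 2 := by
  set w := Matrix.toEuclideanCLM (n := s) (𝕜 := ℂ) (lam • 1 - toeplitz s) u with hw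
  have h := inner_toeplitz lam (WithLp.ofLp u) (WithLp.ofLp w)
  have hww : ∑ m : s, conj (w m) * (lam • 1 - toeplitz s).mulVec (WithLp.ofLp u) m
      = ((‖w‖ ^ 2 : ℝ) : ℂ) := by
    rw [EuclideanSpace.norm_sq_eq]
    push_cast
    exact Finset.sum_congr rfl fun m _ => Complex.conj_mul' (w m)
  rw [hww] at h
  have hbd : ∀ x, ‖‖lam - torusSymbol x‖ ^ 2‖ ≤ (‖lam‖ + lambdaPlus) ^ 2 := fun x => by
    rw [norm_pow, norm_norm]
    gcongr
    exact (norm_sub_le _ _).trans (by gcongr; exact norm_torusSymbol_le x)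
  have hmeas : AEStronglyMeasurable (fun x => ‖lam - torusSymbol x‖ ^ 2)
      (volume : Measure (UnitAddTorus (Fin 2))) :=
    ((aestronglyMeasurable_const.sub aestronglyMeasurable_torusSymbol).norm).pow 2
  have hi := integrable_mul_norm_trigPoly_sq (WithLp.ofLp u) hmeas hbd
  have h1 : Integrable fun x => ‖trigPoly (WithLp.ofLp w) x‖ ^ 2 := by
    simpa using integrable_mul_norm_trigPoly_sq (WithLp.ofLp w) (g := fun _ => 1) (C := 1)
      aestronglyMeasurable_const (by simp)
  -- Testing the form with the image `w` itself and using `2 x y ≤ x² + y²`; the part belonging to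
  -- `w` integrates to `‖w‖² / 2` and is absorbed on the left.
  have h2 : ‖w‖ ^ 2 ≤ ∫ x, (‖trigPoly (WithLp.ofLp w) x‖ ^ 2
      + ‖lam - torusSymbol x‖ ^ 2 * ‖trigPoly (WithLp.ofLp u) x‖ ^ 2) / 2 := by
    calc ‖w‖ ^ 2 = ‖(((‖w‖ ^ 2 : ℝ)) : ℂ)‖ := by
          rw [Complex.norm_real, norm_pow, norm_norm]
      _ = ‖∫ x, conj (trigPoly (WithLp.ofLp w) x)
            * ((lam - torusSymbol x) * trigPoly (WithLp.ofLp u) x)‖ := by rw [h]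
      _ ≤ _ := by
        refine norm_integral_le_of_norm_le ((h1.add hi).div_const 2) (ae_of_all _ fun x => ?_)
        rw [norm_mul, norm_mul, RCLike.norm_conj]
        nlinarith [sq_nonneg (‖trigPoly (WithLp.ofLp w) x‖
          - ‖lam - torusSymbol x‖ * ‖trigPoly (WithLp.ofLp u) x‖)]
  rw [integral_div, integral_add h1 hi, integral_norm_trigPoly_sq, ← EuclideanSpace.norm_sq_eq]
    at h2
  linarith

/-- A trigonometric polynomial of degree one whose modulus peaks at `x₀`. -/
noncomputable def peak (x₀ : UnitAddTorus (Fin 2)) : C(UnitAddTorus (Fin 2), ℂ) :=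
  mFourier 0 + conj (mFourier ![1, 0] x₀) • mFourier ![1, 0]
    + conj (mFourier ![0, 1] x₀) • mFourier ![0, 1]

theorem norm_mFourier_apply (m : Fin 2 → ℤ) (x : UnitAddTorus (Fin 2)) : ‖mFourier m x‖ = 1 := by
  rw [← latticeChar_torusLift, norm_latticeChar]

theorem norm_one_add_lt {a : ℂ} (ha : ‖a‖ = 1) (h : a ≠ 1) : ‖1 + a‖ < 2 := by
  refine lt_of_pow_lt_pow_left₀ 2 (by norm_num) ?_
  have h1 : a.re < 1 := by
    refine lt_of_le_of_ne (ha ▸ Complex.re_le_norm a) fun h2 => h ?_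
    have h3 : a.re ^ 2 + a.im ^ 2 = 1 := by
      rw [← one_pow 2, ← ha, ← Complex.normSq_eq_norm_sq, Complex.normSq_apply]
      ring
    rw [h2] at h3
    exact Complex.ext h2 (by simpa using h3)
  have h4 : Complex.normSq a = 1 := by rw [Complex.normSq_eq_norm_sq, ha, one_pow]
  rw [← Complex.normSq_eq_norm_sq]
  rw [Complex.normSq_apply] at h4 ⊢
  simp only [Complex.add_re, Complex.one_re, Complex.add_im, Complex.one_im]
  nlinarith

theorem norm_peak_self (x₀ : UnitAddTorus (Fin 2)) : ‖peak x₀ x₀‖ = 3 := by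
  have : peak x₀ x₀ = 3 := by
    simp only [peak, ContinuousMap.add_apply, ContinuousMap.smul_apply, smul_eq_mul,
      Complex.conj_mul', norm_mFourier_apply, mFourier_zero, ContinuousMap.one_apply]
    norm_num
  rw [this]
  norm_num

/-- After factoring out phases, the peak is a sum of three unit numbers, one of them 1. Modulus 3
forces all to be equal, and the two basic characters separate points of the torus. -/
theorem norm_peak_lt {x₀ x : UnitAddTorus (Fin 2)} (h : x ≠ x₀) : ‖peak x₀ x‖ < 3 := by
  set α := conj (mFourier ![1, 0] x₀) * mFourier ![1, 0] x with hα
  set β := conj (mFourier ![0, 1] x₀) * mFourier ![0, 1] x with hβ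
  have hp : peak x₀ x = 1 + α + β := by
    simp only [peak, ContinuousMap.add_apply, ContinuousMap.smul_apply, smul_eq_mul,
      mFourier_zero, ContinuousMap.one_apply, hα, hβ]
  have nα : ‖α‖ = 1 := by rw [hα, norm_mul, RCLike.norm_conj]; simp [norm_mFourier_apply]
  have nβ : ‖β‖ = 1 := by rw [hβ, norm_mul, RCLike.norm_conj]; simp [norm_mFourier_apply]
  have hone : ∀ m : Fin 2 → ℤ, conj (mFourier m x₀) * mFourier m x = 1 →
      mFourier m x = mFourier m x₀ := fun m hm => by
    have h2 : mFourier m x₀ * conj (mFourier m x₀) = 1 := by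
      rw [mul_comm, Complex.conj_mul', norm_mFourier_apply]; norm_num
    linear_combination (mFourier m x₀) * hm - mFourier m x * h2
  have hcoord : ∀ i : Fin 2, mFourier (Pi.single i 1) x = mFourier (Pi.single i 1) x₀ →
      x i = x₀ i := fun i hi => by
    rw [mFourier_single, mFourier_single, fourier_one, fourier_one] at hi
    exact AddCircle.injective_toCircle one_ne_zero (Subtype.ext hi)
  have e0 : (![1, 0] : Fin 2 → ℤ) = Pi.single 0 1 := by decide
  have e1 : (![0, 1] : Fin 2 → ℤ) = Pi.single 1 1 := by decide
  have hor : α ≠ 1 ∨ β ≠ 1 := by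
    by_contra hcon
    push Not at hcon
    refine h (funext fun i => ?_)
    fin_cases i
    · exact hcoord 0 (by rw [← e0]; exact hone _ hcon.1)
    · exact hcoord 1 (by rw [← e1]; exact hone _ hcon.2)
  rw [hp]
  rcases hor with h1 | h1
  · have := norm_one_add_lt nα h1
    have := norm_add_le (1 + α) β
    linarith
  · have := norm_one_add_lt nβ h1
    have h2 := norm_add_le (1 + β) α
    rw [add_right_comm]
    linarith

theorem peak_pow_mem (x₀ : UnitAddTorus (Fin 2)) (n : ℕ) :
    peak x₀ ^ n ∈ Submodule.span ℂ (mFourier '' (latticeBox n : Set (Fin 2 → ℤ))) := by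
  have hbase : ∀ c : ℂ, ∀ m ∈ latticeBox 1, c • mFourier m
      ∈ Submodule.span ℂ (mFourier '' (latticeBox 1 : Set (Fin 2 → ℤ))) := fun c m hm =>
    Submodule.smul_mem _ _ (Submodule.subset_span ⟨m, hm, rfl⟩)
  have h1 : peak x₀ ∈ Submodule.span ℂ (mFourier '' (latticeBox 1 : Set (Fin 2 → ℤ))) := by
    refine Submodule.add_mem _ (Submodule.add_mem _ ?_ (hbase _ _ ?_)) (hbase _ _ ?_)
    · simpa using hbase 1 0 (by simp [mem_latticeBox])
    · simp [mem_latticeBox, Fin.forall_fin_two]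
    · simp [mem_latticeBox, Fin.forall_fin_two]
  induction n with
  | zero =>
    rw [pow_zero, ← mFourier_zero]
    exact Submodule.subset_span ⟨0, by simp [mem_latticeBox], rfl⟩
  | succ n ih =>
    rw [pow_succ]
    have h2 := Submodule.mul_mem_mul ih h1
    rw [Submodule.span_mul_span] at h2
    refine Submodule.span_mono ?_ h2
    rintro _ ⟨_, ⟨m, hm, rfl⟩, _, ⟨k, hk, rfl⟩, rfl⟩
    refine ⟨m + k, ?_, ?_⟩
    · rw [Finset.mem_coe, mem_latticeBox] at *
      intro i
      refine (abs_add_le _ _).trans ?_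
      have := hm i
      have := hk i
      push_cast at *
      omega
    · ext x
      exact mFourier_add

/-- Multiplication by a character translates the frequencies by `k` without changing the modulus, so
any translate of the box inside `s` will do. -/
theorem exists_trigPoly_peak (x₀ : UnitAddTorus (Fin 2)) (n : ℕ) (k : Fin 2 → ℤ)
    {s : Finset (Fin 2 → ℤ)} (hs : ∀ m ∈ latticeBox n, m + k ∈ s) :
    ∃ u : s → ℂ, ∀ x, ‖trigPoly u x‖ = ‖peak x₀ x‖ ^ n := by
  have h : peak x₀ ^ n * mFourier k ∈ Submodule.span ℂ (mFourier '' (s : Set (Fin 2 → ℤ))) := by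
    have h2 := Submodule.mul_mem_mul (peak_pow_mem x₀ n)
      (Submodule.subset_span (Set.mem_singleton (mFourier k)) : mFourier k ∈ Submodule.span ℂ _)
    rw [Submodule.span_mul_span] at h2
    refine Submodule.span_mono ?_ h2
    rintro _ ⟨_, ⟨m, hm, rfl⟩, _, rfl, rfl⟩
    refine ⟨m + k, hs m hm, ?_⟩
    ext x
    exact mFourier_add
  obtain ⟨u, hu⟩ := (Submodule.mem_span_image_finset_iff_exists_fun ℂ).1 h
  refine ⟨u, fun x => ?_⟩
  have : trigPoly u = peak x₀ ^ n * mFourier k := hu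
  rw [this, ContinuousMap.mul_apply, ContinuousMap.pow_apply, norm_mul, norm_mFourier_apply,
    mul_one, norm_pow]

/-- A ball in `Ω` around `y` contains arbitrarily large blocks of grid points once the mesh is fine;
the floor defining `k` places the block near `y` whatever the origin of the grid. -/
theorem exists_shifted_box_subset {Ω : Set Plane} (hΩo : IsOpen Ω) (hΩn : Ω.Nonempty)
    (hΩ : Bornology.IsBounded Ω) (a : ℕ+ → Plane) (n : ℕ) (N₀ : ℕ+) :
    ∃ N, N₀ ≤ N ∧ ∃ k : Fin 2 → ℤ, ∀ m ∈ latticeBox n, m + k ∈ gridIndex hΩ (a N) N := by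
  obtain ⟨y, hy⟩ := hΩn
  obtain ⟨r, hr, hball⟩ := Metric.isOpen_iff.1 hΩo y hy
  obtain ⟨M, hM⟩ := exists_nat_gt (2 * ((n : ℝ) + 1) / r)
  set N : ℕ+ := N₀ + M.succPNat with hNdef
  have hN0 : (0 : ℝ) < ((N : ℕ) : ℝ) := by exact_mod_cast N.pos
  have hNM : 2 * ((n : ℝ) + 1) < ((N : ℕ) : ℝ) * r := by
    rw [div_lt_iff₀ hr] at hM
    refine hM.trans_le ?_
    gcongr
    rw [hNdef, PNat.add_coe, Nat.succPNat_coe]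
    omega
  refine ⟨N, (PNat.lt_add_right _ _).le, fun i => ⌊((N : ℕ) : ℝ) * (y i - a N i)⌋, fun m hm => ?_⟩
  rw [gridIndex, Set.Finite.mem_toFinset]
  refine hball ?_
  rw [Metric.mem_ball, dist_eq_norm]
  have hcoord : ∀ i, |(gridPoint (a N) N (m + fun i => ⌊((N : ℕ) : ℝ) * (y i - a N i)⌋) - y) i|
      ≤ ((n : ℝ) + 1) / ((N : ℕ) : ℝ) := fun i => by
    have h1 := mem_latticeBox.1 hm i
    have h2 : |(m i : ℝ)| ≤ n := by exact_mod_cast h1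
    have h3 := Int.floor_le (((N : ℕ) : ℝ) * (y i - a N i))
    have h4 := Int.lt_floor_add_one (((N : ℕ) : ℝ) * (y i - a N i))
    have e : (gridPoint (a N) N (m + fun i => ⌊((N : ℕ) : ℝ) * (y i - a N i)⌋) - y) i
        = ((m i : ℝ) + ((⌊((N : ℕ) : ℝ) * (y i - a N i)⌋ : ℝ)
          - ((N : ℕ) : ℝ) * (y i - a N i))) / ((N : ℕ) : ℝ) := by
      simp [gridPoint, latticePoint]
      field_simp
      ring
    rw [e, abs_div, abs_of_pos hN0]
    gcongr
    refine (abs_add_le _ _).trans (add_le_add h2 ?_)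
    rw [abs_le]
    constructor <;> linarith
  have hq : (0 : ℝ) ≤ ((n : ℝ) + 1) / ((N : ℕ) : ℝ) := by positivity
  calc _ ≤ 2 * (((n : ℝ) + 1) / ((N : ℕ) : ℝ)) := by
        refine le_of_sq_le_sq ?_ (by positivity)
        rw [EuclideanSpace.norm_sq_eq, Fin.sum_univ_two]
        have h0 := hcoord 0
        have h1 := hcoord 1
        rw [← Real.norm_eq_abs] at h0 h1
        have h0' := pow_le_pow_left₀ (norm_nonneg _) h0 2
        have h1' := pow_le_pow_left₀ (norm_nonneg _) h1 2
        nlinarith [sq_nonneg (((n : ℝ) + 1) / ((N : ℕ) : ℝ))]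
    _ < r := by
        rw [← mul_div_assoc, div_lt_iff₀ hN0]
        linarith

theorem not_stable {Ω : Set Plane} (hΩo : IsOpen Ω) (hΩn : Ω.Nonempty)
    (hΩ : Bornology.IsBounded Ω) (a : ℕ+ → Plane) {lam : ℝ}
    (hlam : lam ∈ Set.Icc (-lambdaPlus) lambdaPlus) : ¬ Stable hΩ a (lam : ℂ) := by
  rintro ⟨C, N₀, hC⟩
  obtain ⟨τ, hτ, hsym⟩ := exists_symbol_eq hlam
  set x₀ : UnitAddTorus (Fin 2) := fun i => ((τ i / (2 * Real.pi) : ℝ) : UnitAddCircle)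
  have hx₀ : torusSymbol x₀ = lam := (torusSymbol_coe τ).trans hsym
  set g : UnitAddTorus (Fin 2) → ℝ := fun x => ‖(lam : ℂ) - torusSymbol x‖ ^ 2 with hg
  have hgx₀ : g x₀ = 0 := by simp [hg, hx₀]
  have hgcont : ContinuousAt g x₀ :=
    ((continuousAt_const.sub (continuousAt_torusSymbol hτ)).norm).pow 2
  have hbd : ∀ x, ‖g x‖ ≤ (‖(lam : ℂ)‖ + lambdaPlus) ^ 2 := fun x => by
    simp only [hg]
    rw [norm_pow, norm_norm]
    gcongr
    exact (norm_sub_le _ _).trans (by gcongr; exact norm_torusSymbol_le x)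
  have hmeas : AEStronglyMeasurable g (volume : Measure (UnitAddTorus (Fin 2))) :=
    ((aestronglyMeasurable_const.sub aestronglyMeasurable_torusSymbol).norm).pow 2
  have hint : Integrable g := Integrable.of_bound hmeas _ (ae_of_all _ hbd)
  set c : UnitAddTorus (Fin 2) → ℝ := fun x => ‖peak x₀ x‖ ^ 2 with hc
  have hccont : Continuous c := by fun_prop
  have hlt : ∀ y ∈ (Set.univ : Set (UnitAddTorus (Fin 2))), y ≠ x₀ → c y < c x₀ := by
    intro y _ hy
    simp only [hc, norm_peak_self]
    have := norm_peak_lt hy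
    gcongr
  -- The normalised powers of `c` form an approximate identity at `x₀`, so the weighted means of `g`
  -- tend to `g x₀ = 0`.
  have hpeak := tendsto_setIntegral_pow_smul_of_unique_maximum_of_isCompact_of_integrableOn
    (μ := (volume : Measure (UnitAddTorus (Fin 2)))) isCompact_univ hccont.continuousOn hlt
    (fun x _ => by positivity) (by simp [hc, norm_peak_self]) (by simp)
    hint.integrableOn hgcont.continuousWithinAt
  simp only [Measure.restrict_univ, smul_eq_mul, hgx₀] at hpeak
  -- Stability would bound these means below: for each `n` a suitable grid with `N ≥ N₀` carries the
  -- `n`-th peak, and `C` does not depend on that grid.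
  have hlow : ∀ n : ℕ, 1 ≤ C ^ 2 * ((∫ x, c x ^ n)⁻¹ * ∫ x, c x ^ n * g x) := by
    intro n
    obtain ⟨N, hN, k, hk⟩ := exists_shifted_box_subset hΩo hΩn hΩ a n N₀
    obtain ⟨hU, hnorm⟩ := hC N hN
    obtain ⟨u, hu⟩ := exists_trigPoly_peak x₀ n k hk
    have hcn : ∀ x, ‖trigPoly u x‖ ^ 2 = c x ^ n := fun x => by
      rw [hu, hc, ← pow_mul, ← pow_mul, mul_comm]
    have h1 := norm_sq_toeplitz_le (gridIndex hΩ (a N) N) lam (WithLp.toLp 2 u)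
    have h2 : ‖WithLp.toLp 2 u‖ ≤ C * ‖Matrix.toEuclideanCLM (n := gridIndex hΩ (a N) N) (𝕜 := ℂ)
        ((lam : ℂ) • 1 - toeplitz (gridIndex hΩ (a N) N)) (WithLp.toLp 2 u)‖ := by
      rw [resolventNorm, systemMatrix_eq] at hnorm
      rw [systemMatrix_eq] at hU
      refine le_trans ?_ (ContinuousLinearMap.le_of_opNorm_le _ hnorm _)
      rw [← mul_apply_eq_comp, ← map_mul, Matrix.nonsing_inv_mul _
        ((Matrix.isUnit_iff_isUnit_det _).1 hU), map_one, one_apply_eq_self]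
    have h3 : ‖WithLp.toLp 2 u‖ ^ 2 = ∫ x, c x ^ n := by
      rw [EuclideanSpace.norm_sq_eq, ← integral_norm_trigPoly_sq]
      simp only [hcn]
    have h4 : ∫ x, ‖(lam : ℂ) - torusSymbol x‖ ^ 2 * ‖trigPoly u x‖ ^ 2
        = ∫ x, c x ^ n * g x :=
      integral_congr_ae (ae_of_all _ fun x => by simp only [hcn, hg, mul_comm])
    have h5 := pow_le_pow_left₀ (norm_nonneg _) h2 2
    rw [mul_pow, h3] at h5
    have h6 : ∫ x, c x ^ n ≤ C ^ 2 * ∫ x, c x ^ n * g x :=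
      h5.trans (by rw [← h4]; gcongr)
    have hpos : 0 < ∫ x, c x ^ n := by
      refine (hccont.pow n).integral_pos_of_hasCompactSupport_nonneg_nonzero
        (HasCompactSupport.of_compactSpace _) (fun x => by positivity) (x := x₀) ?_
      simp [hc, norm_peak_self]
    rw [mul_left_comm, ← div_eq_inv_mul, le_div_iff₀ hpos, one_mul]
    exact h6
  have hlim := hpeak.const_mul (C ^ 2)
  rw [mul_zero] at hlim
  exact absurd (ge_of_tendsto' hlim hlow) (by norm_num)

end Torus

/-! ### Convolution of test functions with smooth decaying kernels. -/

section SingularIntegral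

open MeasureTheory
open scoped ComplexConjugate

/-- Smooth functions with compact support. -/
structure IsTest (φ : Plane → ℂ) : Prop where
  contDiff : ContDiff ℝ ∞ φ
  hasCompactSupport : HasCompactSupport φ

theorem IsTest.continuous {φ : Plane → ℂ} (h : IsTest φ) : Continuous φ := h.contDiff.continuous

theorem IsTest.integrable {φ : Plane → ℂ} (h : IsTest φ) : Integrable φ :=
  h.continuous.integrable_of_hasCompactSupport h.hasCompactSupport

/-- The derivative of `φ` in the direction of the `i`-th coordinate. -/
noncomputable def partialDeriv (i : Fin 2) (φ : Plane → ℂ) (x : Plane) : ℂ :=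
  fderiv ℝ φ x (EuclideanSpace.single i 1)

theorem IsTest.partialDeriv {φ : Plane → ℂ} (h : IsTest φ) (i : Fin 2) :
    IsTest (partialDeriv i φ) :=
  ⟨(h.contDiff.fderiv_right (m := ∞) le_rfl).clm_apply contDiff_const,
    h.hasCompactSupport.fderiv_apply (𝕜 := ℝ) _⟩

theorem IsTest.conj {φ : Plane → ℂ} (h : IsTest φ) : IsTest fun x => conj (φ x) :=
  ⟨Complex.conjCLE.contDiff.comp h.contDiff,
    h.hasCompactSupport.comp_left (g := conj) (map_zero _)⟩

theorem partialDeriv_comm {φ : Plane → ℂ} (h : IsTest φ) (i j : Fin 2) :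
    partialDeriv i (partialDeriv j φ) = partialDeriv j (partialDeriv i φ) := by
  have hd : ∀ x, DifferentiableAt ℝ (fderiv ℝ φ) x := fun x =>
    ((h.contDiff.fderiv_right (m := ∞) le_rfl).differentiable (by simp)) x
  have e : ∀ k l x, partialDeriv k (partialDeriv l φ) x
      = fderiv ℝ (fderiv ℝ φ) x (EuclideanSpace.single k 1) (EuclideanSpace.single l 1) := by
    intro k l x
    change fderiv ℝ (fun y => fderiv ℝ φ y (EuclideanSpace.single l 1)) x _ = _
    rw [fderiv_clm_apply (hd x) (differentiableAt_const _)]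
    simp
  ext x
  rw [e, e]
  have hs : IsSymmSndFDerivAt ℝ φ x :=
    h.contDiff.contDiffAt.isSymmSndFDerivAt (by
      rw [minSmoothness_of_isRCLikeNormedField]
      exact WithTop.coe_le_coe.2 (le_top : (2 : ℕ∞) ≤ ⊤))
  exact hs.eq _ _

/-- Convolution with a real kernel. -/
noncomputable def conv (W : Plane → ℝ) (φ : Plane → ℂ) (x : Plane) : ℂ :=
  ∫ t, (W t : ℂ) * φ (x - t)

theorem IsTest.hasCompactSupport_sub {φ : Plane → ℂ} (h : IsTest φ) (x : Plane) :
    HasCompactSupport fun t => φ (x - t) :=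
  h.hasCompactSupport.comp_homeomorph (Homeomorph.subLeft x)

theorem integrable_conv {W : Plane → ℝ} (hW : Continuous W) {φ : Plane → ℂ} (h : IsTest φ)
    (x : Plane) : Integrable fun t => (W t : ℂ) * φ (x - t) := by
  have := h.continuous
  refine Continuous.integrable_of_hasCompactSupport (by fun_prop) ?_
  exact (h.hasCompactSupport_sub x).mul_left

theorem hasFDerivAt_conv {W : Plane → ℝ} (hW : Continuous W) {φ : Plane → ℂ} (h : IsTest φ)
    (x : Plane) : ∃ L : Plane →L[ℝ] ℂ, HasFDerivAt (conv W φ) L x ∧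
      ∀ i, L (EuclideanSpace.single i 1) = conv W (partialDeriv i φ) x := by
  have hloc : LocallyIntegrable (fun t => (W t : ℂ)) (volume : Measure Plane) :=
    (by fun_prop : Continuous fun t => (W t : ℂ)).locallyIntegrable
  refine ⟨_, h.hasCompactSupport.hasFDerivAt_convolution_right (ContinuousLinearMap.mul ℝ ℂ) hloc
    (h.contDiff.of_le (by exact_mod_cast le_top)) x, fun i => ?_⟩
  rw [convolution_precompR_apply]
  · rfl
  · exact hloc
  · exact h.hasCompactSupport.fderiv (𝕜 := ℝ)
  · exact h.contDiff.continuous_fderiv (by simp)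

theorem continuous_conv {W : Plane → ℝ} (hW : Continuous W) {φ : Plane → ℂ} (h : IsTest φ) :
    Continuous (conv W φ) :=
  continuous_iff_continuousAt.2 fun x =>
    let ⟨_, hL, _⟩ := hasFDerivAt_conv hW h x
    hL.continuousAt

theorem hasLineDerivAt_conv {W : Plane → ℝ} (hW : Continuous W) {φ : Plane → ℂ} (h : IsTest φ)
    (i : Fin 2) (x : Plane) :
    HasLineDerivAt ℝ (conv W φ) (conv W (partialDeriv i φ) x) x (EuclideanSpace.single i 1) := by
  obtain ⟨L, hL, hLi⟩ := hasFDerivAt_conv hW h x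
  rw [← hLi]
  exact hL.hasLineDerivAt _

theorem conv_partialDeriv {W W' : Plane → ℝ} (hW : Continuous W) (hW' : Continuous W')
    {i : Fin 2} (hd : ∀ t, HasLineDerivAt ℝ W (W' t) t (EuclideanSpace.single i 1))
    {φ : Plane → ℂ} (h : IsTest φ) (x : Plane) :
    conv W (partialDeriv i φ) x = conv W' φ x := by
  have hparts := integral_bilinear_hasLineDerivAt_right_eq_neg_left_of_integrable
    (μ := (volume : Measure Plane)) (B := ContinuousLinearMap.mul ℝ ℂ)
    (f := fun t => (W t : ℂ)) (f' := fun t => (W' t : ℂ)) (g := fun t => φ (x - t))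
    (g' := fun t => -partialDeriv i φ (x - t)) (v := EuclideanSpace.single i 1)
    (integrable_conv hW' h x)
    (by simpa using (integrable_conv hW (h.partialDeriv i) x).neg)
    (integrable_conv hW h x)
    (fun t _ => by
      have := hd t
      rw [HasLineDerivAt] at this ⊢
      exact this.ofReal_comp)
    (fun t _ => by
      have h1 : HasFDerivAt φ (fderiv ℝ φ (x - t)) (x - t) :=
        (h.contDiff.differentiable (by simp) _).hasFDerivAt
      have h2 : HasFDerivAt (fun t : Plane => x - t) (-ContinuousLinearMap.id ℝ Plane) t :=
        (hasFDerivAt_id t).const_sub x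
      have := (h1.comp t h2).hasLineDerivAt (EuclideanSpace.single i 1)
      convert! this using 1
      simp [partialDeriv])
  simp only [ContinuousLinearMap.mul_apply', mul_neg, integral_neg, neg_inj] at hparts
  exact hparts

/-- Where `φ (x - t)` is nonzero, `1 + ‖x‖ ≤ (1 + R) * (1 + ‖t‖)`, so the convolution inherits the
decay of the kernel. -/
theorem conv_decay {W : Plane → ℝ} {k : ℕ} {C : ℝ} (hC : ∀ t, |W t| * (1 + ‖t‖) ^ k ≤ C)
    {φ : Plane → ℂ} (h : IsTest φ) :
    ∃ C', ∀ x, ‖conv W φ x‖ * (1 + ‖x‖) ^ k ≤ C' := by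
  obtain ⟨R, hR0, hR⟩ := h.hasCompactSupport.isCompact.isBounded.exists_pos_norm_le
  refine ⟨C * (1 + R) ^ k * ∫ t, ‖φ t‖, fun x => ?_⟩
  have hC0 : 0 ≤ C := le_trans (by positivity) (hC 0)
  have hint : Integrable fun t => C * (1 + R) ^ k * ‖φ (x - t)‖ :=
    (h.integrable.comp_sub_left x).norm.const_mul _
  have h1 : (1 + ‖x‖) ^ k * conv W φ x = ∫ t, (1 + ‖x‖ : ℂ) ^ k * ((W t : ℂ) * φ (x - t)) := by
    rw [integral_const_mul, conv]
  have h2 : ‖(1 + ‖x‖) ^ k * conv W φ x‖ ≤ ∫ t, C * (1 + R) ^ k * ‖φ (x - t)‖ := by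
    rw [h1]
    refine norm_integral_le_of_norm_le hint (ae_of_all _ fun t => ?_)
    by_cases ht : φ (x - t) = 0
    · simp [ht]
    have hxt : ‖x - t‖ ≤ R := hR _ (subset_tsupport _ ht)
    have hx : 1 + ‖x‖ ≤ (1 + R) * (1 + ‖t‖) := by
      have : ‖x‖ ≤ ‖x - t‖ + ‖t‖ := by simpa using norm_add_le (x - t) t
      nlinarith [norm_nonneg t]
    have e : ‖(1 + ‖x‖ : ℂ)‖ = 1 + ‖x‖ := by
      rw [show (1 + ‖x‖ : ℂ) = ((1 + ‖x‖ : ℝ) : ℂ) by push_cast; rfl, Complex.norm_real,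
        Real.norm_of_nonneg (by positivity)]
    rw [norm_mul, norm_mul, norm_pow, e, Complex.norm_real, Real.norm_eq_abs, ← mul_assoc]
    refine mul_le_mul_of_nonneg_right ?_ (norm_nonneg _)
    calc (1 + ‖x‖) ^ k * |W t| ≤ ((1 + R) * (1 + ‖t‖)) ^ k * |W t| := by gcongr
      _ = (|W t| * (1 + ‖t‖) ^ k) * (1 + R) ^ k := by rw [mul_pow]; ring
      _ ≤ C * (1 + R) ^ k := by gcongr; exact hC t
  have e : ‖(1 + ‖x‖ : ℂ)‖ = 1 + ‖x‖ := by
    rw [show (1 + ‖x‖ : ℂ) = ((1 + ‖x‖ : ℝ) : ℂ) by push_cast; rfl, Complex.norm_real,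
      Real.norm_of_nonneg (by positivity)]
  rw [integral_const_mul, integral_sub_left_eq_self (fun t => ‖φ t‖), norm_mul, norm_pow, e,
    mul_comm] at h2
  exact h2

/-- Total decay of order 3 suffices since the plane has dimension 2; this is exactly what a gradient
kernel and a Hessian kernel provide together. -/
theorem integrable_mul_of_decay {F G : Plane → ℂ} (hF : Continuous F) (hG : Continuous G)
    {k l : ℕ} (hkl : 3 ≤ k + l) (hFd : ∃ C, ∀ x, ‖F x‖ * (1 + ‖x‖) ^ k ≤ C)
    (hGd : ∃ C, ∀ x, ‖G x‖ * (1 + ‖x‖) ^ l ≤ C) : Integrable fun x => F x * G x := by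
  obtain ⟨C, hC⟩ := hFd
  obtain ⟨D, hD⟩ := hGd
  have hdim : (Module.finrank ℝ Plane : ℝ) < 3 := by
    rw [finrank_euclideanSpace_fin]
    norm_num
  refine ((integrable_one_add_norm (μ := (volume : Measure Plane)) hdim).const_mul (C * D)).mono'
    (by fun_prop) (ae_of_all _ fun x => ?_)
  have hx : (0 : ℝ) < 1 + ‖x‖ := by positivity
  have hC0 : 0 ≤ C := le_trans (by positivity) (hC 0)
  rw [Real.rpow_neg hx.le, Real.rpow_ofNat, ← div_eq_mul_inv, le_div_iff₀ (by positivity), norm_mul]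
  calc ‖F x‖ * ‖G x‖ * (1 + ‖x‖) ^ 3 ≤ ‖F x‖ * ‖G x‖ * (1 + ‖x‖) ^ (k + l) := by
        gcongr
        linarith [norm_nonneg x]
    _ = (‖F x‖ * (1 + ‖x‖) ^ k) * (‖G x‖ * (1 + ‖x‖) ^ l) := by ring
    _ ≤ C * D := mul_le_mul (hC x) (hD x) (by positivity) hC0

/-! ### Regularised kernels and the `L²` bound with constant `1 / 2`. -/

/-- The regularised square of the norm. -/
noncomputable def regSq (ε : ℝ) (t : Plane) : ℝ := t 0 ^ 2 + t 1 ^ 2 + ε ^ 2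

theorem regSq_eq (ε : ℝ) (t : Plane) : regSq ε t = ‖t‖ ^ 2 + ε ^ 2 := by
  simp [regSq, EuclideanSpace.norm_sq_eq, Fin.sum_univ_two]

theorem regSq_pos {ε : ℝ} (hε : ε ≠ 0) (t : Plane) : 0 < regSq ε t := by
  rw [regSq]
  positivity

/-- The regularised gradient `t_i / (2π (|t|² + ε²))` of the fundamental solution. -/
noncomputable def gradKernel (ε : ℝ) (i : Fin 2) (t : Plane) : ℝ :=
  t i / (2 * Real.pi * regSq ε t)

/-- The derivatives of `gradKernel`. -/
noncomputable def hessKernel (ε : ℝ) (i j : Fin 2) (t : Plane) : ℝ :=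
  ((if i = j then 1 else 0) * regSq ε t - 2 * t i * t j) / (2 * Real.pi * regSq ε t ^ 2)

theorem hessKernel_comm (ε : ℝ) (i j : Fin 2) : hessKernel ε i j = hessKernel ε j i := by
  ext t
  simp only [hessKernel, eq_comm]
  ring

theorem continuous_regSq (ε : ℝ) : Continuous (regSq ε) := by
  unfold regSq
  fun_prop

theorem continuous_gradKernel {ε : ℝ} (hε : ε ≠ 0) (i : Fin 2) : Continuous (gradKernel ε i) := by
  have h := fun t => (regSq_pos hε t).ne'
  have := continuous_regSq ε
  have := Real.pi_ne_zero
  unfold gradKernel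
  refine Continuous.div (by fun_prop) (by fun_prop) fun t => ?_
  have := h t
  positivity

theorem continuous_hessKernel {ε : ℝ} (hε : ε ≠ 0) (i j : Fin 2) :
    Continuous (hessKernel ε i j) := by
  have h := fun t => (regSq_pos hε t).ne'
  have := continuous_regSq ε
  have := Real.pi_ne_zero
  unfold hessKernel
  refine Continuous.div (by fun_prop) (by fun_prop) fun t => ?_
  have := h t
  positivity

theorem hasLineDerivAt_gradKernel {ε : ℝ} (hε : ε ≠ 0) (i j : Fin 2) (t : Plane) :
    HasLineDerivAt ℝ (gradKernel ε i) (hessKernel ε i j t) t (EuclideanSpace.single j 1) := by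
  have hq := regSq_pos hε t
  have key : ∀ a α b β c γ : ℝ, b ^ 2 + c ^ 2 + ε ^ 2 ≠ 0 →
      HasDerivAt (fun s : ℝ => (a + s * α) /
        (2 * Real.pi * ((b + s * β) ^ 2 + (c + s * γ) ^ 2 + ε ^ 2)))
      ((α * (b ^ 2 + c ^ 2 + ε ^ 2) - 2 * a * (b * β + c * γ)) /
        (2 * Real.pi * (b ^ 2 + c ^ 2 + ε ^ 2) ^ 2)) 0 := by
    intro a α b β c γ h0
    have h1 : ∀ u v : ℝ, HasDerivAt (fun s : ℝ => u + s * v) v 0 := fun u v => by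
      simpa using ((hasDerivAt_id (0 : ℝ)).mul_const v).const_add u
    have h2 := ((((h1 b β).pow 2).add ((h1 c γ).pow 2)).add_const (ε ^ 2)).const_mul (2 * Real.pi)
    have hpi := Real.pi_ne_zero
    have h3 := (h1 a α).div h2 (by
      simp only [zero_mul, add_zero, Pi.add_apply, Pi.pow_apply]
      positivity)
    refine h3.congr_deriv ?_
    simp only [zero_mul, add_zero, Pi.add_apply, Pi.pow_apply]
    field_simp
    ring
  have h := key (t i) (if i = j then 1 else 0) (t 0) (if 0 = j then 1 else 0) (t 1)
    (if 1 = j then 1 else 0) hq.ne'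
  rw [HasLineDerivAt]
  convert! h using 1
  · ext s
    simp only [gradKernel, regSq, PiLp.add_apply, PiLp.smul_apply, PiLp.single_apply,
      smul_eq_mul]
  · rw [hessKernel, regSq]
    fin_cases j <;> simp

theorem one_add_norm_sq_le {ε : ℝ} (hε : ε ≠ 0) (t : Plane) :
    (1 + ‖t‖) ^ 2 ≤ 2 * (1 + (ε ^ 2)⁻¹) * regSq ε t := by
  have h0 : 0 < ε ^ 2 := by positivity
  have h1 : (ε ^ 2)⁻¹ * ε ^ 2 = 1 := inv_mul_cancel₀ h0.ne'
  rw [regSq_eq]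
  nlinarith [sq_nonneg (‖t‖ - 1), mul_nonneg (inv_nonneg.2 h0.le) (sq_nonneg ‖t‖)]

theorem abs_apply_le_norm (t : Plane) (i : Fin 2) : |t i| ≤ ‖t‖ := by
  simpa using PiLp.norm_apply_le t i

theorem gradKernel_decay {ε : ℝ} (hε : ε ≠ 0) (i : Fin 2) (t : Plane) :
    |gradKernel ε i t| * (1 + ‖t‖) ^ 1 ≤ 2 * (1 + (ε ^ 2)⁻¹) := by
  have hq := regSq_pos hε t
  have h1 := one_add_norm_sq_le hε t
  have hpi := Real.pi_gt_three
  rw [gradKernel, abs_div, abs_of_pos (by positivity : 0 < 2 * Real.pi * regSq ε t),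
    div_mul_eq_mul_div,
    div_le_iff₀ (by positivity)]
  calc |t i| * (1 + ‖t‖) ^ 1 ≤ (1 + ‖t‖) * (1 + ‖t‖) ^ 1 := by
        gcongr
        linarith [abs_apply_le_norm t i]
    _ = (1 + ‖t‖) ^ 2 := by ring
    _ ≤ 2 * (1 + (ε ^ 2)⁻¹) * regSq ε t := h1
    _ ≤ 2 * (1 + (ε ^ 2)⁻¹) * (2 * Real.pi * regSq ε t) := by
        gcongr
        nlinarith

theorem hessKernel_decay {ε : ℝ} (hε : ε ≠ 0) (i j : Fin 2) (t : Plane) :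
    |hessKernel ε i j t| * (1 + ‖t‖) ^ 2 ≤ 2 * (1 + (ε ^ 2)⁻¹) := by
  have hq := regSq_pos hε t
  have h1 := one_add_norm_sq_le hε t
  have hpi := Real.pi_gt_three
  have hnum : |(if i = j then 1 else 0) * regSq ε t - 2 * t i * t j| ≤ 3 * regSq ε t := by
    have h2 : |t i * t j| ≤ regSq ε t := by
      rw [abs_mul]
      calc |t i| * |t j| ≤ ‖t‖ * ‖t‖ := by gcongr <;> exact abs_apply_le_norm t _
        _ ≤ regSq ε t := by rw [regSq_eq]; nlinarith [sq_nonneg ε]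
    rw [abs_le] at h2 ⊢
    split_ifs <;> constructor <;> linarith
  rw [hessKernel, abs_div, abs_of_pos (by positivity : 0 < 2 * Real.pi * regSq ε t ^ 2),
    div_mul_eq_mul_div, div_le_iff₀ (by positivity)]
  calc _ ≤ (3 * regSq ε t) * (2 * (1 + (ε ^ 2)⁻¹) * regSq ε t) := by gcongr
    _ = 2 * (1 + (ε ^ 2)⁻¹) * (3 * regSq ε t ^ 2) := by ring
    _ ≤ _ := by
        gcongr
        linarith

/-- Integrating one derivative off `φ` turns both sides into the same integral, since `∂₀` of the
`11` derivative of the potential of `ψ` equals `∂₁` of its `01` derivative. -/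
theorem integral_hess_mul_hess {ε : ℝ} (hε : ε ≠ 0) {φ ψ : Plane → ℂ} (hφ : IsTest φ)
    (hψ : IsTest ψ) :
    ∫ x, conv (hessKernel ε 0 0) φ x * conv (hessKernel ε 1 1) ψ x
      = ∫ x, conv (hessKernel ε 0 1) φ x * conv (hessKernel ε 0 1) ψ x := by
  have cg := continuous_gradKernel hε
  have ch := continuous_hessKernel hε
  have dg : ∀ i {χ : Plane → ℂ}, IsTest χ →
      ∃ C', ∀ x, ‖conv (gradKernel ε i) χ x‖ * (1 + ‖x‖) ^ 1 ≤ C' :=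
    fun i _ hχ => conv_decay (gradKernel_decay hε i) hχ
  have dh : ∀ i j {χ : Plane → ℂ}, IsTest χ →
      ∃ C', ∀ x, ‖conv (hessKernel ε i j) χ x‖ * (1 + ‖x‖) ^ 2 ≤ C' :=
    fun i j _ hχ => conv_decay (hessKernel_decay hε i j) hχ
  have parts : ∀ j k l : Fin 2, ∫ x, conv (gradKernel ε 0) φ x
      * conv (hessKernel ε k l) (partialDeriv j ψ) x
      = -∫ x, conv (hessKernel ε 0 j) φ x * conv (hessKernel ε k l) ψ x := by
    intro j k l
    refine integral_bilinear_hasLineDerivAt_right_eq_neg_left_of_integrable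
      (B := ContinuousLinearMap.mul ℝ ℂ) (v := EuclideanSpace.single j 1)
      (f := conv (gradKernel ε 0) φ) (f' := conv (hessKernel ε 0 j) φ)
      (g := conv (hessKernel ε k l) ψ) (g' := conv (hessKernel ε k l) (partialDeriv j ψ))
      ?_ ?_ ?_ (fun x _ => ?_) fun x _ => hasLineDerivAt_conv (ch k l) hψ j x
    · exact integrable_mul_of_decay (continuous_conv (ch 0 j) hφ) (continuous_conv (ch k l) hψ)
        (by norm_num) (dh 0 j hφ) (dh k l hψ)
    · exact integrable_mul_of_decay (continuous_conv (cg 0) hφ)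
        (continuous_conv (ch k l) (hψ.partialDeriv j)) (by norm_num) (dg 0 hφ)
        (dh k l (hψ.partialDeriv j))
    · exact integrable_mul_of_decay (continuous_conv (cg 0) hφ) (continuous_conv (ch k l) hψ)
        (by norm_num) (dg 0 hφ) (dh k l hψ)
    · rw [← conv_partialDeriv (cg 0) (ch 0 j) (hasLineDerivAt_gradKernel hε 0 j) hφ]
      exact hasLineDerivAt_conv (cg 0) hφ j x
  have p1 := parts 0 1 1
  have p2 := parts 1 0 1
  have e : ∀ x, conv (hessKernel ε 1 1) (partialDeriv 0 ψ) x
      = conv (hessKernel ε 0 1) (partialDeriv 1 ψ) x := fun x => by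
    rw [hessKernel_comm ε 0 1,
      ← conv_partialDeriv (cg 1) (ch 1 1) (hasLineDerivAt_gradKernel hε 1 1) (hψ.partialDeriv 0),
      ← conv_partialDeriv (cg 1) (ch 1 0) (hasLineDerivAt_gradKernel hε 1 0) (hψ.partialDeriv 1),
      partialDeriv_comm hψ]
  simp only [e] at p1
  rw [p1] at p2
  exact neg_injective p2

/-- The regularised kernel. -/
noncomputable def regKernel (ε : ℝ) (t : Plane) : ℝ :=
  (t 1 ^ 2 - t 0 ^ 2) / (2 * Real.pi * regSq ε t ^ 2)

/-- The regularised delta function. -/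
noncomputable def deltaKernel (ε : ℝ) (t : Plane) : ℝ :=
  ε ^ 2 / (Real.pi * regSq ε t ^ 2)

theorem hessKernel_sub (ε : ℝ) (t : Plane) :
    hessKernel ε 0 0 t - hessKernel ε 1 1 t = 2 * regKernel ε t := by
  simp only [hessKernel, regKernel, if_true]
  ring

theorem hessKernel_add {ε : ℝ} (t : Plane) :
    hessKernel ε 0 0 t + hessKernel ε 1 1 t = deltaKernel ε t := by
  simp only [hessKernel, deltaKernel, if_true]
  rw [← add_div, show 1 * regSq ε t - 2 * t 0 * t 0 + (1 * regSq ε t - 2 * t 1 * t 1)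
    = 2 * ε ^ 2 by rw [regSq]; ring, mul_assoc, mul_div_mul_left _ _ two_ne_zero]

theorem conv_conj (W : Plane → ℝ) (φ : Plane → ℂ) (x : Plane) :
    conv W (fun y => conj (φ y)) x = conj (conv W φ x) := by
  rw [conv, conv, ← integral_conj]
  simp

/-- With `a` and `b` the two pure second derivatives, the two sides are the integrals of `|a - b|²`
and `|a + b|²`. They differ by four times the cross term, which `hcross` identifies with an integral
of a square. -/
theorem integral_regKernel_le_deltaKernel {ε : ℝ} (hε : ε ≠ 0) {φ : Plane → ℂ} (hφ : IsTest φ) :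
    Integrable (fun x => ‖conv (regKernel ε) φ x‖ ^ 2) ∧
    4 * ∫ x, ‖conv (regKernel ε) φ x‖ ^ 2 ≤ ∫ x, ‖conv (deltaKernel ε) φ x‖ ^ 2 := by
  have ch := continuous_hessKernel hε
  have dh : ∀ i j {χ : Plane → ℂ}, IsTest χ →
      ∃ C', ∀ x, ‖conv (hessKernel ε i j) χ x‖ * (1 + ‖x‖) ^ 2 ≤ C' :=
    fun i j _ hχ => conv_decay (hessKernel_decay hε i j) hχ
  have hint : ∀ i j k l, Integrable fun x =>
      conv (hessKernel ε i j) φ x * conj (conv (hessKernel ε k l) φ x) := fun i j k l => by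
    simp only [← conv_conj]
    exact integrable_mul_of_decay (continuous_conv (ch i j) hφ) (continuous_conv (ch k l) hφ.conj)
      (by norm_num) (dh i j hφ) (dh k l hφ.conj)
  have hsq : ∀ i j, Integrable fun x => ‖conv (hessKernel ε i j) φ x‖ ^ 2 := fun i j => by
    refine (hint i j i j).re.congr (ae_of_all _ fun x => ?_)
    simp only [Complex.mul_conj, Complex.normSq_eq_norm_sq]
    exact Complex.ofReal_re _
  set a := conv (hessKernel ε 0 0) φ with ha
  set b := conv (hessKernel ε 1 1) φ with hb
  have hS : ∀ x, 2 * conv (regKernel ε) φ x = a x - b x := fun x => by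
    rw [ha, hb, conv, conv, conv, ← integral_sub (integrable_conv (ch 0 0) hφ x)
      (integrable_conv (ch 1 1) hφ x), ← integral_const_mul]
    congr 1
    ext t
    rw [← sub_mul, ← Complex.ofReal_sub, hessKernel_sub]
    push_cast
    ring
  have hP : ∀ x, conv (deltaKernel ε) φ x = a x + b x := fun x => by
    rw [ha, hb, conv, conv, conv, ← integral_add (integrable_conv (ch 0 0) hφ x)
      (integrable_conv (ch 1 1) hφ x)]
    congr 1
    ext t
    rw [← add_mul, ← Complex.ofReal_add, hessKernel_add]
  have hcross : ∫ x, (a x * conj (b x)).re = ∫ x, ‖conv (hessKernel ε 0 1) φ x‖ ^ 2 := by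
    have h := integral_hess_mul_hess hε hφ hφ.conj
    simp only [conv_conj] at h
    have h1 := integral_re (hint 0 0 1 1)
    simp only [← ha, ← hb] at h1
    rw [← ha, ← hb] at h
    rw [show ∫ x, (a x * conj (b x)).re = ∫ x, RCLike.re (a x * conj (b x)) from rfl, h1, h,
      ← integral_re (hint 0 1 0 1)]
    congr 1
    ext x
    simp only [Complex.mul_conj, Complex.normSq_eq_norm_sq]
    exact Complex.ofReal_re _
  have hcr : Integrable fun x => (a x * conj (b x)).re := (hint 0 0 1 1).re
  have e1 : ∀ x, ‖conv (regKernel ε) φ x‖ ^ 2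
      = (‖a x‖ ^ 2 + ‖b x‖ ^ 2 - 2 * (a x * conj (b x)).re) / 4 := fun x => by
    have := congrArg (fun z => ‖z‖ ^ 2) (hS x)
    simp only [norm_mul, mul_pow, ← Complex.normSq_eq_norm_sq, Complex.normSq_sub] at this
    norm_num at this
    simp only [← Complex.normSq_eq_norm_sq, Complex.mul_re, Complex.conj_re, Complex.conj_im]
    linarith
  have e2 : ∀ x, ‖conv (deltaKernel ε) φ x‖ ^ 2
      = ‖a x‖ ^ 2 + ‖b x‖ ^ 2 + 2 * (a x * conj (b x)).re := fun x => by
    rw [hP]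
    simp only [← Complex.normSq_eq_norm_sq, Complex.normSq_add]
  have iab := (hsq 0 0).add (hsq 1 1)
  constructor
  · simp only [e1]
    exact (iab.sub (hcr.const_mul 2)).div_const 4
  · simp only [e1, e2]
    have hab : ∫ x, (‖a x‖ ^ 2 + ‖b x‖ ^ 2 - 2 * (a x * conj (b x)).re) / 4
        = ((∫ x, (‖a x‖ ^ 2 + ‖b x‖ ^ 2)) - 2 * ∫ x, (a x * conj (b x)).re) / 4 := by
      rw [integral_div, ← integral_const_mul]
      congr 1
      exact integral_sub iab (hcr.const_mul 2)
    have hab2 : ∫ x, (‖a x‖ ^ 2 + ‖b x‖ ^ 2 + 2 * (a x * conj (b x)).re)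
        = (∫ x, (‖a x‖ ^ 2 + ‖b x‖ ^ 2)) + 2 * ∫ x, (a x * conj (b x)).re := by
      rw [← integral_const_mul]
      exact integral_add iab (hcr.const_mul 2)
    have hnn : 0 ≤ ∫ x, ‖conv (hessKernel ε 0 1) φ x‖ ^ 2 :=
      integral_nonneg fun x => by positivity
    rw [hab, hab2, hcross]
    linarith

theorem volume_real_unit_ball : (volume : Measure Plane).real (Metric.ball 0 1) = Real.pi := by
  rw [Measure.real, EuclideanSpace.volume_ball_fin_two]
  simp [Real.pi_pos.le]

theorem continuous_deltaKernel {ε : ℝ} (hε : ε ≠ 0) : Continuous (deltaKernel ε) := by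
  have h : deltaKernel ε = fun t => hessKernel ε 0 0 t + hessKernel ε 1 1 t :=
    funext fun t => (hessKernel_add t).symm
  rw [h]
  exact (continuous_hessKernel hε 0 0).add (continuous_hessKernel hε 1 1)

theorem continuous_regKernel {ε : ℝ} (hε : ε ≠ 0) : Continuous (regKernel ε) := by
  have h : regKernel ε = fun t => (hessKernel ε 0 0 t - hessKernel ε 1 1 t) / 2 :=
    funext fun t => by rw [hessKernel_sub]; ring
  rw [h]
  exact ((continuous_hessKernel hε 0 0).sub (continuous_hessKernel hε 1 1)).div_const 2

/-- In polar coordinates the radial density `r * f r` has the explicit antiderivative in `hderiv`,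
and the area `π` of the unit disc enters with the factor 2. -/
theorem deltaKernel_mass {ε : ℝ} (hε : ε ≠ 0) :
    Integrable (deltaKernel ε) ∧ ∫ t, deltaKernel ε t = 1 := by
  set f : ℝ → ℝ := fun r => ε ^ 2 / (Real.pi * (r ^ 2 + ε ^ 2) ^ 2) with hf
  have hpi := Real.pi_pos
  have hε2 : 0 < ε ^ 2 := by positivity
  have e : deltaKernel ε = fun t => f ‖t‖ := by
    ext t
    rw [deltaKernel, regSq_eq]
  have hdim : Module.finrank ℝ Plane = 2 := finrank_euclideanSpace_fin
  have hderiv : ∀ r : ℝ, HasDerivAt (fun r : ℝ => -(ε ^ 2 / (2 * Real.pi)) * (r ^ 2 + ε ^ 2)⁻¹)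
      (r ^ (2 - 1) • f r) r := fun r => by
    have hq : r ^ 2 + ε ^ 2 ≠ 0 := by positivity
    have h1 := ((((hasDerivAt_id r).pow 2).add_const (ε ^ 2)).inv (by simpa using hq)).const_mul
      (-(ε ^ 2 / (2 * Real.pi)))
    refine h1.congr_deriv ?_
    simp [hf]
    field_simp
  have hlim : Tendsto (fun r : ℝ => -(ε ^ 2 / (2 * Real.pi)) * (r ^ 2 + ε ^ 2)⁻¹) atTop (𝓝 0) := by
    have h2 : Tendsto (fun r : ℝ => r ^ 2 + ε ^ 2) atTop atTop :=
      tendsto_atTop_add_const_right _ _ (tendsto_pow_atTop two_ne_zero)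
    simpa using (tendsto_inv_atTop_zero.comp h2).const_mul (-(ε ^ 2 / (2 * Real.pi)))
  have hpos : ∀ r ∈ Set.Ioi (0 : ℝ), 0 ≤ r ^ (2 - 1) • f r := fun r hr => by
    have : (0 : ℝ) < r := hr
    simp only [hf, smul_eq_mul]
    positivity
  rw [e]
  constructor
  · rw [integrable_fun_norm_addHaar, hdim]
    exact integrableOn_Ioi_deriv_of_nonneg' (fun r _ => hderiv r) hpos hlim
  · rw [integral_fun_norm_addHaar, hdim, volume_real_unit_ball,
      integral_Ioi_of_hasDerivAt_of_nonneg' (fun r _ => hderiv r) hpos hlim]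
    simp
    field_simp

theorem integrable_norm_sq {φ : Plane → ℂ} (h : IsTest φ) : Integrable fun t => ‖φ t‖ ^ 2 := by
  have := h.continuous
  refine Continuous.integrable_of_hasCompactSupport (by fun_prop) ?_
  exact h.hasCompactSupport.comp_left (g := fun z : ℂ => ‖z‖ ^ 2) (by simp)

/-- Jensen's inequality for the probability density `W`, obtained pointwise from nonnegativity of
the variance, followed by integration of the convolution. -/
theorem integral_conv_sq_le {W : Plane → ℝ} (hW : Continuous W) (h0 : ∀ t, 0 ≤ W t)
    (hi : Integrable W) (h1 : ∫ t, W t = 1) {φ : Plane → ℂ} (h : IsTest φ) :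
    ∫ x, ‖conv W φ x‖ ^ 2 ≤ ∫ x, ‖φ x‖ ^ 2 := by
  have hφ := h.continuous
  have hbound : ∀ x, ‖conv W φ x‖ ^ 2 ≤ convolution W (fun t => ‖φ t‖ ^ 2)
      (ContinuousLinearMap.mul ℝ ℝ) volume x := by
    intro x
    have hcs := h.hasCompactSupport_sub x
    have i1 : Integrable fun t => W t * ‖φ (x - t)‖ :=
      Continuous.integrable_of_hasCompactSupport (by fun_prop)
        ((hcs.comp_left (g := fun z : ℂ => ‖z‖) (by simp)).mul_left)
    have i2 : Integrable fun t => W t * ‖φ (x - t)‖ ^ 2 :=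
      Continuous.integrable_of_hasCompactSupport (by fun_prop)
        ((hcs.comp_left (g := fun z : ℂ => ‖z‖ ^ 2) (by simp)).mul_left)
    set m := ∫ t, W t * ‖φ (x - t)‖ with hm
    have hle : ‖conv W φ x‖ ≤ m := by
      refine norm_integral_le_of_norm_le i1 (ae_of_all _ fun t => ?_)
      rw [norm_mul, Complex.norm_real, Real.norm_of_nonneg (h0 t)]
    have hnn : 0 ≤ ∫ t, W t * (‖φ (x - t)‖ - m) ^ 2 :=
      integral_nonneg fun t => mul_nonneg (h0 t) (sq_nonneg _)
    have hexp : ∫ t, W t * (‖φ (x - t)‖ - m) ^ 2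
        = (∫ t, W t * ‖φ (x - t)‖ ^ 2) - 2 * m * m + m ^ 2 * 1 := by
      have e : ∀ t, W t * (‖φ (x - t)‖ - m) ^ 2
          = (W t * ‖φ (x - t)‖ ^ 2 - 2 * m * (W t * ‖φ (x - t)‖)) + m ^ 2 * W t := fun t => by ring
      have i12 : Integrable fun t => W t * ‖φ (x - t)‖ ^ 2 - 2 * m * (W t * ‖φ (x - t)‖) :=
        i2.sub (i1.const_mul _)
      simp only [e]
      rw [integral_add i12 (hi.const_mul _),
        integral_sub i2 (i1.const_mul _), integral_const_mul, integral_const_mul, h1]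
    have hsq : m ^ 2 ≤ ∫ t, W t * ‖φ (x - t)‖ ^ 2 := by
      rw [hexp] at hnn
      linarith
    exact (pow_le_pow_left₀ (norm_nonneg _) hle 2).trans hsq
  have hint : Integrable (convolution W (fun t => ‖φ t‖ ^ 2) (ContinuousLinearMap.mul ℝ ℝ)
      volume) := hi.integrable_convolution _ (integrable_norm_sq h)
  calc ∫ x, ‖conv W φ x‖ ^ 2
      ≤ ∫ x, convolution W (fun t => ‖φ t‖ ^ 2) (ContinuousLinearMap.mul ℝ ℝ) volume x :=
        integral_mono_of_nonneg (ae_of_all _ fun x => by positivity) hint (ae_of_all _ hbound)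
    _ = ∫ x, ‖φ x‖ ^ 2 := by
        rw [integral_convolution _ hi (integrable_norm_sq h), h1]
        simp

theorem integral_regKernel_sq_le {ε : ℝ} (hε : ε ≠ 0) {φ : Plane → ℂ} (h : IsTest φ) :
    Integrable (fun x => ‖conv (regKernel ε) φ x‖ ^ 2) ∧
      ∫ x, ‖conv (regKernel ε) φ x‖ ^ 2 ≤ (∫ x, ‖φ x‖ ^ 2) / 4 := by
  obtain ⟨hi, hle⟩ := integral_regKernel_le_deltaKernel hε h
  obtain ⟨hm, h1⟩ := deltaKernel_mass hε
  have h2 := integral_conv_sq_le (continuous_deltaKernel hε)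
    (fun t => by rw [deltaKernel]; have := Real.pi_pos; positivity) hm h1 h
  exact ⟨hi, by linarith⟩

theorem eLpNorm_two_eq {F : Plane → ℂ} (hF : Integrable fun x => ‖F x‖ ^ 2) :
    eLpNorm F 2 volume = ENNReal.ofReal (Real.sqrt (∫ x, ‖F x‖ ^ 2)) := by
  rw [eLpNorm_eq_lintegral_rpow_enorm_toReal two_ne_zero ENNReal.ofNat_ne_top,
    Real.sqrt_eq_rpow, ← ENNReal.ofReal_rpow_of_nonneg (integral_nonneg fun x => by positivity)
    (by norm_num), ofReal_integral_eq_lintegral_ofReal hF (ae_of_all _ fun x => by positivity)]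
  simp [ENNReal.ofReal_pow]

theorem eLpNorm_regKernel_le {ε : ℝ} (hε : ε ≠ 0) {φ : Plane → ℂ} (h : IsTest φ) :
    eLpNorm (conv (regKernel ε) φ) 2 volume ≤ ENNReal.ofReal (1 / 2) * eLpNorm φ 2 volume := by
  obtain ⟨hi, hle⟩ := integral_regKernel_sq_le hε h
  rw [eLpNorm_two_eq hi, eLpNorm_two_eq (integrable_norm_sq h), ← ENNReal.ofReal_mul (by norm_num)]
  refine ENNReal.ofReal_le_ofReal ?_
  rw [Real.sqrt_le_left (by positivity), mul_pow,
    Real.sq_sqrt (integral_nonneg fun x => by positivity)]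
  linarith

/-! ### The principal value as a limit of cut-offs. -/

/-- The reflection of the plane that exchanges the coordinates. -/
noncomputable def planeSwap : Plane ≃ₗᵢ[ℝ] Plane :=
  LinearIsometryEquiv.piLpCongrLeft 2 ℝ ℝ (Equiv.swap (0 : Fin 2) 1)

theorem kernel_planeSwap (t : Plane) : kernel (planeSwap t) = -kernel t := by
  rw [kernel, kernel, LinearIsometryEquiv.norm_map, ← neg_div, neg_sub]
  rfl

/-- The swap preserves balls, measure and norm but changes the sign of the kernel. This cancellation
is what makes the principal value exist. -/
theorem setIntegral_ball_kernel_mul (η : ℝ → ℝ) (R : ℝ) :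
    ∫ t in Metric.ball (0 : Plane) R, kernel t * η ‖t‖ = 0 := by
  have h := planeSwap.measurePreserving.setIntegral_preimage_emb
    planeSwap.toHomeomorph.measurableEmbedding (fun t => kernel t * η ‖t‖)
    (Metric.ball (0 : Plane) R)
  rw [LinearIsometryEquiv.preimage_ball, map_zero] at h
  simp only [kernel_planeSwap, LinearIsometryEquiv.norm_map, neg_mul, integral_neg] at h
  linarith

theorem abs_kernel_le (t : Plane) : |kernel t| ≤ (‖t‖ ^ 2)⁻¹ := by
  rcases eq_or_ne t 0 with rfl | ht
  · simp [kernel]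
  have h0 : 0 < ‖t‖ := norm_pos_iff.2 ht
  have hn : ‖t‖ ^ 2 = t 0 ^ 2 + t 1 ^ 2 := by
    simp [EuclideanSpace.norm_sq_eq, Fin.sum_univ_two]
  have hpi := Real.pi_gt_three
  rw [kernel, abs_div, abs_of_pos (by positivity : 0 < 2 * Real.pi * ‖t‖ ^ 4), ← one_div,
    div_le_div_iff₀ (by positivity) (by positivity), one_mul]
  have h1 : |t 1 ^ 2 - t 0 ^ 2| ≤ ‖t‖ ^ 2 := by
    rw [hn, abs_le]
    constructor <;> nlinarith [sq_nonneg (t 0), sq_nonneg (t 1)]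
  calc |t 1 ^ 2 - t 0 ^ 2| * ‖t‖ ^ 2 ≤ ‖t‖ ^ 2 * ‖t‖ ^ 2 := by gcongr
    _ = 1 * ‖t‖ ^ 4 := by ring
    _ ≤ _ := by
        gcongr
        linarith

theorem measurable_kernel : Measurable kernel := by
  unfold kernel
  fun_prop

theorem integrableOn_ball_inv_norm (R : ℝ) :
    IntegrableOn (fun t : Plane => ‖t‖⁻¹) (Metric.ball 0 R) := by
  have hdim : Module.finrank ℝ Plane = 2 := finrank_euclideanSpace_fin
  rw [← integrable_indicator_iff Metric.isOpen_ball.measurableSet]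
  have e : (Metric.ball (0 : Plane) R).indicator (fun t : Plane => ‖t‖⁻¹)
      = fun t => (Set.Iio R).indicator (fun r : ℝ => r⁻¹) ‖t‖ := by
    ext t
    simp [Set.indicator]
  rw [e, integrable_fun_norm_addHaar, hdim]
  have h : IntegrableOn (Set.indicator (Set.Iio R) fun _ : ℝ => (1 : ℝ)) (Set.Ioi 0) := by
    rw [IntegrableOn, integrable_indicator_iff measurableSet_Iio, IntegrableOn,
      Measure.restrict_restrict measurableSet_Iio, Set.inter_comm, Set.Ioi_inter_Iio]
    exact integrable_const _
  refine h.congr_fun (fun r hr => ?_) measurableSet_Ioi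
  have hr0 : r ≠ 0 := (show (0 : ℝ) < r from hr).ne'
  simp only [Set.indicator, smul_eq_mul]
  split_ifs <;> simp [hr0]

/-- Radial cut-offs of the kernel lead to the principal value. -/
theorem tendsto_integral_cutoff {η : ℝ → ℝ → ℝ} (hη : ∀ δ r, |η δ r| ≤ 1)
    (hηm : ∀ δ, Measurable (η δ)) (hlim : ∀ r > 0, Tendsto (fun δ => η δ r) (𝓝[>] 0) (𝓝 1))
    {R : ℝ} (hi : ∀ δ > 0, IntegrableOn (fun t : Plane => kernel t * η δ ‖t‖) (Metric.ball 0 R))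
    {φ : Plane → ℂ} (h : IsTest φ) (x : Plane) (hR : ∀ t, t ∉ Metric.ball 0 R → φ (x - t) = 0) :
    Tendsto (fun δ => ∫ t, ((kernel t * η δ ‖t‖ : ℝ) : ℂ) * φ (x - t)) (𝓝[>] 0)
      (𝓝 (∫ t in Metric.ball 0 R, (kernel t : ℂ) * (φ (x - t) - φ x))) := by
  have hφ := h.continuous
  obtain ⟨L, hL⟩ :=
    (h.contDiff.of_le (m := 1) (by exact_mod_cast le_top)).lipschitzWith_of_hasCompactSupport
    h.hasCompactSupport (by simp)
  have hdiff : ∀ t, ‖φ (x - t) - φ x‖ ≤ L * ‖t‖ := fun t => by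
    have := hL.dist_le_mul (x - t) x
    simpa [dist_eq_norm] using this
  obtain ⟨B, hB⟩ := h.hasCompactSupport.exists_bound_of_continuous hφ
  -- Subtracting `φ x` costs nothing by the cancellation over balls, and the Lipschitz bound reduces
  -- the singularity to the integrable majorant `L * ‖t‖⁻¹`.
  have key : Tendsto (fun δ => ∫ t in Metric.ball 0 R,
      ((kernel t * η δ ‖t‖ : ℝ) : ℂ) * (φ (x - t) - φ x)) (𝓝[>] 0)
      (𝓝 (∫ t in Metric.ball 0 R, (kernel t : ℂ) * (φ (x - t) - φ x))) := by
    refine tendsto_integral_filter_of_dominated_convergence (fun t => L * ‖t‖⁻¹)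
      (Eventually.of_forall fun δ => ?_) (Eventually.of_forall fun δ => ae_of_all _ fun t => ?_)
      ((integrableOn_ball_inv_norm R).const_mul _) (ae_of_all _ fun t => ?_)
    · have := measurable_kernel
      have := hηm δ
      exact (by fun_prop : Measurable fun t : Plane =>
        ((kernel t * η δ ‖t‖ : ℝ) : ℂ) * (φ (x - t) - φ x)).aestronglyMeasurable
    · rw [norm_mul, Complex.norm_real, norm_mul, Real.norm_eq_abs, Real.norm_eq_abs]
      have hk := abs_kernel_le t
      calc |kernel t| * |η δ ‖t‖| * ‖φ (x - t) - φ x‖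
          ≤ (‖t‖ ^ 2)⁻¹ * 1 * (L * ‖t‖) := by
            gcongr
            · exact hη _ _
            · exact hdiff t
        _ = L * ‖t‖⁻¹ := by
            rcases eq_or_ne ‖t‖ 0 with h0 | h0
            · simp [h0]
            · field_simp
    · rcases eq_or_ne t 0 with rfl | ht
      · simp
      have h1 := (hlim ‖t‖ (norm_pos_iff.2 ht)).const_mul (kernel t)
      rw [mul_one] at h1
      exact ((Complex.continuous_ofReal.tendsto _).comp h1).mul_const _
  refine key.congr' ?_
  filter_upwards [self_mem_nhdsWithin] with δ hδ
  have hiC : IntegrableOn (fun t : Plane => ((kernel t * η δ ‖t‖ : ℝ) : ℂ)) (Metric.ball 0 R) :=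
    (hi δ hδ).ofReal
  have h1 : IntegrableOn (fun t : Plane => ((kernel t * η δ ‖t‖ : ℝ) : ℂ) * φ (x - t))
      (Metric.ball 0 R) :=
    hiC.mul_bdd (c := B) (by fun_prop) (ae_of_all _ fun t => hB _)
  simp only [mul_sub]
  rw [integral_sub h1 (hiC.mul_const _), integral_mul_const, integral_complex_ofReal,
    setIntegral_ball_kernel_mul, Complex.ofReal_zero, zero_mul, sub_zero]
  exact setIntegral_eq_integral_of_forall_compl_eq_zero fun t ht => by rw [hR t ht, mul_zero]

theorem exists_ball_support {φ : Plane → ℂ} (h : IsTest φ) (x : Plane) :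
    ∃ R, ∀ t, t ∉ Metric.ball 0 R → φ (x - t) = 0 := by
  obtain ⟨R, hR0, hR⟩ := (h.hasCompactSupport_sub x).isCompact.isBounded.exists_pos_norm_le
  refine ⟨R + 1, fun t ht => ?_⟩
  by_contra hne
  have h1 := hR t (subset_tsupport _ hne)
  rw [Metric.mem_ball, dist_zero_right] at ht
  linarith

/-- The principal value of the singular integral. -/
noncomputable def pvIntegral (φ : Plane → ℂ) (x : Plane) : ℂ :=
  limUnder (𝓝[>] (0 : ℝ)) fun ε => conv (regKernel ε) φ x

theorem regKernel_eq {ε : ℝ} (hε : 0 < ε) (t : Plane) :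
    regKernel ε t = kernel t * (‖t‖ ^ 4 / (‖t‖ ^ 2 + ε ^ 2) ^ 2) := by
  rw [regKernel, kernel, regSq_eq]
  rcases eq_or_ne t 0 with rfl | ht
  · simp
  have h0 : 0 < ‖t‖ := norm_pos_iff.2 ht
  have := Real.pi_pos
  field_simp

theorem tendsto_conv_regKernel_aux {φ : Plane → ℂ} (h : IsTest φ) (x : Plane) {R : ℝ}
    (hR : ∀ t, t ∉ Metric.ball 0 R → φ (x - t) = 0) :
    Tendsto (fun ε => conv (regKernel ε) φ x) (𝓝[>] 0)
      (𝓝 (∫ t in Metric.ball 0 R, (kernel t : ℂ) * (φ (x - t) - φ x))) := by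
  have hlim := tendsto_integral_cutoff (η := fun ε r => r ^ 4 / (r ^ 2 + ε ^ 2) ^ 2)
    (fun ε r => ?_) (fun ε => by fun_prop) (fun r hr => ?_) (R := R) (fun ε hε => ?_) h x hR
  · refine hlim.congr' ?_
    filter_upwards [self_mem_nhdsWithin] with ε hε
    simp only [conv, regKernel_eq hε]
  · rw [abs_of_nonneg (by positivity)]
    refine div_le_one_of_le₀ ?_ (by positivity)
    nlinarith [sq_nonneg r, sq_nonneg ε, mul_nonneg (sq_nonneg r) (sq_nonneg ε)]
  · have hc : ContinuousAt (fun ε : ℝ => r ^ 4 / (r ^ 2 + ε ^ 2) ^ 2) 0 := by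
      have : (r ^ 2 + 0 ^ 2) ^ 2 ≠ 0 := by positivity
      exact ContinuousAt.div (by fun_prop) (by fun_prop) this
    have h1 := hc.tendsto.mono_left (nhdsWithin_le_nhds (s := Set.Ioi 0))
    have e : r ^ 4 / (r ^ 2 + 0 ^ 2) ^ 2 = 1 := by
      field_simp
      ring
    rwa [e] at h1
  · have e : (fun t : Plane => kernel t * (‖t‖ ^ 4 / (‖t‖ ^ 2 + ε ^ 2) ^ 2)) = regKernel ε :=
      funext fun t => (regKernel_eq hε t).symm
    simp only [e]
    exact ((continuous_regKernel hε.ne').continuousOn.integrableOn_compact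
      (isCompact_closedBall 0 R)).mono_set Metric.ball_subset_closedBall

theorem tendsto_conv_regKernel {φ : Plane → ℂ} (h : IsTest φ) (x : Plane) :
    Tendsto (fun ε => conv (regKernel ε) φ x) (𝓝[>] 0) (𝓝 (pvIntegral φ x)) :=
  let ⟨_, hR⟩ := exists_ball_support h x
  tendsto_nhds_limUnder ⟨_, tendsto_conv_regKernel_aux h x hR⟩

/-- The sharp truncation and the smooth regularisation are both radial cut-offs of the kernel, so
they share the limit given by `tendsto_integral_cutoff`. -/
theorem tendsto_truncatedIntegral {Ω : Set Plane} (hΩ : IsOpen Ω) {φ : Plane → ℂ} (h : IsTest φ)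
    (hs : tsupport φ ⊆ Ω) (x : Plane) :
    Tendsto (fun ε => truncatedIntegral Ω φ x ε) (𝓝[>] 0) (𝓝 (pvIntegral φ x)) := by
  obtain ⟨R, hR⟩ := exists_ball_support h x
  rw [tendsto_nhds_unique (tendsto_conv_regKernel h x) (tendsto_conv_regKernel_aux h x hR)]
  have hlim := tendsto_integral_cutoff (η := fun ε r => if ε < r then 1 else 0)
    (fun ε r => by split_ifs <;> simp)
    (fun ε => Measurable.ite measurableSet_Ioi measurable_const measurable_const)
    (fun r hr => ?_) (R := R) (fun ε hε => ?_) h x hR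
  · refine hlim.congr fun ε => ?_
    have hm : MeasurableSet {y : Plane | y ∈ Ω ∧ ε < ‖x - y‖} :=
      hΩ.measurableSet.inter (measurableSet_lt measurable_const
        (by fun_prop : Measurable fun y : Plane => ‖x - y‖))
    rw [truncatedIntegral, ← integral_indicator hm, ← integral_sub_left_eq_self _ volume x]
    refine integral_congr_ae (ae_of_all _ fun t => ?_)
    simp only [Set.indicator, Set.mem_ofPred_eq, sub_sub_cancel]
    by_cases h1 : ε < ‖x - t‖
    · by_cases h2 : t ∈ Ω
      · simp [h1, h2]
      · have : φ t = 0 := image_eq_zero_of_notMem_tsupport fun h3 => h2 (hs h3)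
        simp [this]
    · simp [h1]
  · refine tendsto_const_nhds.congr' ?_
    filter_upwards [nhdsWithin_le_nhds (eventually_lt_nhds hr)] with ε hε
    simp [hε]
  · have hmeas : Measurable fun t : Plane => kernel t * (if ε < ‖t‖ then (1 : ℝ) else 0) :=
      measurable_kernel.mul (Measurable.ite (measurableSet_lt measurable_const measurable_norm)
        measurable_const measurable_const)
    refine Measure.integrableOn_of_bounded (M := (ε ^ 2)⁻¹) measure_ball_lt_top.ne
      hmeas.aestronglyMeasurable (ae_of_all _ fun t => ?_)
    split_ifs with h1
    · have : (0 : ℝ) < ε := hε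
      rw [mul_one, Real.norm_eq_abs]
      refine (abs_kernel_le t).trans ?_
      gcongr
    · simp
      positivity

theorem aestronglyMeasurable_conv_regKernel {ε : ℝ} (hε : ε ≠ 0) {φ : Plane → ℂ} (h : IsTest φ) :
    AEStronglyMeasurable (conv (regKernel ε) φ) volume :=
  (continuous_conv (continuous_regKernel hε) h).aestronglyMeasurable

theorem tendsto_conv_regKernel_seq {φ : Plane → ℂ} (h : IsTest φ) (x : Plane) :
    Tendsto (fun n : ℕ => conv (regKernel ((n : ℝ) + 1)⁻¹) φ x) atTop (𝓝 (pvIntegral φ x)) := by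
  refine (tendsto_conv_regKernel h x).comp (tendsto_nhdsWithin_iff.2 ⟨?_, ?_⟩)
  · exact tendsto_inv_atTop_zero.comp
      (tendsto_atTop_add_const_right _ (1 : ℝ) tendsto_natCast_atTop_atTop)
  · exact Eventually.of_forall fun n => by
      rw [Set.mem_Ioi]
      positivity

theorem aestronglyMeasurable_pvIntegral {φ : Plane → ℂ} (h : IsTest φ) :
    AEStronglyMeasurable (pvIntegral φ) (volume : Measure Plane) :=
  aestronglyMeasurable_of_tendsto_ae atTop
    (fun n : ℕ => aestronglyMeasurable_conv_regKernel (ε := ((n : ℝ) + 1)⁻¹) (by positivity) h)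
    (ae_of_all _ fun x => tendsto_conv_regKernel_seq h x)

/-- Fatou's lemma along `ε = 1 / (n + 1)`, since the bound for the regularised operators is uniform
in `ε`. -/
theorem eLpNorm_pvIntegral_le {φ : Plane → ℂ} (h : IsTest φ) :
    eLpNorm (pvIntegral φ) 2 volume ≤ ENNReal.ofReal (1 / 2) * eLpNorm φ 2 volume := by
  refine (Lp.eLpNorm_lim_le_liminf_eLpNorm (fun n : ℕ => aestronglyMeasurable_conv_regKernel
    (ε := ((n : ℝ) + 1)⁻¹) (by positivity) h) _
    (ae_of_all _ fun x => tendsto_conv_regKernel_seq h x)).trans ?_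
  refine liminf_le_of_le (by isBoundedDefault) fun b hb => ?_
  obtain ⟨n, hn⟩ := hb.exists
  exact hn.trans (eLpNorm_regKernel_le (by positivity) h)

theorem pvIntegral_add {φ ψ : Plane → ℂ} (hφ : IsTest φ) (hψ : IsTest ψ) (h : IsTest (φ + ψ)) :
    pvIntegral (φ + ψ) = pvIntegral φ + pvIntegral ψ := by
  ext x
  refine tendsto_nhds_unique (tendsto_conv_regKernel h x)
    (((tendsto_conv_regKernel hφ x).add (tendsto_conv_regKernel hψ x)).congr' ?_)
  filter_upwards [self_mem_nhdsWithin] with ε hε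
  have hc := continuous_regKernel (ne_of_gt (show (0 : ℝ) < ε from hε))
  rw [conv, conv, conv, ← integral_add (integrable_conv hc hφ x) (integrable_conv hc hψ x)]
  simp only [Pi.add_apply, mul_add]

theorem pvIntegral_smul (c : ℂ) {φ : Plane → ℂ} (hφ : IsTest φ) (h : IsTest (c • φ)) :
    pvIntegral (c • φ) = c • pvIntegral φ := by
  ext x
  refine tendsto_nhds_unique (tendsto_conv_regKernel h x)
    (((tendsto_conv_regKernel hφ x).const_mul c).congr fun ε => ?_)
  rw [conv, conv, ← integral_const_mul]
  simp only [Pi.smul_apply, smul_eq_mul, mul_left_comm]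

theorem IsTest.memLp {φ : Plane → ℂ} (h : IsTest φ) : MemLp φ 2 volume :=
  h.continuous.memLp_of_hasCompactSupport h.hasCompactSupport

theorem memLp_pvIntegral {φ : Plane → ℂ} (h : IsTest φ) : MemLp (pvIntegral φ) 2 volume :=
  ⟨aestronglyMeasurable_pvIntegral h, (eLpNorm_pvIntegral_le h).trans_lt
    (ENNReal.mul_lt_top ENNReal.ofReal_lt_top h.memLp.2)⟩

/-! ### The singular integral operator on `L²(Ω)` and its resolvent. -/

/-- The test functions on `Ω`. -/
def testSpace (Ω : Set Plane) : Submodule ℂ (Plane → ℂ) where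
  carrier := {φ | IsTest φ ∧ tsupport φ ⊆ Ω}
  add_mem' := fun ha hb => ⟨⟨ha.1.contDiff.add hb.1.contDiff,
    ha.1.hasCompactSupport.add hb.1.hasCompactSupport⟩,
    (tsupport_add _ _).trans (Set.union_subset ha.2 hb.2)⟩
  zero_mem' := ⟨⟨contDiff_const, HasCompactSupport.zero⟩, by simp [tsupport]⟩
  smul_mem' := fun c φ h => ⟨⟨contDiff_const.smul h.1.contDiff,
    h.1.hasCompactSupport.smul_left (f := fun _ => c)⟩,
    (tsupport_smul_subset_right (fun _ => c) φ).trans h.2⟩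

/-- The inclusion of the test functions into `L²(Ω)`. -/
noncomputable def testToL2 (Ω : Set Plane) : testSpace Ω →ₗ[ℂ] L2 Ω where
  toFun φ := (φ.2.1.memLp.restrict Ω).toLp φ.1
  map_add' _ _ := rfl
  map_smul' _ _ := rfl

/-- The singular integral as a map from the test functions to `L²(Ω)`. -/
noncomputable def pvToL2 (Ω : Set Plane) : testSpace Ω →ₗ[ℂ] L2 Ω where
  toFun φ := ((memLp_pvIntegral φ.2.1).restrict Ω).toLp (pvIntegral φ.1)
  map_add' φ ψ := by
    rw [← MemLp.toLp_add]
    exact MemLp.toLp_congr _ _ (by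
      rw [← pvIntegral_add φ.2.1 ψ.2.1 (φ + ψ).2.1]
      rfl)
  map_smul' c φ := by
    rw [RingHom.id_apply, ← MemLp.toLp_const_smul]
    exact MemLp.toLp_congr _ _ (by
      rw [← pvIntegral_smul c φ.2.1 (c • φ).2.1]
      rfl)

theorem norm_pvToL2_le (Ω : Set Plane) (φ : testSpace Ω) :
    ‖pvToL2 Ω φ‖ ≤ 1 / 2 * ‖testToL2 Ω φ‖ := by
  have h1 : ‖pvToL2 Ω φ‖ = (eLpNorm (pvIntegral φ.1) 2 (volume.restrict Ω)).toReal :=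
    Lp.norm_toLp _ ((memLp_pvIntegral φ.2.1).restrict Ω)
  have h2 : ‖testToL2 Ω φ‖ = (eLpNorm φ.1 2 (volume.restrict Ω)).toReal :=
    Lp.norm_toLp _ (φ.2.1.memLp.restrict Ω)
  rw [h1, h2, eLpNorm_restrict_eq_of_support_subset ((subset_tsupport _).trans φ.2.2),
    ← ENNReal.toReal_ofReal (show (0 : ℝ) ≤ 1 / 2 by norm_num), ← ENNReal.toReal_mul]
  refine ENNReal.toReal_mono (ENNReal.mul_ne_top ENNReal.ofReal_ne_top φ.2.1.memLp.2.ne) ?_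
  exact (eLpNorm_restrict_le _ _ _ _).trans (eLpNorm_pvIntegral_le φ.2.1)

/-- A function orthogonal to all real test functions vanishes by the fundamental lemma of the
calculus of variations, so the orthogonal complement is trivial. -/
theorem denseRange_testToL2 {Ω : Set Plane} (hΩ : IsOpen Ω) : DenseRange (testToL2 Ω) := by
  have hbot : (LinearMap.range (testToL2 Ω))ᗮ = ⊥ := by
    rw [Submodule.eq_bot_iff]
    intro u hu
    rw [Submodule.mem_orthogonal] at hu
    have hzero := hΩ.ae_eq_zero_of_integral_contDiff_smul_eq_zero (f := u)
      (μ := volume.restrict Ω)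
      (((Lp.memLp u).locallyIntegrable (by norm_num)).locallyIntegrableOn Ω)
      (fun g hg hgc hgs => by
        have hsupp : tsupport (fun x => (g x : ℂ)) ⊆ tsupport g :=
          closure_mono fun x hx => by
            rw [Function.mem_support] at *
            exact_mod_cast hx
        have hφ : (fun x => (g x : ℂ)) ∈ testSpace Ω :=
          ⟨⟨Complex.ofRealCLM.contDiff.comp hg,
            hgc.comp_left (g := fun r : ℝ => (r : ℂ)) Complex.ofReal_zero⟩, hsupp.trans hgs⟩
        have h := hu _ ⟨⟨_, hφ⟩, rfl⟩
        rw [L2.inner_def] at h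
        rw [← h]
        refine integral_congr_ae ?_
        filter_upwards [((show IsTest fun x => (g x : ℂ) from hφ.1).memLp.restrict Ω).coeFn_toLp]
          with x hx
        have hx' : testToL2 Ω ⟨_, hφ⟩ x = (g x : ℂ) := hx
        rw [hx', RCLike.inner_apply, Complex.conj_ofReal, Complex.real_smul, mul_comm])
    refine (Lp.eq_zero_iff_ae_eq_zero).2 ?_
    filter_upwards [hzero, ae_restrict_mem hΩ.measurableSet] with x hx hx'
    exact hx hx'
  have := (Submodule.topologicalClosure_eq_top_iff).2 hbot
  exact (Submodule.dense_iff_topologicalClosure_eq_top).2 this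

theorem IsSingularIntegralOperator.apply_testToL2 {Ω : Set Plane} (hΩ : IsOpen Ω)
    {A : L2 Ω →L[ℂ] L2 Ω} (hA : IsSingularIntegralOperator Ω A) (φ : testSpace Ω) :
    A (testToL2 Ω φ) = pvToL2 Ω φ := by
  refine Lp.ext ?_
  have h1 := hA φ.1 φ.2.1.contDiff φ.2.1.hasCompactSupport φ.2.2 (testToL2 Ω φ)
    (φ.2.1.memLp.restrict Ω).coeFn_toLp
  have h2 : pvToL2 Ω φ =ᵐ[volume.restrict Ω] pvIntegral φ.1 :=
    ((memLp_pvIntegral φ.2.1).restrict Ω).coeFn_toLp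
  filter_upwards [h1, h2] with x hx hx'
  rw [hx']
  exact tendsto_nhds_unique hx (tendsto_truncatedIntegral hΩ φ.2.1 φ.2.2 x)

theorem isSingularIntegralOperator_of_apply {Ω : Set Plane} (hΩ : IsOpen Ω)
    {A : L2 Ω →L[ℂ] L2 Ω} (hA : ∀ φ, A (testToL2 Ω φ) = pvToL2 Ω φ) :
    IsSingularIntegralOperator Ω A := by
  intro φ h1 h2 h3 u hu
  have hφ : φ ∈ testSpace Ω := ⟨⟨h1, h2⟩, h3⟩
  have hue : u = testToL2 Ω ⟨φ, hφ⟩ :=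
    Lp.ext (hu.trans ((hφ.1.memLp.restrict Ω).coeFn_toLp).symm)
  have h4 : pvToL2 Ω ⟨φ, hφ⟩ =ᵐ[volume.restrict Ω] pvIntegral φ :=
    ((memLp_pvIntegral hφ.1).restrict Ω).coeFn_toLp
  filter_upwards [h4] with x hx
  rw [hue, hA, hx]
  exact tendsto_truncatedIntegral hΩ hφ.1 h3 x

/-- Identifies any such operator with the bounded extension from test functions; uniqueness and the
norm bound `1 / 2` both follow from this. -/
theorem IsSingularIntegralOperator.eq_extendOfNorm {Ω : Set Plane} (hΩ : IsOpen Ω)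
    {A : L2 Ω →L[ℂ] L2 Ω} (hA : IsSingularIntegralOperator Ω A) :
    (pvToL2 Ω).extendOfNorm (testToL2 Ω) = A :=
  LinearMap.extendOfNorm_unique (denseRange_testToL2 hΩ) (1 / 2) (norm_pvToL2_le Ω) A
    (LinearMap.ext fun φ => hA.apply_testToL2 hΩ φ)

theorem existsUnique_singularIntegralOperator {Ω : Set Plane} (hΩ : IsOpen Ω) :
    ∃! A : L2 Ω →L[ℂ] L2 Ω, IsSingularIntegralOperator Ω A :=
  ⟨(pvToL2 Ω).extendOfNorm (testToL2 Ω), isSingularIntegralOperator_of_apply hΩ fun φ =>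
    LinearMap.extendOfNorm_eq (denseRange_testToL2 hΩ) ⟨_, norm_pvToL2_le Ω⟩ φ,
    fun _ hA => (hA.eq_extendOfNorm hΩ).symm⟩

theorem IsSingularIntegralOperator.norm_le {Ω : Set Plane} (hΩ : IsOpen Ω)
    {A : L2 Ω →L[ℂ] L2 Ω} (hA : IsSingularIntegralOperator Ω A) : ‖A‖ ≤ 1 / 2 := by
  rw [← hA.eq_extendOfNorm hΩ]
  exact LinearMap.opNorm_extendOfNorm_le (denseRange_testToL2 hΩ) (by norm_num) (norm_pvToL2_le Ω)

theorem wellPosed_of_norm_lt {Ω : Set Plane} {A : L2 Ω →L[ℂ] L2 Ω} {lam : ℂ}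
    (h : ‖A‖ < ‖lam‖) : WellPosed A lam := by
  have hres : lam ∈ resolventSet ℂ A := by
    -- The Neumann series criterion carries a factor `‖1‖`; only `‖1‖ ≤ 1` is used, so nontriviality
    -- of the space plays no role.
    refine spectrum.mem_resolventSet_of_norm_lt_mul (lt_of_le_of_lt ?_ h)
    exact mul_le_of_le_one_right (norm_nonneg _) ContinuousLinearMap.norm_id_le
  have happ : ∀ u, (algebraMap ℂ (L2 Ω →L[ℂ] L2 Ω) lam - A) u = lam • u - A u := fun u => by
    rw [Algebra.algebraMap_eq_smul_one]
    rfl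
  obtain ⟨B, hB⟩ := hres
  have hl : ∀ u, (↑B⁻¹ : L2 Ω →L[ℂ] L2 Ω) (lam • u - A u) = u := fun u => by
    have := congrArg (fun T : L2 Ω →L[ℂ] L2 Ω => T u) B.inv_mul
    rw [hB] at this
    rw [← happ]
    exact this
  have hr : ∀ f, lam • (↑B⁻¹ : L2 Ω →L[ℂ] L2 Ω) f - A ((↑B⁻¹ : L2 Ω →L[ℂ] L2 Ω) f) = f :=
      fun f => by
    have := congrArg (fun T : L2 Ω →L[ℂ] L2 Ω => T f) B.mul_inv
    rw [hB] at this
    rw [← happ]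
    exact this
  refine ⟨fun f => ⟨_, hr f, fun u hu => ?_⟩, ‖(↑B⁻¹ : L2 Ω →L[ℂ] L2 Ω)‖, fun u f hu => ?_⟩
  · rw [← hu, hl]
  · have := ContinuousLinearMap.le_opNorm (↑B⁻¹ : L2 Ω →L[ℂ] L2 Ω) f
    rwa [← hu, hl, hu] at this

end SingularIntegral

end DeltaDelta

theorem corollaryC (Ω : Set Plane) (hΩo : IsOpen Ω) (hΩn : Ω.Nonempty)
    (hΩ : Bornology.IsBounded Ω) (a : ℕ+ → Plane) :
    -- the series of the symbol converges, its range is `[-Λ₊, Λ₊]`, and `Λ₊ > 1/2`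
    (∀ τ : Fin 2 → ℝ,
      Filter.Tendsto (symbolPartialSum τ) Filter.atTop (𝓝 (symbol τ))) ∧
    symbol '' periodSquare = segmentC ∧
    1 / 2 < lambdaPlus ∧
    -- unique solvability of the discrete system and uniform resolvent bound
    (∀ lam : ℂ, lam ∉ segmentC → ∀ N : ℕ+,
      (∀ f : gridIndex hΩ (a N) N → ℂ, ∃! u : gridIndex hΩ (a N) N → ℂ,
        (lam • 1 - systemMatrix hΩ (a N) N).mulVec u = f) ∧
      resolventNorm hΩ (a N) N lam ≤ (Metric.infDist lam segmentC)⁻¹) ∧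
    -- the integral equation is well posed, but the discretization is unstable
    (∃! A : L2 Ω →L[ℂ] L2 Ω, IsSingularIntegralOperator Ω A) ∧
    (∀ A : L2 Ω →L[ℂ] L2 Ω, IsSingularIntegralOperator Ω A →
      ∀ lam : ℝ,
        lam ∈ Set.Ico (-lambdaPlus) (-(1 / 2)) ∪ Set.Ioc (1 / 2) lambdaPlus →
          WellPosed A (lam : ℂ) ∧ ¬ Stable hΩ a (lam : ℂ)) := by
  have hL := half_lt_lambdaPlus
  refine ⟨tendsto_symbolPartialSum, symbol_image, hL,
    fun lam hlam N => discrete_stability hΩ (a N) N hlam,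
    existsUnique_singularIntegralOperator hΩo, fun A hA lam hlam => ⟨?_, ?_⟩⟩
  · refine wellPosed_of_norm_lt ((hA.norm_le hΩo).trans_lt ?_)
    rw [Complex.norm_real, Real.norm_eq_abs, lt_abs]
    rcases hlam with h | h
    · exact Or.inr (by linarith [h.2])
    · exact Or.inl h.1
  · refine not_stable hΩo hΩn hΩ a ?_
    rcases hlam with h | h
    · exact ⟨h.1, by linarith [h.2]⟩
    · exact ⟨by linarith [h.1], h.2⟩
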